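/- Let $K$ be a field, $X$ a finite totally ordered set, $V=KX$, and let $X^{(m)}$ be the set of words of length $m$ in $X$, ordered lexicographically. Identify $V^{\otimes m}$ with $KX^{(m)}$ and $T(V)$ with the free algebra $K\langle X\rangle$. For $f\neq 0$ in $V^{\otimes m}$ let $\mathrm{lm}(f)$ be the greatest word occurring in $f$. For elements $t,s$ of a monoid let $\langle t,s\rangle^k=\cdots sts$ ($k$ factors). **Presentation.** Let $N\ge 2$, let $R\subset V^{\otimes N}$ consist of elements with leading coefficient $1$, let $\overline R$ be its span, and let $A\simeq K\langle X\rangle/I(R)$, where $I(R)$ is the two-sided ideal generated by $R$; write $\overline f\in A$ for the class of $f\in T(V)$ and $\varepsilon:A\to K$ for the augmentation ($\overline x\mapsto 0$ for $x \in X$). Put $I(R)_m=\sum_{i+N+j=m}V^{\otimes i}\otimes\overline R\otimes V^{\otimes j}$. The reductions are the endomorphisms $r_{ufv}$ of $T(V)$ ($u,v$ words, $f\in R$) that send $u\,\mathrm{lm}(f)\,v$ to $u(\mathrm{lm}(f)-f)v$ and fix all other words; a normal form is an element fixed by all reductions, and a normal form of $f$ is a normal form obtained from $f$ by finitely many reductions.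 Assume that $\langle X\mid R\rangle$ is reduced: for all $f\in R$, $\mathrm{lm}(f)-f$ is a normal form for $R$ and $\mathrm{lm}(f)$ is a normal form for $R\setminus\{f\}$. Let $S\in\mathrm{End}(V^{\otimes N})$ be given by $S(\mathrm{lm}(f))=\mathrm{lm}(f)-f$ for $f\in R$ and $S(w)=w$ for all other words $w$. Assume that the presentation is *extra-confluent*: * (side-confluence) for $1\le m\le N-1$ there is $k\ge 1$ with $\langle \mathrm{id}_{V^{\otimes m}}\otimes S,\,S\otimes\mathrm{id}_{V^{\otimes m}}\rangle^k=\langle S\otimes\mathrm{id}_{V^{\otimes m}},\,\mathrm{id}_{V^{\otimes m}}\otimes S\rangle^k$; * (extra-condition) $(V^{\otimes n}\otimes\overline R)\cap(\overline R\otimes V^{\otimes n})\subset V^{\otimes n-1}\otimes\overline R\otimes V$ for $2\le n\le N-1$. **Koszul complex.** Let $l_N(2k)=kN$, $l_N(2k+1)=kN+1$; $J_0=K$, $J_1=V$ and $J_n=\bigcap_{i+N+j=l_N(n)}V^{\otimes i}\otimes\overline R\otimes V^{\otimes j}\subset V^{\otimes l_N(n)}$ for $n\ge 2$. The Koszul complex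 of $A$ is $\cdots\to A\otimes J_n\xrightarrow{\partial_n}A\otimes J_{n-1}\to\cdots\to A\otimes J_1\xrightarrow{\partial_1}A\xrightarrow{\varepsilon}K\to 0$, where $\partial_n$ is the restriction of the $A$-linear map $1\otimes w_1w_2\mapsto\overline{w_1}\otimes w_2$ ($w_1w_2\in X^{(l_N(n))}$, $w_2\in X^{(l_N(n-1))}$). **Left bound.** For a finite totally ordered set $Y$, a reduction operator relatively to $Y$ is a linear projector $T$ of $KY$ such that for all $y\in Y$ either $T(y)=y$, or all elements of $Y$ occurring in $T(y)$ are $<y$; $T\mapsto\ker T$ is a bijection $\theta_Y$ from reduction operators to subspaces of $KY$. For $m\ge l_N(n)$ let $$F_1^{n,m}=\theta_{X^{(m)}}^{-1}\bigl(I(R)_{m-l_N(n)}\otimes V^{\otimes l_N(n)}\bigr),\qquad F_2^{n,m}=\begin{cases}\mathrm{id}&m<l_N(n+1),\\ \theta_{X^{(m)}}^{-1}\bigl(V^{\otimes m-l_N(n+1)}\otimes J_{n+1}\bigr)&\text{otherwise,}\end{cases}$$ and $P_{n,m}=(F_1^{n,m},F_2^{n,m})$. For $k\ge1$ let $\mathcal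 A_k=\langle s_1,s_2\mid s_i^2=s_i,\ \langle s_1,s_2\rangle^k=\langle s_2,s_1\rangle^k\rangle$ be the confluence algebra of degree $k$, and $\gamma_1=(1-s_2)\sum_i\langle s_2,s_1\rangle^i\in\mathcal A_k$, the sum being over the odd integers $i$ with $1\le i\le k-1$. If $\langle F_1^{n,m},F_2^{n,m}\rangle^{k}=\langle F_2^{n,m},F_1^{n,m}\rangle^{k}$ with $k=k_{n,m}\ge 1$, let $\varphi^{P_{n,m}}:\mathcal A_k\to\mathrm{End}(V^{\otimes m})$ be the morphism of algebras $s_i\mapsto F_i^{n,m}$, and let $h'_n$ be the linear map on $\bigoplus_{m\ge l_N(n)}V^{\otimes m}$ that is $\varphi^{P_{n,m}}(\gamma_1)$ on $V^{\otimes m}$. **Theorem.** Under these hypotheses: 1. all pairs $P_{n,m}$ ($m\ge l_N(n)$) are confluent, i.e. integers $k_{n,m}\geq 1$ as above exist; 2. every $f\in T(V)$ has a unique normal form $\widehat f$, and $\overline f\mapsto\widehat f$ is a well-defined linear map $\overline\phi:A\to T(V)$; put $\phi_n=\overline\phi\otimes\mathrm{id}:A\otimes J_n\to T(V)$; 3.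 there is exactly one family of $K$-linear maps $h_n:A\otimes J_n\to A\otimes J_{n+1}$, $n\ge0$, with $\phi_{n+1}\circ h_n=h'_n\circ\phi_n$ (the *left bound* of $\langle X\mid R\rangle$), and it does not depend on the choice of the $k_{n,m}$; 4. the left bound, together with $h_{-1}:K\to A$, $1\mapsto 1$, is a contracting homotopy for the Koszul complex of $A$: $\varepsilon h_{-1}=\mathrm{id}_K$, $\partial_1h_0+h_{-1}\varepsilon=\mathrm{id}_A$ and $\partial_{n+1}h_n+h_{n-1}\partial_n=\mathrm{id}_{A\otimes J_n}$ for $n\ge1$. In particular the Koszul complex of $A$ is acyclic (exact). -/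

import Mathlib

open scoped TensorProduct

noncomputable section

namespace KoszulHomotopy

/-! ### Reduction operators on the vector space `Y →₀ K` spanned by a finite ordered set `Y` -/

section ReductionOperators

variable {K Y : Type*} [Field K] [LinearOrder Y]

/-- The leading monomial of `v`: the greatest basis element occurring in `v` (`⊥` if `v = 0`). -/
def lm (v : Y →₀ K) : WithBot Y := v.support.max

/-- A reduction operator relatively to `Y`: a linear projector `T` such that, for every `y` in `Y`,
either `T y = y` or `T y < y` (i.e. `T y = 0` or the leading monomial of `T y` is `< y`). -/
def IsReductionOperator (T : Module.End K (Y →₀ K)) : Prop :=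
  T * T = T ∧ ∀ y : Y, T (Finsupp.single y 1) = Finsupp.single y 1 ∨
    lm (T (Finsupp.single y 1)) < (y : WithBot Y)

variable (K Y) in
/-- The set `Red(Y)` of reduction operators relatively to `Y`. -/
def Red : Type _ := {T : Module.End K (Y →₀ K) // IsReductionOperator T}

/-- The map `θ_Y : T ↦ ker T` from `Red(Y)` to the subspaces of `K Y`. -/
def theta (T : Red K Y) : Submodule K (Y →₀ K) := LinearMap.ker T.1

theorem lm_lt_iff {v : Y →₀ K} {y : Y} : lm v < (y : WithBot Y) ↔ ∀ z, v z ≠ 0 → z < y := by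
  unfold lm
  rw [Finset.max_eq_sup_withBot, Finset.sup_lt_iff (WithBot.bot_lt_coe y)]
  simp

theorem lm_eq_iff {v : Y →₀ K} {y : Y} :
    lm v = (y : WithBot Y) ↔ v y ≠ 0 ∧ ∀ z, v z ≠ 0 → z ≤ y := by
  unfold lm
  constructor
  · intro h
    refine ⟨by simpa using Finset.mem_of_max h, fun z hz => ?_⟩
    exact Finset.le_max_of_eq (by simpa using hz) h
  · rintro ⟨h1, h2⟩
    apply le_antisymm
    · rw [Finset.max_eq_sup_withBot]
      exact Finset.sup_le fun z hz => WithBot.coe_le_coe.2 (h2 z (by simpa using hz))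
    · exact Finset.le_max (by simpa using h1)

theorem lm_eq_bot_iff {v : Y →₀ K} : lm v = ⊥ ↔ v = 0 := by
  unfold lm
  rw [Finset.max_eq_bot, Finsupp.support_eq_empty]

/-- Basis elements that are not leading monomials of elements of `W`. -/
def normalSet (W : Submodule K (Y →₀ K)) : Set Y := {y | ∀ w ∈ W, lm w ≠ (y : WithBot Y)}

theorem exists_normal_rep [Finite Y] (W : Submodule K (Y →₀ K)) (y : Y) :
    ∃ u : Y →₀ K, Finsupp.single y 1 - u ∈ W ∧ (∀ z, u z ≠ 0 → z ∈ normalSet W) ∧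
      (u = Finsupp.single y 1 ∨ ∀ z, u z ≠ 0 → z < y) := by
  classical
  induction y using WellFoundedLT.induction with
  | ind y ih =>
    by_cases hy : y ∈ normalSet W
    · refine ⟨Finsupp.single y 1, by simp, ?_, Or.inl rfl⟩
      intro z hz
      by_cases h : z = y
      · exact h ▸ hy
      · exact absurd (Finsupp.single_eq_of_ne h) hz
    · obtain ⟨w, hw, hwy⟩ : ∃ w ∈ W, lm w = (y : WithBot Y) := by
        simpa [normalSet] using hy
      rw [lm_eq_iff] at hwy
      choose! u hu1 hu2 hu3 using ih
      -- reduce `y` to `y - w / lc w`, all of whose monomials are `< y`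
      set v : Y →₀ K := Finsupp.single y 1 - (w y)⁻¹ • w with hv
      have hvlt : ∀ z, v z ≠ 0 → z < y := by
        intro z hz
        rcases lt_trichotomy z y with h | h | h
        · exact h
        · subst h
          simp [hv, hwy.1] at hz
        · have : w z = 0 := by
            by_contra hne
            exact absurd (hwy.2 z hne) (not_le.2 h)
          simp [hv, this, h.ne] at hz
      have hsum : ∀ z, (v.sum fun x c => c • u x) z ≠ 0 → ∃ x, v x ≠ 0 ∧ u x z ≠ 0 := by
        intro z hz
        rw [Finsupp.sum, Finsupp.finsetSum_apply] at hz
        obtain ⟨x, hx, hxz⟩ := Finset.exists_ne_zero_of_sum_ne_zero hz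
        refine ⟨x, by simpa using hx, fun h0 => hxz (by simp [h0])⟩
      refine ⟨v.sum fun x c => c • u x, ?_, ?_, Or.inr ?_⟩
      · have h1 : v - (v.sum fun x c => c • u x) ∈ W := by
          have : v - (v.sum fun x c => c • u x)
              = ∑ x ∈ v.support, v x • (Finsupp.single x 1 - u x) := by
            simp only [smul_sub, Finset.sum_sub_distrib]
            congr 1
            conv_lhs => rw [← Finsupp.sum_single v]
            simp [Finsupp.sum]
          rw [this]
          exact Submodule.sum_mem _ fun x hx =>
            W.smul_mem _ (hu1 x (hvlt x (by simpa using hx)))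
        have h2 := W.add_mem h1 (W.smul_mem (w y)⁻¹ hw)
        have e : v - (v.sum fun x c => c • u x) + (w y)⁻¹ • w
            = Finsupp.single y 1 - (v.sum fun x c => c • u x) := by
          rw [hv]; abel
        rwa [e] at h2
      · intro z hz
        obtain ⟨x, hx, hxz⟩ := hsum z hz
        exact hu2 x (hvlt x hx) z hxz
      · intro z hz
        obtain ⟨x, hx, hxz⟩ := hsum z hz
        have hxy := hvlt x hx
        rcases hu3 x hxy with h | h
        · rw [h] at hxz
          by_cases hzx : z = x
          · exact hzx ▸ hxy
          · exact absurd (Finsupp.single_eq_of_ne hzx) hxz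
        · exact (h z hxz).trans hxy

theorem eq_zero_of_mem_of_normal (W : Submodule K (Y →₀ K)) {v : Y →₀ K} (hv : v ∈ W)
    (h : ∀ z, v z ≠ 0 → z ∈ normalSet W) : v = 0 := by
  by_contra hne
  obtain ⟨y, hy⟩ := WithBot.ne_bot_iff_exists.1 (mt lm_eq_bot_iff.1 hne)
  exact h y (lm_eq_iff.1 hy.symm).1 v hv hy.symm

theorem single_ne_zero_cases {y z : Y} (h : (Finsupp.single y (1 : K)) z ≠ 0) : z = y := by
  by_contra hne
  exact h (Finsupp.single_eq_of_ne hne)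

theorem normal_sum {W : Submodule K (Y →₀ K)} {u : Y → Y →₀ K}
    (hu : ∀ y z, u y z ≠ 0 → z ∈ normalSet W) (v : Y →₀ K) (z : Y)
    (hz : Finsupp.linearCombination K u v z ≠ 0) : z ∈ normalSet W := by
  rw [Finsupp.linearCombination_apply, Finsupp.sum, Finsupp.finsetSum_apply] at hz
  obtain ⟨x, _, hxz⟩ := Finset.exists_ne_zero_of_sum_ne_zero hz
  exact hu x z fun h0 => hxz (by simp [h0])

theorem sub_linearCombination_mem {K Y : Type*} [Field K]
    {W : Submodule K (Y →₀ K)} {u : Y → Y →₀ K}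
    (hu : ∀ y, Finsupp.single y 1 - u y ∈ W) (v : Y →₀ K) :
    v - Finsupp.linearCombination K u v ∈ W := by
  induction v using Finsupp.induction_linear with
  | zero => simp
  | add f g hf hg =>
    rw [map_add, add_sub_add_comm]
    exact W.add_mem hf hg
  | single a b =>
    have := W.smul_mem b (hu a)
    simpa [smul_sub] using this

theorem theta_surjective [Finite Y] : Function.Surjective (theta (K := K) (Y := Y)) := by
  intro W
  choose u hu1 hu2 hu3 using exists_normal_rep W
  have hmem := sub_linearCombination_mem hu1
  have hker : LinearMap.ker (Finsupp.linearCombination K u) = W := by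
    ext v
    rw [LinearMap.mem_ker]
    constructor
    · intro h
      simpa [h] using hmem v
    · intro h
      refine eq_zero_of_mem_of_normal W ?_ (normal_sum hu2 v)
      have := W.sub_mem h (hmem v)
      simpa using this
  refine ⟨⟨Finsupp.linearCombination K u, ?_, ?_⟩, hker⟩
  · refine LinearMap.ext fun v => ?_
    have h1 : v - Finsupp.linearCombination K u v ∈ LinearMap.ker (Finsupp.linearCombination K u) :=
      hker ▸ hmem v
    rw [LinearMap.mem_ker, map_sub, sub_eq_zero] at h1
    exact h1.symm
  · intro y
    simp only [Finsupp.linearCombination_single, one_smul]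
    exact (hu3 y).imp id fun h => lm_lt_iff.2 h

theorem theta_injective [Finite Y] : Function.Injective (theta (K := K) (Y := Y)) := by
  -- the values of a reduction operator are combinations of elements of `normalSet (ker T)`
  have key : ∀ (T : Red K Y) (v : Y →₀ K) (z : Y), T.1 v z ≠ 0 → z ∈ normalSet (theta T) := by
    intro T v
    obtain ⟨hT, hred⟩ := T.2
    have hTT : ∀ x, T.1 (T.1 x) = T.1 x := fun x => LinearMap.congr_fun hT x
    choose u hu1 hu2 hu3 using exists_normal_rep (theta T)
    -- a normal `y` is fixed by `T`
    have hfix : ∀ y ∈ normalSet (theta T), T.1 (Finsupp.single y 1) = Finsupp.single y 1 := by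
      intro y hy
      rcases hred y with h | h
      · exact h
      · exfalso
        rw [lm_lt_iff] at h
        refine hy (Finsupp.single y 1 - T.1 (Finsupp.single y 1)) ?_ ?_
        · rw [theta, LinearMap.mem_ker, map_sub, hTT, sub_self]
        · rw [lm_eq_iff]
          have h0 : T.1 (Finsupp.single y 1) y = 0 := by
            by_contra hne
            exact lt_irrefl _ (h y hne)
          refine ⟨by simp [h0], fun z hz => ?_⟩
          by_contra hzy
          rw [not_le] at hzy
          have h1 : T.1 (Finsupp.single y 1) z = 0 := by
            by_contra hne
            exact lt_asymm hzy (h z hne)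
          rw [Finsupp.sub_apply, h1, sub_zero] at hz
          exact hzy.ne' (single_ne_zero_cases hz)
    have hfixv : ∀ w : Y →₀ K, (∀ z, w z ≠ 0 → z ∈ normalSet (theta T)) → T.1 w = w := by
      intro w hw
      conv_lhs => rw [← Finsupp.sum_single w]
      conv_rhs => rw [← Finsupp.sum_single w]
      rw [Finsupp.sum, map_sum]
      refine Finset.sum_congr rfl fun x hx => ?_
      have : Finsupp.single x (w x) = w x • Finsupp.single x (1 : K) := by simp
      rw [this, map_smul, hfix x (hw x (by simpa using hx))]
    have h1 : T.1 v = T.1 (Finsupp.linearCombination K u v) := by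
      have := sub_linearCombination_mem hu1 v
      rwa [theta, LinearMap.mem_ker, map_sub, sub_eq_zero] at this
    rw [h1, hfixv _ (normal_sum hu2 v)]
    exact normal_sum hu2 v
  intro T U h
  apply Subtype.ext
  refine LinearMap.ext fun v => ?_
  have hmem : ∀ (S : Red K Y), v - S.1 v ∈ theta S := by
    intro S
    rw [theta, LinearMap.mem_ker, map_sub, sub_eq_zero]
    exact (LinearMap.congr_fun S.2.1 v).symm
  rw [← sub_eq_zero]
  refine eq_zero_of_mem_of_normal (theta T) ?_ ?_
  · have := (theta T).sub_mem (h ▸ hmem U) (hmem T)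
    simpa using this
  · intro z hz
    by_cases h0 : T.1 v z = 0
    · refine h ▸ key U v z fun h1 => hz (by simp [h0, h1])
    · exact key T v z h0

/-- The inverse `θ_Y⁻¹` of the bijection `T ↦ ker T`: the unique reduction operator with a given
kernel. -/
def thetaInv [Finite Y] (W : Submodule K (Y →₀ K)) : Red K Y :=
  (Equiv.ofBijective theta ⟨theta_injective, theta_surjective⟩).symm W

end ReductionOperators

/-! ### Alternating products, confluence algebras and their representations -/

/-- `altProd t s k` is the product `⟨t, s⟩^k = ⋯ s t s` with `k` factors. -/
def altProd {M : Type*} [Monoid M] : M → M → ℕ → M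
  | _, _, 0 => 1
  | t, s, k + 1 => altProd s t k * s

section ConfluenceAlgebra

variable (K : Type*) [Field K]

/-- The defining relations of the confluence algebra of degree `k`; the generators `s₁`, `s₂` are
indexed by `0` and `1`. -/
inductive ConfluenceRel (k : ℕ) : FreeAlgebra K (Fin 2) → FreeAlgebra K (Fin 2) → Prop
  | idem (i : Fin 2) : ConfluenceRel k (FreeAlgebra.ι K i * FreeAlgebra.ι K i) (FreeAlgebra.ι K i)
  | braid : ConfluenceRel k (altProd (FreeAlgebra.ι K 0) (FreeAlgebra.ι K 1) k)
      (altProd (FreeAlgebra.ι K 1) (FreeAlgebra.ι K 0) k)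

/-- The confluence algebra of degree `k`:
`⟨s₁, s₂ | sᵢ² = sᵢ, ⟨s₁, s₂⟩^k = ⟨s₂, s₁⟩^k⟩`. -/
abbrev ConfluenceAlgebra (k : ℕ) : Type _ := RingQuot (ConfluenceRel K k)

/-- The generators `s₁` (`i = 0`) and `s₂` (`i = 1`) of the confluence algebra. -/
def ConfluenceAlgebra.s (k : ℕ) (i : Fin 2) : ConfluenceAlgebra K k :=
  RingQuot.mkAlgHom K (ConfluenceRel K k) (FreeAlgebra.ι K i)

/-- `γ₁ = (1 - s₂) ∑ ⟨s₂, s₁⟩^i`, the sum being over the odd integers `i` with `1 ≤ i ≤ k - 1`. -/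
def ConfluenceAlgebra.gammaOne (k : ℕ) : ConfluenceAlgebra K k :=
  (1 - s K k 1) * ∑ i ∈ (Finset.range k).filter (fun i => Odd i), altProd (s K k 1) (s K k 0) i

variable {K} {Y : Type*} [LinearOrder Y]

/-- `(T₁, T₂)` satisfies `⟨T₁, T₂⟩^k = ⟨T₂, T₁⟩^k`, where `k ≥ 1`. -/
def ConfluentAt (P : Red K Y × Red K Y) (k : ℕ) : Prop :=
  1 ≤ k ∧ altProd P.1.1 P.2.1 k = altProd P.2.1 P.1.1 k

/-- Confluent pairs of reduction operators. -/
def Confluent (P : Red K Y × Red K Y) : Prop := ∃ k, ConfluentAt P k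

theorem map_altProd {M M' F : Type*} [Monoid M] [Monoid M'] [FunLike F M M']
    [MonoidHomClass F M M'] (f : F) (t s : M) (k : ℕ) :
    f (altProd t s k) = altProd (f t) (f s) k := by
  induction k generalizing t s with
  | zero => simp [altProd]
  | succ k ih => simp [altProd, ih]

/-- The `P`-representation of the confluence algebra of degree `k`: the morphism of algebras
`s₁ ↦ T₁`, `s₂ ↦ T₂`. -/
def pairRep (P : Red K Y × Red K Y) (k : ℕ) (hk : ConfluentAt P k) :
    ConfluenceAlgebra K k →ₐ[K] Module.End K (Y →₀ K) :=
  RingQuot.liftAlgHom K ⟨FreeAlgebra.lift K ![P.1.1, P.2.1], by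
    intro x y h
    cases h with
    | idem i =>
      fin_cases i
      · simpa using P.1.2.1
      · simpa using P.2.2.1
    | braid => simpa [map_altProd] using hk.2⟩

/-- The left bound `φ^P(γ₁)` of a confluent pair `P`. -/
def pairLeftBound (P : Red K Y × Red K Y) (k : ℕ) (hk : ConfluentAt P k) :
    Module.End K (Y →₀ K) :=
  pairRep P k hk (ConfluenceAlgebra.gammaOne K k)

end ConfluenceAlgebra

/-! ### Words and tensor powers

`T(V)` is identified with the space `List X →₀ K` spanned by all words, and `V^{⊗ m}` with the space
`Word X m →₀ K` spanned by the words of length `m`. -/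

/-- The set `X^{(m)}` of words of length `m`. -/
abbrev Word (X : Type*) (m : ℕ) : Type _ := {w : List X // w.length = m}

/-- `V^{⊗ m}`, the vector space spanned by the words of length `m`; words of length `m` are totally
ordered by the lexicographic order. -/
abbrev TensorPow (K X : Type*) [Field K] (m : ℕ) : Type _ := Word X m →₀ K

/-- The space `T(V)` spanned by all words. -/
abbrev TensorAlg (K X : Type*) [Field K] : Type _ := List X →₀ K

instance Word.instFinite (X : Type*) [Finite X] (m : ℕ) : Finite (Word X m) :=
  have := Fintype.ofFinite X
  inferInstanceAs (Finite (List.Vector X m))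

section Words

variable {K X : Type*} [Field K]

/-- The inclusion `V^{⊗ m} ⊂ T(V)`. -/
def incl (m : ℕ) : TensorPow K X m →ₗ[K] TensorAlg K X := Finsupp.lmapDomain K K Subtype.val

/-- The identification of the space spanned by all words with the free algebra `K⟨X⟩`. -/
def toFree : TensorAlg K X →ₗ[K] FreeAlgebra K X :=
  Finsupp.linearCombination K fun w => (w.map (FreeAlgebra.ι K)).prod

/-- The product `f ↦ u f t` of an element of `V^{⊗ p}` with words `u`, `t`. -/
def sandwich {i p j m : ℕ} (h : i + p + j = m) (u : Word X i) (t : Word X j) :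
    TensorPow K X p →ₗ[K] TensorPow K X m :=
  Finsupp.lmapDomain K K fun v =>
    ⟨u.1 ++ v.1 ++ t.1, by simp only [List.length_append, u.2, v.2, t.2, h]⟩

/-- The subspace `V^{⊗ i} ⊗ U ⊗ V^{⊗ j}` of `V^{⊗ m}`, where `U ⊂ V^{⊗ p}` and `i + p + j = m`. -/
def tensorSub (i j : ℕ) {p m : ℕ} (h : i + p + j = m) (U : Submodule K (TensorPow K X p)) :
    Submodule K (TensorPow K X m) :=
  ⨆ (u : Word X i) (t : Word X j), U.map (sandwich h u t)

/-- The operator `id_{V^{⊗ i}} ⊗ T ⊗ id_{V^{⊗ j}}` of `V^{⊗ m}`, where `T` is an endomorphism of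
`V^{⊗ p}` and `i + p + j = m`: it maps a word `u v t` to `u T(v) t`. -/
def tensorOp (i j : ℕ) {p m : ℕ} (h : i + p + j = m) (T : Module.End K (TensorPow K X p)) :
    Module.End K (TensorPow K X m) :=
  Finsupp.linearCombination K fun w : Word X m =>
    sandwich (K := K) h
      ⟨w.1.take i, by have := w.2; rw [List.length_take]; omega⟩
      ⟨w.1.drop (i + p), by have := w.2; rw [List.length_drop]; omega⟩
      (T (Finsupp.single
        ⟨(w.1.drop i).take p, by have := w.2; rw [List.length_take, List.length_drop]; omega⟩ 1))

/-- The multiplication `T(V) ⊗ V^{⊗ p} → T(V)`. -/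
def concat (p : ℕ) : TensorAlg K X ⊗[K] TensorPow K X p →ₗ[K] TensorAlg K X :=
  TensorProduct.lift (Finsupp.linearCombination K fun w : List X =>
    (Finsupp.lmapDomain K K fun v : Word X p => w ++ v.1 : TensorPow K X p →ₗ[K] TensorAlg K X))

end Words

/-! ### Homogeneous presentations -/

/-- An `N`-homogeneous presentation `⟨X | R⟩`: an integer `N ≥ 2` and a set `R ⊂ V^{⊗ N}`. -/
structure HomPresentation (K X : Type*) [Field K] where
  N : ℕ
  two_le : 2 ≤ N
  R : Set (TensorPow K X N)

/-- The function `l_N`: `l_N(2k) = kN` and `l_N(2k+1) = kN + 1`. -/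
def lN (N n : ℕ) : ℕ := N * (n / 2) + n % 2

theorem lN_two_mul (N k : ℕ) : lN N (2 * k) = k * N := by
  simp [lN, Nat.mul_comm]

theorem lN_two_mul_add_one (N k : ℕ) : lN N (2 * k + 1) = k * N + 1 := by
  have h1 : (2 * k + 1) / 2 = k := by omega
  have h2 : (2 * k + 1) % 2 = 1 := by omega
  rw [lN, h1, h2, Nat.mul_comm]

theorem lN_le_succ {N : ℕ} (hN : 2 ≤ N) (n : ℕ) : lN N n ≤ lN N (n + 1) := by
  obtain ⟨k, rfl | rfl⟩ := Nat.even_or_odd' n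
  · rw [lN_two_mul, lN_two_mul_add_one]; omega
  · rw [lN_two_mul_add_one, show 2 * k + 1 + 1 = 2 * (k + 1) by ring, lN_two_mul, Nat.succ_mul]
    omega

namespace HomPresentation

section NormalForms

variable {K X : Type*} [Field K] [LinearOrder X]

/-- The reduction `r_{u f t}`: the endomorphism of `T(V)` that maps the word `u lm(f) t` to
`u (lm(f) - f) t` and fixes all the other words. -/
def reduction {N : ℕ} (u : List X) (f : TensorPow K X N) (t : List X) :
    TensorAlg K X →ₗ[K] TensorAlg K X :=
  open Classical in
  Finsupp.linearCombination K fun w : List X =>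
    if ∃ v : Word X N, lm f = (v : WithBot (Word X N)) ∧ w = u ++ v.1 ++ t then
      Finsupp.single w 1 - Finsupp.mapDomain (fun v : Word X N => u ++ v.1 ++ t) f
    else Finsupp.single w 1

/-- `r` is a reduction of the presentation with set of relations `R`. -/
def IsReduction {N : ℕ} (R : Set (TensorPow K X N)) (r : TensorAlg K X →ₗ[K] TensorAlg K X) :
    Prop :=
  ∃ u t : List X, ∃ f ∈ R, r = reduction u f t

/-- Normal forms: the elements fixed by all the reductions. -/
def IsNormalForm {N : ℕ} (R : Set (TensorPow K X N)) (g : TensorAlg K X) : Prop :=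
  ∀ r, IsReduction R r → r g = g

/-- `g` is a normal form of `f`: it is a normal form and it is obtained from `f` by applying
finitely many reductions. -/
def IsNormalFormOf {N : ℕ} (R : Set (TensorPow K X N)) (f g : TensorAlg K X) : Prop :=
  IsNormalForm R g ∧
    Relation.ReflTransGen (fun a b => ∃ r, IsReduction R r ∧ b = r a) f g

variable (P : HomPresentation K X)

/-- The standing assumptions on presentations: every relation has leading coefficient `1`, and the
presentation is reduced, i.e. for every `f ∈ R`, `lm(f) - f` is a normal form for `⟨X | R⟩` and
`lm(f)` is a normal form for `⟨X | R \ {f}⟩`. -/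
def IsReduced : Prop :=
  ∀ f ∈ P.R, ∃ w : Word X P.N, lm f = (w : WithBot (Word X P.N)) ∧ f w = 1 ∧
    IsNormalForm P.R (incl P.N (Finsupp.single w 1 - f)) ∧
    IsNormalForm (P.R \ {f}) (incl P.N (Finsupp.single w 1))

/-- The operator `S` of the presentation: `S(w) = lm(f) - f` if `w = lm(f)` with `f ∈ R`, and
`S(w) = w` if there is no such `f`. -/
def operatorS : Module.End K (TensorPow K X P.N) :=
  open Classical in
  Finsupp.linearCombination K fun w : Word X P.N =>
    if h : ∃ f ∈ P.R, lm f = (w : WithBot (Word X P.N)) then Finsupp.single w 1 - h.choose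
    else Finsupp.single w 1

/-- Side-confluence: for `1 ≤ m ≤ N - 1` there is `k ≥ 1` such that
`⟨id_{V^{⊗ m}} ⊗ S, S ⊗ id_{V^{⊗ m}}⟩^k = ⟨S ⊗ id_{V^{⊗ m}}, id_{V^{⊗ m}} ⊗ S⟩^k`. -/
def IsSideConfluent : Prop :=
  ∀ m, 1 ≤ m → m ≤ P.N - 1 → ∃ k, 1 ≤ k ∧
    altProd (tensorOp m 0 (by omega : m + P.N + 0 = m + P.N) P.operatorS)
        (tensorOp 0 m (by omega : 0 + P.N + m = m + P.N) P.operatorS) k =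
      altProd (tensorOp 0 m (by omega : 0 + P.N + m = m + P.N) P.operatorS)
        (tensorOp m 0 (by omega : m + P.N + 0 = m + P.N) P.operatorS) k

end NormalForms

section Koszul

variable {K X : Type*} [Field K] (P : HomPresentation K X)

/-- The subspace `R̄` of `V^{⊗ N}` spanned by `R`. -/
def Rbar : Submodule K (TensorPow K X P.N) := Submodule.span K P.R

/-- The extra-condition: `(V^{⊗ n} ⊗ R̄) ∩ (R̄ ⊗ V^{⊗ n}) ⊂ V^{⊗ n - 1} ⊗ R̄ ⊗ V` for
`2 ≤ n ≤ N - 1`. -/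
def ExtraCondition : Prop :=
  ∀ n, (hn : 2 ≤ n) → n ≤ P.N - 1 →
    tensorSub n 0 (by omega : n + P.N + 0 = n + P.N) P.Rbar ⊓
        tensorSub 0 n (by omega : 0 + P.N + n = n + P.N) P.Rbar ≤
      tensorSub (n - 1) 1 (by omega : n - 1 + P.N + 1 = n + P.N) P.Rbar

/-- The presentation `⟨X | R⟩` (`X` being a totally ordered finite set) is extra-confluent. -/
def IsExtraConfluent [LinearOrder X] : Prop :=
  P.IsReduced ∧ P.IsSideConfluent ∧ P.ExtraCondition

/-- `l_N(n)` for the integer `N` of the presentation. -/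
abbrev l (n : ℕ) : ℕ := lN P.N n

/-- The component `I(R)_m = ∑ V^{⊗ i} ⊗ R̄ ⊗ V^{⊗ m - N - i}` of the ideal `I(R)`. -/
def idealComp (m : ℕ) : Submodule K (TensorPow K X m) :=
  ⨆ (i : ℕ) (j : ℕ) (h : i + P.N + j = m), tensorSub i j h P.Rbar

/-- The spaces `J_n ⊂ V^{⊗ l_N(n)}`: `J_0 = K`, `J_1 = V` and
`J_n = ⋂ V^{⊗ i} ⊗ R̄ ⊗ V^{⊗ l_N(n) - N - i}` for `n ≥ 2` (in particular `J_2 = R̄`). -/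
def J (n : ℕ) : Submodule K (TensorPow K X (P.l n)) :=
  if n < 2 then ⊤ else ⨅ (i : ℕ) (j : ℕ) (h : i + P.N + j = P.l n), tensorSub i j h P.Rbar

/-- The algebra `K⟨X⟩ / I(R)`. -/
abbrev Alg : Type _ :=
  RingQuot fun a b : FreeAlgebra K X => (∃ f ∈ P.R, a = toFree (incl P.N f)) ∧ b = 0

theorem toFree_incl_single (m : ℕ) (w : Word X m) (c : K) :
    toFree (incl m (Finsupp.single w c)) = c • (w.1.map (FreeAlgebra.ι K)).prod := by
  simp [incl, toFree, Finsupp.lmapDomain_apply, Finsupp.mapDomain_single]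

/-- The augmentation of the free algebra kills `V^{⊗ m}` for `m ≥ 1`. -/
theorem aug_toFree_incl (m : ℕ) (hm : 1 ≤ m) (f : TensorPow K X m) :
    FreeAlgebra.lift K (fun _ : X => (0 : K)) (toFree (incl m f)) = 0 := by
  induction f using Finsupp.induction_linear with
  | zero => simp
  | add f g hf hg => simp only [map_add, hf, hg, add_zero]
  | single w c =>
    rw [toFree_incl_single, map_smul, map_list_prod]
    obtain ⟨w, rfl⟩ := w
    cases w with
    | nil => simp at hm
    | cons x w => simp

/-- The projection `K⟨X⟩ / I(R) → K` which maps `1` to `1` and the components of positive degree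
to `0`. -/
def augAlg : P.Alg →ₐ[K] K :=
  RingQuot.liftAlgHom K ⟨FreeAlgebra.lift K (fun _ : X => (0 : K)), by
    rintro a b ⟨⟨f, _, rfl⟩, rfl⟩
    have := P.two_le
    rw [aug_toFree_incl P.N (by omega) f, map_zero]⟩

/-! The Koszul complex of an algebra `A` presented by `⟨X | R⟩`. -/

variable {P} {A : Type*} [Ring A] [Algebra K A] (ψ : A ≃ₐ[K] P.Alg)

/-- The projection `f ↦ f̄` of `T(V)` onto `A`. -/
def bar : TensorAlg K X →ₗ[K] A :=
  ψ.symm.toLinearMap ∘ₗ (RingQuot.mkAlgHom K _).toLinearMap ∘ₗ toFree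

/-- The space `A ⊗ J_n`, as an `A`-submodule of `A ⊗ V^{⊗ l_N(n)}`. -/
def koszul (_ψ : A ≃ₐ[K] P.Alg) (n : ℕ) : Submodule A (A ⊗[K] TensorPow K X (P.l n)) :=
  (P.J n).baseChange A

/-- For `m = d + p`, the map `V^{⊗ m} → A ⊗ V^{⊗ p}` that sends a word `w = w₁ w₂` with `w₂` of
length `p` to `w̄₁ ⊗ w₂`. -/
def splitBar {d p m : ℕ} (h : d + p = m) : TensorPow K X m →ₗ[K] A ⊗[K] TensorPow K X p :=
  Finsupp.linearCombination K fun w : Word X m =>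
    bar ψ (Finsupp.single (w.1.take d) 1) ⊗ₜ[K]
      Finsupp.single (⟨w.1.drop d, by have := w.2; rw [List.length_drop]; omega⟩ : Word X p) (1 : K)

theorem sub_add_lN (n : ℕ) : P.l (n + 1) - P.l n + P.l n = P.l (n + 1) :=
  Nat.sub_add_cancel (lN_le_succ P.two_le n)

/-- The `A`-linear map `F_{n+1} : A ⊗ V^{⊗ l_N(n+1)} → A ⊗ V^{⊗ l_N(n)}`, `1 ⊗ w ↦ w̄₁ ⊗ w₂`, where
`w = w₁ w₂` and `w₂` has length `l_N(n)`. -/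
def koszulF (n : ℕ) :
    A ⊗[K] TensorPow K X (P.l (n + 1)) →ₗ[A] A ⊗[K] TensorPow K X (P.l n) :=
  TensorProduct.AlgebraTensorModule.lift
    { toFun := fun a => (Algebra.lsmul K K (A ⊗[K] TensorPow K X (P.l n)) a) ∘ₗ
        splitBar ψ (sub_add_lN n)
      map_add' := fun a b => by ext; simp
      map_smul' := fun a b => by ext; simp }

/-- The prefix `u` of length `d` being fixed, the map that sends a word `u v` to `v` and the words
that do not start with `u` to `0`. -/
def slice {d p m : ℕ} (h : d + p = m) (u : Word X d) : TensorPow K X m →ₗ[K] TensorPow K X p :=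
  open Classical in
  Finsupp.linearCombination K fun w : Word X m =>
    if w.1.take d = u.1 then
      Finsupp.single (⟨w.1.drop d, by have := w.2; rw [List.length_drop]; omega⟩ : Word X p) (1 : K)
    else 0

theorem splitBar_eq_sum [Finite X] {d p m : ℕ} (h : d + p = m) (f : TensorPow K X m) :
    splitBar ψ h f = ∑ᶠ u : Word X d, bar ψ (Finsupp.single u.1 1) ⊗ₜ[K] slice h u f := by
  classical
  have := Fintype.ofFinite (Word X d)
  rw [finsum_eq_sum_of_fintype]
  induction f using Finsupp.induction_linear with
  | zero => simp
  | add f g hf hg => simp only [map_add, hf, hg, TensorProduct.tmul_add, Finset.sum_add_distrib]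
  | single w c =>
    have hl : (w.1.take d).length = d := by have := w.2; rw [List.length_take]; omega
    rw [Finset.sum_eq_single ⟨w.1.take d, hl⟩]
    · simp [splitBar, slice, ← TensorProduct.tmul_smul]
    · intro u _ hu
      have : w.1.take d ≠ u.1 := fun e => hu (Subtype.ext e.symm)
      simp [slice, this]
    · simp

theorem slice_mem {d p m i j N : ℕ} (hd : d + p = m) (h : i + N + j = p)
    (h' : d + i + N + j = m) (U : Submodule K (TensorPow K X N)) (u : Word X d)
    {f : TensorPow K X m} (hf : f ∈ tensorSub (d + i) j h' U) :
    slice hd u f ∈ tensorSub i j h U := by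
  classical
  suffices H : tensorSub (d + i) j h' U ≤ (tensorSub i j h U).comap (slice hd u) from H hf
  refine iSup₂_le fun u' t => ?_
  rw [Submodule.map_le_iff_le_comap]
  intro g hg
  rw [Submodule.mem_comap, Submodule.mem_comap]
  have hu' := u'.2
  have hdl : (u'.1.drop d).length = i := by rw [List.length_drop]; omega
  have key : ∀ g : TensorPow K X N, slice hd u (sandwich h' u' t g) =
      if u'.1.take d = u.1 then sandwich h ⟨u'.1.drop d, hdl⟩ t g else 0 := by
    intro g
    induction g using Finsupp.induction_linear with
    | zero => simp
    | add a b ha hb =>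
      rw [map_add, map_add, ha, hb]
      split_ifs <;> simp
    | single v c =>
      have h1 : d ≤ u'.1.length := by omega
      simp only [sandwich, Finsupp.lmapDomain_apply, Finsupp.mapDomain_single, slice,
        Finsupp.linearCombination_single, List.append_assoc, List.take_append_of_le_length h1,
        List.drop_append_of_le_length h1]
      split_ifs <;> simp
  rw [key]
  split_ifs
  · exact (le_iSup₂_of_le (⟨u'.1.drop d, hdl⟩ : Word X i) t le_rfl :
      U.map (sandwich h ⟨u'.1.drop d, hdl⟩ t) ≤ tensorSub i j h U) ⟨g, hg, rfl⟩
  · exact Submodule.zero_mem _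

theorem slice_J (n : ℕ) (u : Word X (P.l (n + 1) - P.l n)) {f : TensorPow K X (P.l (n + 1))}
    (hf : f ∈ P.J (n + 1)) : slice (sub_add_lN n) u f ∈ P.J n := by
  by_cases hn : n < 2
  · simp [J, hn]
  · have hn' : ¬ n + 1 < 2 := by omega
    simp only [J, hn, hn', if_false, Submodule.mem_iInf] at hf ⊢
    intro i j h
    have hs := sub_add_lN (P := P) n
    have h' : P.l (n + 1) - P.l n + i + P.N + j = P.l (n + 1) := by omega
    exact slice_mem _ h h' _ u (hf _ j h')

theorem koszulF_tmul (n : ℕ) (a : A) (f : TensorPow K X (P.l (n + 1))) :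
    koszulF ψ n (a ⊗ₜ f) = a • splitBar ψ (sub_add_lN n) f := rfl

theorem koszulF_mem [Finite X] (n : ℕ) :
    ∀ x ∈ koszul ψ (n + 1), koszulF ψ n x ∈ koszul ψ n := by
  suffices H : koszul ψ (n + 1) ≤ (koszul ψ n).comap (koszulF ψ n) from fun x hx => H hx
  rw [koszul, Submodule.baseChange_eq_span, Submodule.span_le]
  rintro _ ⟨f, hf, rfl⟩
  have := Fintype.ofFinite (Word X (P.l (n + 1) - P.l n))
  change koszulF ψ n (1 ⊗ₜ f) ∈ koszul ψ n
  rw [koszulF_tmul, one_smul, splitBar_eq_sum, finsum_eq_sum_of_fintype]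
  exact Submodule.sum_mem _ fun u _ => Submodule.tmul_mem_baseChange_of_mem _ (slice_J n u hf)

/-- The differential `∂_{n+1} : A ⊗ J_{n+1} → A ⊗ J_n`, the restriction of `F_{n+1}`. -/
def koszulD [Finite X] (n : ℕ) : koszul ψ (n + 1) →ₗ[A] koszul ψ n :=
  (koszulF ψ n).restrict (koszulF_mem ψ n)

/-- The empty word, which spans `J_0 = K`. -/
def emptyWord : Word X (P.l 0) := ⟨[], by simp [l, lN]⟩

/-- The augmentation `ε : A ⊗ J_0 = A → K`. -/
def koszulAug : koszul ψ 0 →ₗ[K] K :=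
  TensorProduct.lift (((LinearMap.mul K K).compl₂ (Finsupp.lapply emptyWord)) ∘ₗ
      P.augAlg.toLinearMap ∘ₗ ψ.toLinearMap) ∘ₗ
    ((koszul ψ 0).subtype.restrictScalars K)

/-- The map `h_{-1} : K → A = A ⊗ J_0`, `1 ↦ 1`. -/
def koszulUnit : K →ₗ[K] koszul ψ 0 :=
  LinearMap.toSpanSingleton K (koszul ψ 0)
    ⟨1 ⊗ₜ[K] Finsupp.single emptyWord 1,
      Submodule.tmul_mem_baseChange_of_mem _ (by simp [J])⟩

/-- The maps `h_{-1}` (`1 ↦ 1`) and `h_n : A ⊗ J_n → A ⊗ J_{n+1}`, `n ≥ 0`, form a contracting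
homotopy for the Koszul complex `⋯ → A ⊗ J_1 → A ⊗ J_0 = A → K → 0`. -/
structure IsContractingHomotopy [Finite X]
    (h : ∀ n, koszul ψ n →ₗ[K] koszul ψ (n + 1)) : Prop where
  aug : koszulAug ψ ∘ₗ koszulUnit ψ = LinearMap.id
  zero : (koszulD ψ 0).restrictScalars K ∘ₗ h 0 + koszulUnit ψ ∘ₗ koszulAug ψ = LinearMap.id
  succ : ∀ n, (koszulD ψ (n + 1)).restrictScalars K ∘ₗ h (n + 1) +
    h n ∘ₗ (koszulD ψ n).restrictScalars K = LinearMap.id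

/-- The Koszul complex `⋯ → A ⊗ J_1 → A ⊗ J_0 = A → K → 0` is exact. -/
structure KoszulAcyclic [Finite X] : Prop where
  surjective : Function.Surjective (koszulAug ψ)
  exact_zero : Function.Exact (koszulD ψ 0) (koszulAug ψ)
  exact_succ : ∀ n, Function.Exact (koszulD ψ (n + 1)) (koszulD ψ n)

end Koszul

/-! ### Reduction pairs and the left bound of a presentation -/

section LeftBound

variable {K X : Type*} [Field K] [LinearOrder X] [Finite X] (P : HomPresentation K X)

/-- The operator `F_1^{n,m} = θ⁻¹(I(R)_{m - l_N(n)} ⊗ V^{⊗ l_N(n)})`, where `m ≥ l_N(n)`. -/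
def F1 (n m : ℕ) (hm : P.l n ≤ m) : Red K (Word X m) :=
  thetaInv (tensorSub 0 (P.l n) (by omega : 0 + (m - P.l n) + P.l n = m)
    (P.idealComp (m - P.l n)))

/-- The operator `F_2^{n,m}`, equal to the identity if `m < l_N(n+1)` and to
`θ⁻¹(V^{⊗ m - l_N(n+1)} ⊗ J_{n+1})` otherwise. -/
def F2 (n m : ℕ) : Red K (Word X m) :=
  if h : m < P.l (n + 1) then ⟨1, mul_one 1, fun _ => Or.inl rfl⟩
  else thetaInv (tensorSub (m - P.l (n + 1)) 0
    (by omega : m - P.l (n + 1) + P.l (n + 1) + 0 = m) (P.J (n + 1)))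

/-- The reduction pair `P_{n,m} = (F_1^{n,m}, F_2^{n,m})` of bi-degree `(n, m)`. -/
def reductionPair (n m : ℕ) (hm : P.l n ≤ m) : Red K (Word X m) × Red K (Word X m) :=
  (P.F1 n m hm, P.F2 n m)

/-- `k n m` is, for all `n` and `m ≥ l_N(n)`, a positive integer with
`⟨F_1^{n,m}, F_2^{n,m}⟩^{k n m} = ⟨F_2^{n,m}, F_1^{n,m}⟩^{k n m}`. -/
def AreDegrees (k : ℕ → ℕ → ℕ) : Prop :=
  ∀ n m, (hm : P.l n ≤ m) → ConfluentAt (P.reductionPair n m hm) (k n m)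

variable {P}

/-- The map `h'_n : ⨁_{m ≥ l_N(n)} V^{⊗ m} → T(V)` whose restriction to `V^{⊗ m}` is the left bound
of `P_{n,m}` (extended by `0` to the words of length `< l_N(n)`). -/
def hPrime {k : ℕ → ℕ → ℕ} (hk : P.AreDegrees k) (n : ℕ) : TensorAlg K X →ₗ[K] TensorAlg K X :=
  Finsupp.linearCombination K fun w : List X =>
    if hw : P.l n ≤ w.length then
      incl w.length (pairLeftBound (P.reductionPair n w.length hw) (k n w.length)
        (hk n w.length hw) (Finsupp.single ⟨w, rfl⟩ 1))
    else 0

variable {A : Type*} [Ring A] [Algebra K A] (ψ : A ≃ₐ[K] P.Alg)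

/-- `φbar : A → T(V)` maps the class of every `f ∈ T(V)` to the unique normal form of `f`. -/
def IsNormalFormMap (φbar : A →ₗ[K] TensorAlg K X) : Prop :=
  ∀ f g : TensorAlg K X, IsNormalFormOf P.R f g ↔ g = φbar (bar ψ f)

/-- The map `φ_n = φbar ⊗ id : A ⊗ J_n → im(φ) ⊗ J_n ⊂ T(V)`. -/
def phiN (φbar : A →ₗ[K] TensorAlg K X) (n : ℕ) : koszul ψ n →ₗ[K] TensorAlg K X :=
  concat (P.l n) ∘ₗ TensorProduct.map φbar LinearMap.id ∘ₗ
    (koszul ψ n).subtype.restrictScalars K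

/-- `(h_n)` is the left bound of the presentation: `h_n = φ_{n+1}⁻¹ ∘ h'_n ∘ φ_n`, that is,
`φ_{n+1} ∘ h_n = h'_n ∘ φ_n`, the maps `φ_n` being injective. -/
def IsLeftBound (φbar : A →ₗ[K] TensorAlg K X) {k : ℕ → ℕ → ℕ} (hk : P.AreDegrees k)
    (h : ∀ n, koszul ψ n →ₗ[K] koszul ψ (n + 1)) : Prop :=
  ∀ n, phiN ψ φbar (n + 1) ∘ₗ h n = hPrime hk n ∘ₗ phiN ψ φbar n

end LeftBound

end HomPresentation

end KoszulHomotopy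

end

/-! The whole argument runs through leading monomials. The operator `θ⁻¹(W)` sends a vector to its
only representative modulo `W` without monomials in `lmSet W`. Call `W₁`, `W₂` confluent
(`LmConfluent`) when every leading monomial of `W₁ + W₂` is already one of `W₁` or `W₂`. An equality
of alternating products implies this (`lmConfluent_of_altProd_eq`); conversely it forces both
alternating products of `θ⁻¹(W₁)`, `θ⁻¹(W₂)` to stabilise at `θ⁻¹(W₁ + W₂)`
(`eventually_altProd_eq`).

Pairwise confluence propagates. Leading monomials of a sum form the union (the diamond lemma
`lmSet_iSup_subset`), those of an intersection form the intersection (`LmConfluent.lmSet_inf`). So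
sums and intersections of a pairwise confluent family stay confluent, and intersecting distributes
over sums (`iSup_inf_le_of_lmConfluent`).

The kernel of `F_1^{n,m}` is the sum of the `V^{⊗ i} ⊗ R̄ ⊗ V^{⊗ j}` with `j ≥ l_N(n)`. For `n ≥ 1`
and `m ≥ l_N(n+1)`, the kernel of `F_2^{n,m}` is the intersection of those with `i ≥ m - l_N(n+1)`.
Two such subspaces are confluent: unconditionally when the factors are disjoint, by side-confluence
when they overlap. Hence `P_{n,m}` is confluent. Distributivity and the extra-condition give `ker
F_1^n ∩ ker F_2^n ⊂ ker F_1^{n+1} + ker F_2^{n+1}` (`kerF1_inf_kerF2_le`).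

A telescoping sum shows that the left bound `b_n` of the pair satisfies `F_1^n b_n = F_1^n - θ⁻¹(ker
F_1^n + ker F_2^n)`. For `v ∈ ker F_2^n`, the vector `v - b_n v` lies in `ker F_1^n ∩ ker F_2^n`,
and the words of `b_n v` are normal for `ker F_1^{n+1} + ker F_2^{n+1}`. So `b_n v` is the value at
`v` of the operator subtracted in the formula for `b_{n+1}`, whence `F_1^{n+1}(b_{n+1} v + b_n v) =
F_1^{n+1} v`. Cutting words, `w₁ w₂ ↦ w̄₁ ⊗ w₂`, makes `F_1` invisible, turns `b_n` into `h_n`, and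
turns `∂` into a mere displacement of the cut; the last identity becomes `∂h + h∂ = id`. -/

noncomputable section
namespace KoszulHomotopy

/-! ### Leading monomials of subspaces -/

section LeadingMonomials

variable {K Y : Type*} [Field K] [LinearOrder Y]

/-- The set of leading monomials of the nonzero elements of `W`. -/
def lmSet (W : Submodule K (Y →₀ K)) : Set Y := {y | ∃ w ∈ W, lm w = (y : WithBot Y)}

theorem mem_lmSet {W : Submodule K (Y →₀ K)} {y : Y} :
    y ∈ lmSet W ↔ ∃ w ∈ W, w y ≠ 0 ∧ ∀ z, w z ≠ 0 → z ≤ y := by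
  simp only [lmSet, Set.mem_ofPred_eq, lm_eq_iff]

theorem mem_normalSet_iff {W : Submodule K (Y →₀ K)} {y : Y} :
    y ∈ normalSet W ↔ y ∉ lmSet W := by
  simp [normalSet, lmSet]

theorem lmSet_mono {W W' : Submodule K (Y →₀ K)} (h : W ≤ W') : lmSet W ⊆ lmSet W' :=
  fun _ ⟨w, hw, hy⟩ => ⟨w, h hw, hy⟩

theorem exists_lm_eq {v : Y →₀ K} (hv : v ≠ 0) : ∃ y, v y ≠ 0 ∧ ∀ z, v z ≠ 0 → z ≤ y := by
  obtain ⟨y, hy⟩ := WithBot.ne_bot_iff_exists.1 (mt lm_eq_bot_iff.1 hv)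
  exact ⟨y, lm_eq_iff.1 hy.symm⟩

/-- The elements supported by `s`, written pointwise. -/
theorem mem_supported_iff {K Y : Type*} [Field K] {s : Set Y} {f : Y →₀ K} :
    f ∈ Finsupp.supported K K s ↔ ∀ z, f z ≠ 0 → z ∈ s := by
  rw [Finsupp.mem_supported]
  simp [Set.subset_def]

/-- If all the leading monomials of `W` are leading monomials of subspaces `U i` of `W`, then `W` is
the sum of the `U i`, compatibly with the filtration by lower sets. -/
theorem le_iSup_of_lmSet_subset [Finite Y] {ι : Type*} {W : Submodule K (Y →₀ K)}
    {U : ι → Submodule K (Y →₀ K)} (hU : ∀ i, U i ≤ W) (h : lmSet W ⊆ ⋃ i, lmSet (U i))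
    {s : Set Y} (hs : IsLowerSet s) :
    W ⊓ Finsupp.supported K K s ≤ ⨆ i, U i ⊓ Finsupp.supported K K s := by
  rintro f ⟨hfW, hfs⟩
  replace hfs := mem_supported_iff.1 hfs
  suffices H : ∀ (y : Y) (f : Y →₀ K), f ∈ W → (∀ z, f z ≠ 0 → z ∈ s) → (∀ z, f z ≠ 0 → z ≤ y) →
      f ∈ ⨆ i, U i ⊓ Finsupp.supported K K s by
    by_cases hf : f = 0
    · subst hf; exact Submodule.zero_mem _
    · obtain ⟨y, hy⟩ := exists_lm_eq hf
      exact H y f hfW hfs hy.2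
  clear hfW hfs f
  intro y
  induction y using WellFoundedLT.induction with
  | ind y ih =>
    intro f hfW hfs hfy
    by_cases hf : f = 0
    · subst hf; exact Submodule.zero_mem _
    obtain ⟨x, hx0, hx⟩ := exists_lm_eq hf
    obtain ⟨i, hi⟩ := Set.mem_iUnion.1 (h (mem_lmSet.2 ⟨f, hfW, hx0, hx⟩))
    obtain ⟨w, hw, hw0, hwx⟩ := mem_lmSet.1 hi
    have hws : w ∈ Finsupp.supported K K s :=
      mem_supported_iff.2 fun z hz => hs (hwx z hz) (hfs x hx0)
    -- One division step: `w` cancels the leading term of `f` and, `s` being a lower set, is itself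
    -- supported in `s`.
    set g := f - (f x / w x) • w with hg
    have hgx : g x = 0 := by simp [hg, hw0]
    have hgz : ∀ z, g z ≠ 0 → f z ≠ 0 ∨ w z ≠ 0 := by
      intro z hz
      by_contra! hcon
      exact hz (by simp [hg, hcon.1, hcon.2])
    have hglt : ∀ z, g z ≠ 0 → z < x := by
      intro z hz
      refine lt_of_le_of_ne ((hgz z hz).elim (hx z) (hwx z)) ?_
      rintro rfl
      exact hz hgx
    have hgmem : g ∈ ⨆ i, U i ⊓ Finsupp.supported K K s := by
      by_cases hg0 : g = 0
      · rw [hg0]; exact Submodule.zero_mem _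
      obtain ⟨z, hz0, hz⟩ := exists_lm_eq hg0
      refine ih z ((hglt z hz0).trans_le (hfy x hx0)) g
        (W.sub_mem hfW (W.smul_mem _ (hU i hw))) ?_ hz
      exact fun z' hz' => (hgz z' hz').elim (hfs z') (mem_supported_iff.1 hws z')
    have : f = g + (f x / w x) • w := by rw [hg]; abel
    rw [this]
    exact Submodule.add_mem _ hgmem (Submodule.smul_mem _ _
      ((le_iSup (fun i => U i ⊓ Finsupp.supported K K s) i) ⟨hw, hws⟩))

/-- The leading monomials of `W₁ + W₂` are leading monomials of `W₁` or of `W₂`. -/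
def LmConfluent (W₁ W₂ : Submodule K (Y →₀ K)) : Prop :=
  lmSet (W₁ ⊔ W₂) ⊆ lmSet W₁ ∪ lmSet W₂

theorem LmConfluent.symm {W₁ W₂ : Submodule K (Y →₀ K)} (h : LmConfluent W₁ W₂) :
    LmConfluent W₂ W₁ := by
  rw [LmConfluent, sup_comm, Set.union_comm]; exact h

theorem LmConfluent.of_le {W₁ W₂ : Submodule K (Y →₀ K)} (h : W₁ ≤ W₂) : LmConfluent W₁ W₂ := by
  rw [LmConfluent, sup_eq_right.2 h]
  exact Set.subset_union_right

/-! ### Confluence of pairs and of families of subspaces. -/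

variable [Finite Y]

theorem LmConfluent.sup_inf_supported_le {W₁ W₂ : Submodule K (Y →₀ K)} (h : LmConfluent W₁ W₂)
    {s : Set Y} (hs : IsLowerSet s) :
    (W₁ ⊔ W₂) ⊓ Finsupp.supported K K s ≤
      W₁ ⊓ Finsupp.supported K K s ⊔ W₂ ⊓ Finsupp.supported K K s := by
  have := le_iSup_of_lmSet_subset (W := W₁ ⊔ W₂) (U := fun b : Bool => cond b W₁ W₂)
    (by rintro (_ | _) <;> simp) (by rw [← Set.iSup_eq_iUnion, iSup_bool_eq]; exact h) hs
  rwa [iSup_bool_eq] at this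

/-- Elements of `W₁` and `W₂` with the same leading monomial `y` differ, after scaling, by an
element of `W₁ + W₂` supported below `y`. Confluence splits it into summands of `W₁` and `W₂` still
supported below `y`; moving them across gives an element of both subspaces with leading monomial
`y`. -/
theorem LmConfluent.lmSet_inf {W₁ W₂ : Submodule K (Y →₀ K)} (h : LmConfluent W₁ W₂) :
    lmSet W₁ ∩ lmSet W₂ ⊆ lmSet (W₁ ⊓ W₂) := by
  rintro y ⟨h₁, h₂⟩
  obtain ⟨w₁, hw₁, hy₁, hl₁⟩ := mem_lmSet.1 h₁
  obtain ⟨w₂, hw₂, hy₂, hl₂⟩ := mem_lmSet.1 h₂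
  set g := w₁ - (w₁ y / w₂ y) • w₂ with hg
  have hgs : g ∈ (W₁ ⊔ W₂) ⊓ Finsupp.supported K K (Set.Iio y) := by
    refine ⟨Submodule.sub_mem _ (Submodule.mem_sup_left hw₁)
      (Submodule.smul_mem _ _ (Submodule.mem_sup_right hw₂)), mem_supported_iff.2 fun z hz => ?_⟩
    have hzy : z ≠ y := by
      rintro rfl
      exact hz (by simp [hg, hy₂])
    refine lt_of_le_of_ne ?_ hzy
    by_contra hcon
    have e₁ : w₁ z = 0 := by by_contra h0; exact hcon (hl₁ z h0)
    have e₂ : w₂ z = 0 := by by_contra h0; exact hcon (hl₂ z h0)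
    exact hz (by simp [hg, e₁, e₂])
  obtain ⟨a, ⟨ha, has⟩, b, ⟨hb, hbs⟩, hab⟩ :=
    Submodule.mem_sup.1 (h.sup_inf_supported_le (isLowerSet_Iio y) hgs)
  replace has := mem_supported_iff.1 has
  have hay : a y = 0 := by
    by_contra h0
    exact lt_irrefl _ (has y h0)
  refine mem_lmSet.2 ⟨w₁ - a, ⟨W₁.sub_mem hw₁ ha, ?_⟩, by simpa [hay] using hy₁, fun z hz => ?_⟩
  · have : w₁ - a = (w₁ y / w₂ y) • w₂ + b := by
      have hb' : b = w₁ - (w₁ y / w₂ y) • w₂ - a := by rw [← hg, ← hab]; abel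
      rw [hb']
      abel
    rw [this]
    exact W₂.add_mem (W₂.smul_mem _ hw₂) hb
  · by_contra hcon
    have e₁ : w₁ z = 0 := by by_contra h0; exact hcon (hl₁ z h0)
    have e₂ : a z = 0 := by by_contra h0; exact hcon (has z h0).le
    exact hz (by simp [e₁, e₂])

/-- A leading monomial of `(W₁ ∩ W₂) + W₃` outside `lmSet W₃` must lie in both `lmSet W₁` and `lmSet
W₂`, hence in `lmSet (W₁ ∩ W₂)`. -/
theorem LmConfluent.inf_left {W₁ W₂ W₃ : Submodule K (Y →₀ K)} (h₁₂ : LmConfluent W₁ W₂)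
    (h₁₃ : LmConfluent W₁ W₃) (h₂₃ : LmConfluent W₂ W₃) : LmConfluent (W₁ ⊓ W₂) W₃ := by
  intro y hy
  have h₁ := h₁₃ (lmSet_mono (sup_le_sup_right inf_le_left W₃) hy)
  have h₂ := h₂₃ (lmSet_mono (sup_le_sup_right inf_le_right W₃) hy)
  rcases h₁ with h₁ | h₁
  · rcases h₂ with h₂ | h₂
    · exact Or.inl (h₁₂.lmSet_inf ⟨h₁, h₂⟩)
    · exact Or.inr h₂
  · exact Or.inr h₁

theorem lmConfluent_finset_inf {ι : Type*} {W : ι → Submodule K (Y →₀ K)}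
    (h : ∀ i j, LmConfluent (W i) (W j)) (s : Finset ι) (j : ι) :
    LmConfluent (s.inf W) (W j) := by
  classical
  induction s using Finset.induction_on generalizing j with
  | empty => exact (LmConfluent.of_le le_top).symm
  | insert a s _ ih =>
    rw [Finset.inf_insert]
    exact (ih a).symm.inf_left (h a j) (ih j)

theorem lmConfluent_iInf {ι : Type*} [Finite ι] {W : ι → Submodule K (Y →₀ K)}
    (h : ∀ i j, LmConfluent (W i) (W j)) (p : ι → Prop) (j : ι) :
    LmConfluent (⨅ (i) (_ : p i), W i) (W j) := by
  classical
  have := Fintype.ofFinite ι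
  have e : (⨅ (i) (_ : p i), W i) = (Finset.univ.filter p).inf W := by
    rw [Finset.inf_eq_iInf]; simp
  rw [e]
  exact lmConfluent_finset_inf h _ j

/-- The diamond lemma for families of subspaces: confluence of all pairs implies confluence of the
whole family. -/
theorem lmSet_iSup_subset {ι : Type*} {W : ι → Submodule K (Y →₀ K)}
    (h : ∀ i j, LmConfluent (W i) (W j)) : lmSet (⨆ i, W i) ⊆ ⋃ i, lmSet (W i) := by
  classical
  intro y hy
  obtain ⟨f, hf, hf0, hfy⟩ := mem_lmSet.1 hy
  -- The set `s` bounds all the monomials used in some decomposition of `f`; the induction lowers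
  -- this bound until no cancellation of top monomials remains.
  suffices H : ∀ s : Finset Y, IsLowerSet (s : Set Y) →
      f ∈ ⨆ i, W i ⊓ Finsupp.supported K K (s : Set Y) → y ∈ ⋃ i, lmSet (W i) by
    have := Fintype.ofFinite Y
    refine H Finset.univ (by simp [isLowerSet_univ]) ?_
    simpa [Finsupp.supported_univ] using hf
  intro s
  induction s using Finset.induction_on_max with
  | empty =>
    intro _ hmem
    simp only [Finset.coe_empty, Finsupp.supported_empty, inf_bot_eq, iSup_bot,
      Submodule.mem_bot] at hmem
    exact absurd (by simp [hmem]) hf0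
  | insert a s hs ih =>
    intro hlow hmem
    have hlow' : IsLowerSet (s : Set Y) := by
      intro x z hzx hx
      have hz := hlow hzx (by simp only [Finset.coe_insert]; exact Or.inr hx)
      simp only [Finset.coe_insert] at hz
      rcases hz with rfl | hz
      · exact absurd (hs x hx) (not_lt.2 hzx)
      · exact hz
    have hsa : ∀ w : Y →₀ K, w ∈ Finsupp.supported K K ((insert a s : Finset Y) : Set Y) →
        w a = 0 → w ∈ Finsupp.supported K K (s : Set Y) := by
      intro w hw hwa
      rw [mem_supported_iff] at hw ⊢
      intro z hz
      have := hw z hz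
      simp only [Finset.coe_insert] at this
      rcases this with rfl | hz'
      · exact absurd hwa hz
      · exact hz'
    obtain ⟨w, hw, hsum⟩ := (Submodule.mem_iSup_iff_exists_finsupp _ _).1 hmem
    rw [Finsupp.sum] at hsum
    by_cases hall : ∀ i, w i a = 0
    · refine ih hlow' ?_
      rw [← hsum]
      exact Submodule.sum_mem _ fun i _ =>
        (le_iSup (fun i => W i ⊓ Finsupp.supported K K (s : Set Y)) i)
          ⟨(hw i).1, hsa _ (hw i).2 (hall i)⟩
    push Not at hall
    obtain ⟨i₀, hi₀⟩ := hall
    by_cases hfa : f a = 0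
    · refine ih hlow' ?_
      -- The coefficients of `a` cancel in `f`, so the same pivot `w i₀` can be subtracted from
      -- every term at no total cost. Each difference lies in `W i + W i₀` and no longer involves
      -- `a`, so confluence of that pair decomposes it again below `a`.
      have key : ∑ i ∈ w.support, (w i - (w i a / w i₀ a) • w i₀) = f := by
        rw [Finset.sum_sub_distrib, hsum, ← Finset.sum_smul, ← Finset.sum_div]
        have : ∑ i ∈ w.support, w i a = 0 := by
          rw [← Finsupp.finsetSum_apply, hsum, hfa]
        rw [this, zero_div, zero_smul, sub_zero]
      rw [← key]
      refine Submodule.sum_mem _ fun i _ => ?_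
      have hle : W i ⊓ Finsupp.supported K K (s : Set Y) ⊔ W i₀ ⊓ Finsupp.supported K K (s : Set Y)
          ≤ ⨆ i, W i ⊓ Finsupp.supported K K (s : Set Y) :=
        sup_le (le_iSup (fun i => W i ⊓ Finsupp.supported K K (s : Set Y)) i)
          (le_iSup (fun i => W i ⊓ Finsupp.supported K K (s : Set Y)) i₀)
      refine hle ((h i i₀).sup_inf_supported_le hlow' ⟨?_, hsa _ ?_ ?_⟩)
      · exact Submodule.sub_mem _ (Submodule.mem_sup_left (hw i).1)
          (Submodule.smul_mem _ _ (Submodule.mem_sup_right (hw i₀).1))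
      · exact Submodule.sub_mem _ (hw i).2 (Submodule.smul_mem _ _ (hw i₀).2)
      · simp [hi₀]
    -- No cancellation at the top: `a` is the leading monomial of `f` and of the summand `w i₀`.
    · have hle : ∀ i z, w i z ≠ 0 → z ≤ a := by
        intro i z hz
        have := mem_supported_iff.1 (hw i).2 z hz
        simp only [Finset.coe_insert] at this
        rcases this with rfl | hz'
        · exact le_rfl
        · exact (hs z hz').le
      have hya : y ≤ a := by
        rw [← hsum, Finsupp.finsetSum_apply] at hf0
        obtain ⟨i, _, hi⟩ := Finset.exists_ne_zero_of_sum_ne_zero hf0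
        exact hle i y hi
      have : y = a := le_antisymm hya (hfy a hfa)
      subst this
      exact Set.mem_iUnion.2 ⟨i₀, mem_lmSet.2 ⟨w i₀, (hw i₀).1, hi₀, hle i₀⟩⟩

/-- Distributivity is checked on leading monomials: one of the left-hand side is one of some `W i`
by the diamond lemma and one of `U`, hence one of `W i ∩ U`. A subspace is spanned by subspaces that
exhaust its leading monomials. -/
theorem iSup_inf_le_of_lmConfluent {ι : Type*} {W : ι → Submodule K (Y →₀ K)}
    {U : Submodule K (Y →₀ K)} (h : ∀ i j, LmConfluent (W i) (W j))
    (hU : ∀ i, LmConfluent (W i) U) : (⨆ i, W i) ⊓ U ≤ ⨆ i, W i ⊓ U := by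
  have := le_iSup_of_lmSet_subset (W := (⨆ i, W i) ⊓ U) (U := fun i => W i ⊓ U)
    (fun i => inf_le_inf_right U (le_iSup W i)) (fun y hy => by
      obtain ⟨i, hi⟩ := Set.mem_iUnion.1 (lmSet_iSup_subset h (lmSet_mono inf_le_left hy))
      exact Set.mem_iUnion.2 ⟨i, (hU i).lmSet_inf ⟨hi, lmSet_mono inf_le_right hy⟩⟩)
    isLowerSet_univ
  simpa [Finsupp.supported_univ] using this

theorem lmConfluent_iSup {ι : Type*} {W : ι → Submodule K (Y →₀ K)}
    {U : Submodule K (Y →₀ K)} (h : ∀ i j, LmConfluent (W i) (W j))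
    (hU : ∀ i, LmConfluent (W i) U) : LmConfluent (⨆ i, W i) U := by
  intro y hy
  -- The diamond lemma is applied to the family enlarged by `U` as one more member.
  have := lmSet_iSup_subset (W := fun o : Option ι => o.elim U W) (by
    rintro (_ | i) (_ | j)
    · exact LmConfluent.of_le le_rfl
    · exact (hU j).symm
    · exact hU i
    · exact h i j)
  rw [iSup_option, Set.iUnion_option, sup_comm] at this
  rcases this hy with hy | hy
  · exact Or.inr hy
  · obtain ⟨i, hi⟩ := Set.mem_iUnion.1 hy
    exact Or.inl (lmSet_mono (le_iSup W i) hi)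

end LeadingMonomials

/-! ### Reduction operators and their left bounds -/

section Operators

variable {K Y : Type*} [Field K] [LinearOrder Y]

/-- `T` maps every basis element `y` to a combination of basis elements `≤ y`. -/
def IsTriangular (T : Module.End K (Y →₀ K)) : Prop :=
  ∀ y z, T (Finsupp.single y 1) z ≠ 0 → z ≤ y

theorem end_apply_eq_sum {K Y : Type*} [Field K] {Z : Type*} (T : (Y →₀ K) →ₗ[K] (Z →₀ K))
    (f : Y →₀ K) (z : Z) : T f z = ∑ x ∈ f.support, f x * T (Finsupp.single x 1) z := by
  conv_lhs => rw [← Finsupp.sum_single f]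
  rw [Finsupp.sum, map_sum, Finsupp.finsetSum_apply]
  refine Finset.sum_congr rfl fun x _ => ?_
  rw [← mul_one (f x), ← smul_eq_mul, ← Finsupp.smul_single, map_smul]
  simp

theorem exists_of_end_apply_ne_zero {K Y : Type*} [Field K] {Z : Type*}
    {T : (Y →₀ K) →ₗ[K] (Z →₀ K)} {f : Y →₀ K}
    {z : Z} (h : T f z ≠ 0) : ∃ x, f x ≠ 0 ∧ T (Finsupp.single x 1) z ≠ 0 := by
  rw [end_apply_eq_sum] at h
  obtain ⟨x, _, hx⟩ := Finset.exists_ne_zero_of_sum_ne_zero h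
  exact ⟨x, left_ne_zero_of_mul hx, right_ne_zero_of_mul hx⟩

theorem end_apply_eq_self {K Y : Type*} [Field K] {T : (Y →₀ K) →ₗ[K] (Y →₀ K)} {v : Y →₀ K}
    (h : ∀ x, v x ≠ 0 → T (Finsupp.single x 1) = Finsupp.single x 1) : T v = v := by
  ext z
  rw [end_apply_eq_sum]
  conv_rhs => rw [← LinearMap.id_apply (R := K) v, end_apply_eq_sum]
  refine Finset.sum_congr rfl fun x hx => ?_
  rw [h x (by simpa using hx), LinearMap.id_apply]

theorem IsTriangular.one : IsTriangular (1 : Module.End K (Y →₀ K)) :=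
  fun _ _ hz => (single_ne_zero_cases hz).le

theorem IsTriangular.mul {T U : Module.End K (Y →₀ K)} (hT : IsTriangular T)
    (hU : IsTriangular U) : IsTriangular (T * U) := by
  intro y z hz
  obtain ⟨x, hx, hxz⟩ := exists_of_end_apply_ne_zero (T := T) hz
  exact (hT x z hxz).trans (hU y x hx)

theorem IsTriangular.altProd {T U : Module.End K (Y →₀ K)} (hT : IsTriangular T)
    (hU : IsTriangular U) (k : ℕ) : IsTriangular (altProd T U k) := by
  induction k generalizing T U with
  | zero => exact .one
  | succ k ih => exact (ih hU hT).mul hU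

/-- Triangularity lets no smaller monomial of `f` contribute to the coefficient of `y`, so the
leading coefficient survives. -/
theorem IsTriangular.map_ne_zero {T : Module.End K (Y →₀ K)} (hT : IsTriangular T) {f : Y →₀ K}
    {y : Y} (hy : T (Finsupp.single y 1) = Finsupp.single y 1) (hf : f y ≠ 0)
    (hl : ∀ z, f z ≠ 0 → z ≤ y) : T f ≠ 0 := by
  intro h0
  have h1 : T f y = f y := by
    rw [end_apply_eq_sum, Finset.sum_eq_single y]
    · simp [hy]
    · intro x hx hxy
      by_contra hne
      exact hxy (le_antisymm (hl x (by simpa using hx)) (hT x y (right_ne_zero_of_mul hne)))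
    · intro hy'
      simp only [Finsupp.mem_support_iff, not_not] at hy'
      simp [hy']
  exact hf (by rw [← h1, h0, Finsupp.coe_zero, Pi.zero_apply])

theorem altProd_apply_of_fixed {V : Type*} [AddCommGroup V] [Module K V] {T U : Module.End K V}
    {v : V} (hT : T v = v) (hU : U v = v) (k : ℕ) : altProd T U k v = v := by
  induction k generalizing T U with
  | zero => rfl
  | succ k ih => rw [altProd, Module.End.mul_apply, hU, ih hU hT]

/-- The common alternating product has `T₁` as rightmost factor in one form and `T₂` in the other,
so it kills `W₁ + W₂`. It fixes a monomial that is leading for neither subspace, and a triangular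
operator cannot kill a vector whose leading monomial it fixes. Only triangularity is needed, so the
lemma applies to `S ⊗ id` and `id ⊗ S` directly. -/
theorem lmConfluent_of_altProd_eq {T₁ T₂ : Module.End K (Y →₀ K)} {W₁ W₂ : Submodule K (Y →₀ K)}
    (h₁ : IsTriangular T₁) (h₂ : IsTriangular T₂) (hW₁ : W₁ ≤ LinearMap.ker T₁)
    (hW₂ : W₂ ≤ LinearMap.ker T₂)
    (hf₁ : ∀ y, y ∉ lmSet W₁ → T₁ (Finsupp.single y 1) = Finsupp.single y 1)
    (hf₂ : ∀ y, y ∉ lmSet W₂ → T₂ (Finsupp.single y 1) = Finsupp.single y 1)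
    {k : ℕ} (hk : 1 ≤ k) (h : altProd T₁ T₂ k = altProd T₂ T₁ k) : LmConfluent W₁ W₂ := by
  intro y hy
  by_contra hcon
  rw [Set.mem_union, not_or] at hcon
  obtain ⟨f, hf, hf0, hfl⟩ := mem_lmSet.1 hy
  refine (h₁.altProd h₂ k).map_ne_zero
    (altProd_apply_of_fixed (hf₁ y hcon.1) (hf₂ y hcon.2) k) hf0 hfl ?_
  obtain ⟨a, ha, b, hb, rfl⟩ := Submodule.mem_sup.1 hf
  obtain ⟨k, rfl⟩ := Nat.exists_eq_add_of_le' hk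
  rw [map_add, h]
  nth_rewrite 2 [← h]
  rw [altProd, altProd, Module.End.mul_apply, Module.End.mul_apply,
    LinearMap.mem_ker.1 (hW₁ ha), LinearMap.mem_ker.1 (hW₂ hb), map_zero, map_zero, add_zero]

theorem lmSet_subset_of_le_ker {T : Module.End K (Y →₀ K)} {W : Submodule K (Y →₀ K)}
    (hT : IsTriangular T) (hW : W ≤ LinearMap.ker T) {s : Set Y}
    (hf : ∀ y, y ∉ s → T (Finsupp.single y 1) = Finsupp.single y 1) : lmSet W ⊆ s := by
  intro y hy
  by_contra hcon
  obtain ⟨f, hfW, hf0, hfl⟩ := mem_lmSet.1 hy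
  exact hT.map_ne_zero (hf y hcon) hf0 hfl (hW hfW)

theorem Red.isTriangular (T : Red K Y) : IsTriangular T.1 := by
  intro y z hz
  rcases T.2.2 y with h | h
  · rw [h] at hz
    exact (single_ne_zero_cases hz).le
  · exact (lm_lt_iff.1 h z hz).le

/-! ### Identities between two idempotents, and the left bound of a confluent pair. -/

theorem one_sub_mul_mul_self {M : Type*} [Ring M] {b : M} (hb : b * b = b) (x : M) :
    (1 - b) * (b * x) = 0 := by
  rw [← mul_assoc, sub_mul, one_mul, hb, sub_self, zero_mul]

theorem self_mul_one_sub_mul {M : Type*} [Ring M] {b : M} (hb : b * b = b) (x : M) :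
    b * ((1 - b) * x) = 0 := by
  rw [← mul_assoc, mul_sub, mul_one, hb, sub_self, zero_mul]

/-- Telescoping: `a (1 - b) a (b a)^j = a (b a)^j - a (b a)^(j+1)`. -/
theorem mul_one_sub_mul_sum {M : Type*} [Ring M] {a : M} (b : M) (ha : a * a = a) (n : ℕ) :
    a * ((1 - b) * ∑ j ∈ Finset.range n, a * (b * a) ^ j) = a - a * (b * a) ^ n := by
  induction n with
  | zero => simp
  | succ n ih =>
    rw [Finset.sum_range_succ, mul_add, mul_add, ih, pow_succ', sub_mul, mul_sub, one_mul]
    simp only [← mul_assoc, ha]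
    abel

theorem sum_mul_self {M : Type*} [Ring M] {a : M} (b : M) (ha : a * a = a) (n : ℕ) :
    (∑ j ∈ Finset.range n, a * (b * a) ^ j) * a = ∑ j ∈ Finset.range n, a * (b * a) ^ j := by
  rw [Finset.sum_mul]
  refine Finset.sum_congr rfl fun j _ => ?_
  cases j with
  | zero => simp [ha]
  | succ j => rw [pow_succ]; simp only [mul_assoc, ha]

theorem altProd_odd {M : Type*} [Monoid M] (t s : M) (j : ℕ) :
    altProd t s (2 * j + 1) = s * (t * s) ^ j := by
  induction j with
  | zero => simp [altProd]
  | succ j ih =>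
    rw [show 2 * (j + 1) + 1 = 2 * j + 1 + 1 + 1 by ring, altProd, altProd, ih, pow_succ]
    simp only [mul_assoc]

theorem sum_filter_odd {M : Type*} [AddCommMonoid M] (a : ℕ → M) (n : ℕ) :
    ∑ i ∈ (Finset.range (2 * n)).filter (fun i => Odd i), a i =
      ∑ j ∈ Finset.range n, a (2 * j + 1) := by
  induction n with
  | zero => simp
  | succ n ih =>
    rw [show 2 * (n + 1) = 2 * n + 1 + 1 by ring, Finset.range_add_one, Finset.filter_insert,
      if_pos ⟨n, rfl⟩, Finset.range_add_one, Finset.filter_insert, if_neg (by simp),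
      Finset.sum_insert (by simp), ih, Finset.sum_range_succ, add_comm]

/-- The endomorphism underlying a reduction operator. -/
def Red.op (T : Red K Y) : Module.End K (Y →₀ K) := T.1

theorem Red.op_mul_self (T : Red K Y) : T.op * T.op = T.op := T.2.1

theorem pairLeftBound_eq_sum (P : Red K Y × Red K Y) (k : ℕ) (hk : ConfluentAt P k) :
    pairLeftBound P k hk = (1 - P.2.op) *
      ∑ i ∈ (Finset.range k).filter (fun i => Odd i), altProd P.2.op P.1.op i := by
  have hs : ∀ i, pairRep P k hk (ConfluenceAlgebra.s K k i) = ![P.1.op, P.2.op] i := by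
    intro i
    simp [pairRep, ConfluenceAlgebra.s, Red.op]
  simp [pairLeftBound, ConfluenceAlgebra.gammaOne, map_sum, map_altProd, hs]

/-- At degree `k` the common product absorbs either idempotent on the right, so both alternating
products are constant from `k` on. -/
theorem altProd_eq_of_confluentAt {P : Red K Y × Red K Y} {k : ℕ} (hk : ConfluentAt P k) {i : ℕ}
    (hi : k ≤ i) : altProd P.2.op P.1.op i = altProd P.1.op P.2.op i := by
  have hl : ∀ i, k ≤ i → altProd P.1.op P.2.op i = altProd P.1.op P.2.op k ∧
      altProd P.2.op P.1.op i = altProd P.1.op P.2.op k := by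
    obtain ⟨h1, hk⟩ := hk
    change altProd P.1.op P.2.op k = altProd P.2.op P.1.op k at hk
    obtain ⟨j, rfl⟩ := Nat.exists_eq_add_of_le' h1
    intro i hi
    induction i, hi using Nat.le_induction with
    | base => exact ⟨rfl, hk.symm⟩
    | succ i _ ih =>
      rw [altProd, altProd.eq_2 P.2.op, ih.1, ih.2]
      constructor
      · rw [altProd, mul_assoc, P.2.op_mul_self]
      · rw [hk, altProd, mul_assoc, P.1.op_mul_self]
  rw [(hl i hi).1, (hl i hi).2]

/-- The sum defining `γ₁` may be prolonged beyond the degree `k`: the new odd products can be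
rewritten with `P.2` as leftmost factor, and `1 - P.2` kills them. The resulting formula mentions
`k` no more, which gives independence of the degree. -/
theorem eventually_pairLeftBound_eq (P : Red K Y × Red K Y) (k : ℕ) (hk : ConfluentAt P k) :
    ∀ᶠ n in Filter.atTop, pairLeftBound P k hk =
      (1 - P.2.op) * ∑ j ∈ Finset.range n, P.1.op * (P.2.op * P.1.op) ^ j := by
  have key : ∀ k', k ≤ k' → pairLeftBound P k hk = (1 - P.2.op) *
      ∑ i ∈ (Finset.range k').filter (fun i => Odd i), altProd P.2.op P.1.op i := by
    intro k' hk'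
    induction k', hk' using Nat.le_induction with
    | base => exact pairLeftBound_eq_sum P k hk
    | succ i hi ih =>
      rw [Finset.range_add_one, Finset.filter_insert]
      split_ifs with hodd
      · rw [Finset.sum_insert (by simp), mul_add, ← ih]
        obtain ⟨j, rfl⟩ := hodd
        rw [altProd_eq_of_confluentAt hk hi, altProd_odd, one_sub_mul_mul_self (M := Module.End K (Y →₀ K)) P.2.op_mul_self,
          zero_add]
      · exact ih
  filter_upwards [Filter.eventually_ge_atTop k] with n hn
  rw [key (2 * n) (by omega), sum_filter_odd]
  simp only [altProd_odd]

theorem pairLeftBound_eq_of_confluentAt (P : Red K Y × Red K Y) (k k' : ℕ) (hk : ConfluentAt P k)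
    (hk' : ConfluentAt P k') : pairLeftBound P k hk = pairLeftBound P k' hk' := by
  obtain ⟨n, h₁, h₂⟩ :=
    ((eventually_pairLeftBound_eq P k hk).and (eventually_pairLeftBound_eq P k' hk')).exists
  rw [h₁, h₂]

theorem exists_pairLeftBound_eq_mul (P : Red K Y × Red K Y) (k : ℕ) (hk : ConfluentAt P k) :
    ∃ G, pairLeftBound P k hk = (1 - P.2.op) * (P.1.op * G) := by
  obtain ⟨n, h⟩ := (eventually_pairLeftBound_eq P k hk).exists
  exact ⟨_, by rw [h, ← Finset.mul_sum]⟩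

theorem pairLeftBound_mul_fst (P : Red K Y × Red K Y) (k : ℕ) (hk : ConfluentAt P k) :
    pairLeftBound P k hk * P.1.op = pairLeftBound P k hk := by
  obtain ⟨n, h⟩ := (eventually_pairLeftBound_eq P k hk).exists
  rw [h, mul_assoc, sum_mul_self (M := Module.End K (Y →₀ K)) _ P.1.op_mul_self]

theorem snd_mul_pairLeftBound (P : Red K Y × Red K Y) (k : ℕ) (hk : ConfluentAt P k) :
    P.2.op * pairLeftBound P k hk = 0 := by
  obtain ⟨G, h⟩ := exists_pairLeftBound_eq_mul P k hk
  rw [h, self_mul_one_sub_mul (M := Module.End K (Y →₀ K)) P.2.op_mul_self]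

/-! ### The operators `θ⁻¹(W)` and the left bounds of confluent pairs of subspaces. -/

variable [Finite Y]

/-- The reduction operator `θ⁻¹(W)`, as an endomorphism. -/
def redOp (W : Submodule K (Y →₀ K)) : Module.End K (Y →₀ K) := (thetaInv W).op

theorem ker_redOp (W : Submodule K (Y →₀ K)) : LinearMap.ker (redOp W) = W :=
  (Equiv.ofBijective theta ⟨theta_injective, theta_surjective⟩).apply_symm_apply W

theorem redOp_single_cases (W : Submodule K (Y →₀ K)) (y : Y) :
    redOp W (Finsupp.single y 1) = Finsupp.single y 1 ∨
      lm (redOp W (Finsupp.single y 1)) < (y : WithBot Y) :=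
  (thetaInv W).2.2 y

theorem redOp_mul_self (W : Submodule K (Y →₀ K)) :
    redOp W * redOp W = redOp W :=
  (thetaInv W).2.1

theorem sub_redOp_mem (W : Submodule K (Y →₀ K)) (v : Y →₀ K) : v - redOp W v ∈ W := by
  suffices h : v - redOp W v ∈ LinearMap.ker (redOp W) by rwa [ker_redOp] at h
  rw [LinearMap.mem_ker, map_sub, sub_eq_zero]
  exact (LinearMap.congr_fun (redOp_mul_self W) v).symm

theorem redOp_apply_eq_zero_iff {W : Submodule K (Y →₀ K)} {v : Y →₀ K} :
    redOp W v = 0 ↔ v ∈ W := by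
  rw [← LinearMap.mem_ker, ker_redOp]

theorem redOp_single_of_mem_normalSet {W : Submodule K (Y →₀ K)} {y : Y}
    (hy : y ∈ normalSet W) : redOp W (Finsupp.single y 1) = Finsupp.single y 1 := by
  rcases redOp_single_cases W y with h | h
  · exact h
  · exfalso
    rw [lm_lt_iff] at h
    have h0 : redOp W (Finsupp.single y 1) y = 0 := by
      by_contra hne
      exact lt_irrefl _ (h y hne)
    refine hy _ (sub_redOp_mem W (Finsupp.single y 1)) (lm_eq_iff.2 ⟨by simp [h0], ?_⟩)
    intro z hz
    by_contra hzy
    have h1 : redOp W (Finsupp.single y 1) z = 0 := by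
      by_contra hne
      exact hzy (h z hne).le
    rw [Finsupp.sub_apply, h1, sub_zero] at hz
    exact hzy (single_ne_zero_cases hz).le

theorem redOp_apply_of_normal {W : Submodule K (Y →₀ K)} {v : Y →₀ K}
    (hv : ∀ z, v z ≠ 0 → z ∈ normalSet W) : redOp W v = v :=
  end_apply_eq_self fun z hz => redOp_single_of_mem_normalSet (hv z hz)

/-- `θ⁻¹(W)` maps `v` to its unique representative modulo `W` all of whose monomials are normal. -/
theorem redOp_apply_eq_iff {W : Submodule K (Y →₀ K)} {v u : Y →₀ K} :
    redOp W v = u ↔ v - u ∈ W ∧ ∀ z, u z ≠ 0 → z ∈ normalSet W := by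
  constructor
  · rintro rfl
    refine ⟨sub_redOp_mem W v, ?_⟩
    choose u hu1 hu2 _ using exists_normal_rep W
    have h1 := redOp_apply_eq_zero_iff.2 (sub_linearCombination_mem hu1 v)
    rw [map_sub, sub_eq_zero, redOp_apply_of_normal (normal_sum hu2 v)] at h1
    rw [h1]
    exact normal_sum hu2 v
  · rintro ⟨h1, h2⟩
    rw [← redOp_apply_eq_zero_iff, map_sub, sub_eq_zero, redOp_apply_of_normal h2] at h1
    exact h1

theorem mem_normalSet_of_redOp_apply {W : Submodule K (Y →₀ K)} {v : Y →₀ K} {z : Y}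
    (h : redOp W v z ≠ 0) : z ∈ normalSet W :=
  (redOp_apply_eq_iff.1 rfl).2 z h

theorem redOp_bot : redOp (⊥ : Submodule K (Y →₀ K)) = 1 := by
  refine LinearMap.ext fun v => ?_
  have := sub_redOp_mem ⊥ v
  rw [Submodule.mem_bot, sub_eq_zero] at this
  exact this.symm

/-- The alternating products of a confluent pair are eventually equal to `θ⁻¹(W₁ + W₂)`. -/
theorem eventually_altProd_eq {W₁ W₂ : Submodule K (Y →₀ K)} (h : LmConfluent W₁ W₂) :
    ∀ᶠ k in Filter.atTop, altProd (redOp W₁) (redOp W₂) k = redOp (W₁ ⊔ W₂) := by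
  -- The pair is quantified inside the induction because peeling off one factor exchanges the two
  -- operators.
  have key : ∀ (y : Y) (W₁ W₂ : Submodule K (Y →₀ K)), LmConfluent W₁ W₂ →
      ∀ᶠ k in Filter.atTop, altProd (redOp W₁) (redOp W₂) k (Finsupp.single y 1) =
        redOp (W₁ ⊔ W₂) (Finsupp.single y 1) := by
    intro y
    induction y using WellFoundedLT.induction with
    | ind y ih =>
      have ih' : ∀ (W₁ W₂ : Submodule K (Y →₀ K)), LmConfluent W₁ W₂ → ∀ v : Y →₀ K,
          lm v < (y : WithBot Y) → ∀ᶠ k in Filter.atTop,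
            altProd (redOp W₁) (redOp W₂) k v = redOp (W₁ ⊔ W₂) v := by
        intro W₁ W₂ h v hv
        rw [lm_lt_iff] at hv
        have := (Filter.eventually_all_finset v.support).2
          fun x hx => ih x (hv x (by simpa using hx)) W₁ W₂ h
        filter_upwards [this] with k hk
        ext z
        rw [end_apply_eq_sum, end_apply_eq_sum]
        exact Finset.sum_congr rfl fun x hx => by rw [hk x hx]
      intro W₁ W₂ h
      have hsub : ∀ W : Submodule K (Y →₀ K), W ≤ W₁ ⊔ W₂ → ∀ v,
          redOp (W₁ ⊔ W₂) (redOp W v) = redOp (W₁ ⊔ W₂) v := by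
        intro W hW v
        have := redOp_apply_eq_zero_iff.2 (hW (sub_redOp_mem W v))
        rwa [map_sub, sub_eq_zero, eq_comm] at this
      rcases redOp_single_cases W₂ y with h₂ | h₂
      · rcases redOp_single_cases W₁ y with h₁ | h₁
        -- Here `y` is leading for neither subspace; confluence says that it is not leading for the
        -- sum, so all the operators fix it. This is the only use of confluence.
        · refine Filter.Eventually.of_forall fun k => ?_
          rw [altProd_apply_of_fixed h₁ h₂, redOp_single_of_mem_normalSet]
          rw [mem_normalSet_iff]
          intro hy
          have hn : ∀ W : Submodule K (Y →₀ K),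
              redOp W (Finsupp.single y 1) = Finsupp.single y 1 → y ∉ lmSet W :=
            fun W hW => mem_normalSet_iff.1
              (mem_normalSet_of_redOp_apply (v := Finsupp.single y 1) (by rw [hW]; simp))
          exact (h hy).elim (hn _ h₁) (hn _ h₂)
        · have := ih' W₁ W₂ h _ h₁
          -- The rightmost factor `redOp W₂` fixes `y`, so two factors are consumed before `y` is
          -- replaced by smaller monomials.
          rw [← Filter.map_add_atTop_eq_nat 2, Filter.eventually_map]
          filter_upwards [this] with k hk
          rw [altProd, altProd, Module.End.mul_apply, Module.End.mul_apply, h₂, hk,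
            hsub W₁ le_sup_left]
      · have := ih' W₂ W₁ h.symm _ h₂
        rw [← Filter.map_add_atTop_eq_nat 1, Filter.eventually_map]
        filter_upwards [this] with k hk
        rw [altProd, Module.End.mul_apply, hk, sup_comm, hsub W₂ le_sup_right]
  filter_upwards [Filter.eventually_all.2 fun y => key y W₁ W₂ h] with k hk
  refine LinearMap.ext fun v => Finsupp.ext fun z => ?_
  rw [end_apply_eq_sum, end_apply_eq_sum]
  exact Finset.sum_congr rfl fun x _ => by rw [hk x]

theorem confluent_thetaInv {W₁ W₂ : Submodule K (Y →₀ K)} (h : LmConfluent W₁ W₂) :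
    Confluent (thetaInv W₁, thetaInv W₂) := by
  obtain ⟨k, h₁, h₂, hk⟩ := ((eventually_altProd_eq h).and ((eventually_altProd_eq h.symm).and
    (Filter.eventually_ge_atTop 1))).exists
  exact ⟨k, hk, h₁.trans (by rw [sup_comm]; exact h₂.symm)⟩

/-- In the telescoped identity the remainder `a (b a)^n` is an alternating product, equal to `θ⁻¹(W₁
+ W₂)` for large `n`. -/
theorem fst_mul_pairLeftBound {W₁ W₂ : Submodule K (Y →₀ K)} (h : LmConfluent W₁ W₂) (k : ℕ)
    (hk : ConfluentAt (thetaInv W₁, thetaInv W₂) k) :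
    redOp W₁ * pairLeftBound (thetaInv W₁, thetaInv W₂) k hk =
      redOp W₁ - redOp (W₁ ⊔ W₂) := by
  have h2 : Filter.Tendsto (fun n : ℕ => 2 * n + 1) Filter.atTop Filter.atTop :=
    Filter.tendsto_atTop_mono (fun n => by simp only [id]; omega) Filter.tendsto_id
  obtain ⟨n, h₁, h₂⟩ := ((eventually_pairLeftBound_eq _ k hk).and
    (h2.eventually (eventually_altProd_eq h.symm))).exists
  rw [altProd_odd, sup_comm] at h₂
  rw [h₁, ← h₂]
  exact mul_one_sub_mul_sum (M := Module.End K (Y →₀ K)) _ (redOp_mul_self W₁) n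

/-- The left bound of the pair `(θ⁻¹(W₁), θ⁻¹(W₂))`. -/
def leftBound {W₁ W₂ : Submodule K (Y →₀ K)} (h : LmConfluent W₁ W₂) : Module.End K (Y →₀ K) :=
  pairLeftBound (thetaInv W₁, thetaInv W₂) _ (confluent_thetaInv h).choose_spec

theorem pairLeftBound_eq_leftBound {W₁ W₂ : Submodule K (Y →₀ K)} (h : LmConfluent W₁ W₂)
    {P : Red K Y × Red K Y} (hP : P = (thetaInv W₁, thetaInv W₂)) (k : ℕ) (hk : ConfluentAt P k) :
    pairLeftBound P k hk = leftBound h := by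
  subst hP
  exact pairLeftBound_eq_of_confluentAt _ _ _ _ _

theorem redOp_mul_leftBound {W₁ W₂ : Submodule K (Y →₀ K)} (h : LmConfluent W₁ W₂) :
    redOp W₁ * leftBound h = redOp W₁ - redOp (W₁ ⊔ W₂) :=
  fst_mul_pairLeftBound h _ _

theorem leftBound_mul_redOp {W₁ W₂ : Submodule K (Y →₀ K)} (h : LmConfluent W₁ W₂) :
    leftBound h * redOp W₁ = leftBound h :=
  pairLeftBound_mul_fst _ _ _

theorem leftBound_apply_mem {W₁ W₂ : Submodule K (Y →₀ K)} (h : LmConfluent W₁ W₂) (v : Y →₀ K) :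
    leftBound h v ∈ W₂ :=
  redOp_apply_eq_zero_iff.1 (LinearMap.congr_fun
    (snd_mul_pairLeftBound (thetaInv W₁, thetaInv W₂) _ (confluent_thetaInv h).choose_spec) v)

theorem exists_leftBound_apply_eq {W₁ W₂ : Submodule K (Y →₀ K)} (h : LmConfluent W₁ W₂)
    (v : Y →₀ K) : ∃ w, (∀ z, w z ≠ 0 → z ∈ normalSet W₁) ∧ leftBound h v = w - redOp W₂ w := by
  obtain ⟨G, hG⟩ := exists_pairLeftBound_eq_mul (thetaInv W₁, thetaInv W₂) _
    (confluent_thetaInv h).choose_spec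
  exact ⟨redOp W₁ (G v), fun z hz => mem_normalSet_of_redOp_apply hz, LinearMap.congr_fun hG v⟩

/-- A value of the left bound is `w - redOp W₂ w` with `w` normal for `W₁`; normal monomials of
either subspace avoid the leading monomials of the intersection. -/
theorem leftBound_apply_ne_zero {W₁ W₂ : Submodule K (Y →₀ K)} (h : LmConfluent W₁ W₂)
    {v : Y →₀ K} {z : Y} (hz : leftBound h v z ≠ 0) : z ∉ lmSet (W₁ ⊓ W₂) := by
  obtain ⟨w, hw, e⟩ := exists_leftBound_apply_eq h v
  intro hcon
  have h₁ : w z = 0 := by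
    by_contra hne
    exact mem_normalSet_iff.1 (hw z hne) (lmSet_mono inf_le_left hcon)
  have h₂ : redOp W₂ w z = 0 := by
    by_contra hne
    exact mem_normalSet_iff.1 (mem_normalSet_of_redOp_apply hne) (lmSet_mono inf_le_right hcon)
  refine hz ?_
  rw [e, Finsupp.sub_apply, h₁, h₂, sub_zero]

/-- For `v ∈ W₂`, the left bound subtracts from `v` an element of `W₁ ∩ W₂`. -/
theorem sub_leftBound_apply_mem {W₁ W₂ : Submodule K (Y →₀ K)} (h : LmConfluent W₁ W₂)
    {v : Y →₀ K} (hv : v ∈ W₂) : v - leftBound h v ∈ W₁ ⊓ W₂ := by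
  refine ⟨?_, W₂.sub_mem hv (leftBound_apply_mem h v)⟩
  have h1 := LinearMap.congr_fun (redOp_mul_leftBound h) v
  -- As `v ∈ W₂`, the operator `θ⁻¹(W₁ + W₂)` kills `v`, so `v` and its left bound have the same
  -- image under `θ⁻¹(W₁)`.
  rw [Module.End.mul_apply, LinearMap.sub_apply,
    redOp_apply_eq_zero_iff.2 (Submodule.mem_sup_right hv), sub_zero] at h1
  exact redOp_apply_eq_zero_iff.1 (by rw [map_sub, h1, sub_self])

end Operators

/-! ### Words and subspaces of tensor powers -/

section Words

theorem append_lt_append_left_iff {X : Type*} [LinearOrder X] (u : List X) {v v' : List X} :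
    u ++ v < u ++ v' ↔ v < v' := by
  induction u with
  | nil => simp
  | cons x u ih => simp [ih]

theorem append_lt_append_of_lt {X : Type*} [LinearOrder X] {u u' : List X}
    (hl : u.length = u'.length) (h : u < u') (v v' : List X) : u ++ v < u' ++ v' := by
  induction u generalizing u' with
  | nil =>
    cases u' with
    | nil => exact absurd h (lt_irrefl _)
    | cons => simp at hl
  | cons x u ih =>
    cases u' with
    | nil => simp at hl
    | cons x' u' =>
      rw [List.cons_lt_cons_iff] at h
      rw [List.cons_append, List.cons_append, List.cons_lt_cons_iff]
      exact h.imp id fun h => ⟨h.1, ih (by simpa using hl) h.2⟩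

variable {K X : Type*} [Field K]

/-- The word `u v t`. -/
def glue {i p j m : ℕ} (h : i + p + j = m) (u : Word X i) (t : Word X j) (v : Word X p) :
    Word X m :=
  ⟨u.1 ++ v.1 ++ t.1, by simp only [List.length_append, u.2, v.2, t.2, h]⟩

theorem glue_inj {i p j m : ℕ} (h : i + p + j = m) {u u' : Word X i} {t t' : Word X j}
    {v v' : Word X p} : glue h u t v = glue h u' t' v' ↔ u = u' ∧ t = t' ∧ v = v' := by
  constructor
  · intro e
    have e := congrArg Subtype.val e
    simp only [glue] at e
    obtain ⟨e₁, e₂⟩ := List.append_inj e (by simp [u.2, u'.2, v.2, v'.2])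
    obtain ⟨e₃, e₄⟩ := List.append_inj e₁ (by simp [u.2, u'.2])
    exact ⟨Subtype.ext e₃, Subtype.ext e₂, Subtype.ext e₄⟩
  · rintro ⟨rfl, rfl, rfl⟩
    rfl

theorem glue_injective {i p j m : ℕ} (h : i + p + j = m) (u : Word X i) (t : Word X j) :
    Function.Injective (glue h u t) := fun _ _ e => ((glue_inj h).1 e).2.2

theorem exists_glue {i p j m : ℕ} (h : i + p + j = m) (w : Word X m) :
    ∃ (u : Word X i) (t : Word X j) (v : Word X p), w = glue h u t v := by
  have hw := w.2
  refine ⟨⟨w.1.take i, by rw [List.length_take]; omega⟩,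
    ⟨w.1.drop (i + p), by rw [List.length_drop]; omega⟩,
    ⟨(w.1.drop i).take p, by rw [List.length_take, List.length_drop]; omega⟩, Subtype.ext ?_⟩
  simp only [glue]
  rw [List.append_assoc, ← List.drop_drop, List.take_append_drop, List.take_append_drop]

theorem glue_strictMono [LinearOrder X] {i p j m : ℕ} (h : i + p + j = m) (u : Word X i)
    (t : Word X j) : StrictMono (glue h u t) := by
  intro v v' hv
  change u.1 ++ v.1 ++ t.1 < u.1 ++ v'.1 ++ t.1
  rw [List.append_assoc, List.append_assoc, append_lt_append_left_iff]
  exact append_lt_append_of_lt (v.2.trans v'.2.symm) hv _ _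

theorem sandwich_single {i p j m : ℕ} (h : i + p + j = m) (u : Word X i) (t : Word X j)
    (v : Word X p) (c : K) :
    sandwich h u t (Finsupp.single v c) = Finsupp.single (glue h u t v) c := by
  simp [sandwich, Finsupp.lmapDomain_apply, Finsupp.mapDomain_single, glue]

theorem sandwich_apply_glue {i p j m : ℕ} (h : i + p + j = m) (u : Word X i) (t : Word X j)
    (f : TensorPow K X p) (v : Word X p) : sandwich h u t f (glue h u t v) = f v :=
  Finsupp.mapDomain_apply (glue_injective h u t) f v

theorem exists_of_sandwich_apply_ne_zero {i p j m : ℕ} {h : i + p + j = m} {u : Word X i}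
    {t : Word X j} {f : TensorPow K X p} {w : Word X m} (hw : sandwich h u t f w ≠ 0) :
    ∃ v, w = glue h u t v ∧ f v ≠ 0 := by
  by_cases hr : w ∈ Set.range (glue h u t)
  · obtain ⟨v, rfl⟩ := hr
    exact ⟨v, rfl, by rwa [sandwich_apply_glue] at hw⟩
  · exact absurd (Finsupp.mapDomain_of_notMem_range f w hr) hw

/-- The coefficient `f ↦ f_{u,t}` in the decomposition `f = ∑ u f_{u,t} t`. -/
def cut {i p j m : ℕ} (h : i + p + j = m) (u : Word X i) (t : Word X j) :
    TensorPow K X m →ₗ[K] TensorPow K X p :=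
  Finsupp.lcomapDomain (glue h u t) (glue_injective h u t)

theorem cut_apply {i p j m : ℕ} (h : i + p + j = m) (u : Word X i) (t : Word X j)
    (f : TensorPow K X m) (v : Word X p) : cut h u t f v = f (glue h u t v) := rfl

theorem cut_sandwich_self {i p j m : ℕ} (h : i + p + j = m) (u : Word X i) (t : Word X j)
    (f : TensorPow K X p) : cut h u t (sandwich h u t f) = f := by
  ext v
  rw [cut_apply, sandwich_apply_glue]

theorem cut_sandwich_of_ne {i p j m : ℕ} (h : i + p + j = m) {u u' : Word X i} {t t' : Word X j}
    (hne : ¬ (u = u' ∧ t = t')) (f : TensorPow K X p) : cut h u t (sandwich h u' t' f) = 0 := by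
  ext v
  rw [cut_apply]
  by_contra h0
  obtain ⟨v', e, _⟩ := exists_of_sandwich_apply_ne_zero h0
  rw [glue_inj] at e
  exact hne ⟨e.1, e.2.1⟩

theorem sandwich_mem_tensorSub {i p j m : ℕ} (h : i + p + j = m) (u : Word X i) (t : Word X j)
    {U : Submodule K (TensorPow K X p)} {f : TensorPow K X p} (hf : f ∈ U) :
    sandwich h u t f ∈ tensorSub i j h U :=
  (le_iSup₂_of_le u t le_rfl : U.map (sandwich h u t) ≤ tensorSub i j h U) ⟨f, hf, rfl⟩

theorem tensorSub_mono {i p j m : ℕ} (h : i + p + j = m) {U U' : Submodule K (TensorPow K X p)}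
    (hU : U ≤ U') : tensorSub i j h U ≤ tensorSub i j h U' :=
  iSup₂_mono fun _ _ => Submodule.map_mono hU

theorem tensorSub_iSup {ι : Sort*} {i p j m : ℕ} (h : i + p + j = m)
    (U : ι → Submodule K (TensorPow K X p)) :
    tensorSub i j h (⨆ k, U k) = ⨆ k, tensorSub i j h (U k) := by
  simp only [tensorSub, Submodule.map_iSup]
  rw [iSup_comm]
  conv_lhs => enter [1, t]; rw [iSup_comm]
  rw [iSup_comm]
  exact iSup_congr fun k => iSup_comm

theorem tensorOp_single_glue {i p j m : ℕ} (h : i + p + j = m)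
    (T : Module.End K (TensorPow K X p)) (u : Word X i) (t : Word X j) (v : Word X p) :
    tensorOp i j h T (Finsupp.single (glue h u t v) 1) =
      sandwich h u t (T (Finsupp.single v 1)) := by
  obtain ⟨u, hu⟩ := u
  obtain ⟨v, hv⟩ := v
  subst hu hv
  simp [tensorOp, glue]

theorem tensorOp_sandwich {i p j m : ℕ} (h : i + p + j = m) (T : Module.End K (TensorPow K X p))
    (u : Word X i) (t : Word X j) (f : TensorPow K X p) :
    tensorOp i j h T (sandwich h u t f) = sandwich h u t (T f) := by
  induction f using Finsupp.induction_linear with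
  | zero => simp
  | add f g hf hg => simp only [map_add, hf, hg]
  | single v c =>
    rw [← mul_one c, ← smul_eq_mul, ← Finsupp.smul_single, map_smul, map_smul, map_smul, map_smul,
      sandwich_single, tensorOp_single_glue]

theorem tensorSub_le_ker_tensorOp {i p j m : ℕ} (h : i + p + j = m)
    {T : Module.End K (TensorPow K X p)} {U : Submodule K (TensorPow K X p)}
    (hU : U ≤ LinearMap.ker T) : tensorSub i j h U ≤ LinearMap.ker (tensorOp i j h T) := by
  refine iSup₂_le fun u t => ?_
  rintro _ ⟨f, hf, rfl⟩
  rw [LinearMap.mem_ker, tensorOp_sandwich, LinearMap.mem_ker.1 (hU hf), map_zero]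

theorem IsTriangular.tensorOp [LinearOrder X] {i p j m : ℕ} (h : i + p + j = m)
    {T : Module.End K (TensorPow K X p)} (hT : IsTriangular T) :
    IsTriangular (tensorOp i j h T) := by
  intro y z hz
  obtain ⟨u, t, v, rfl⟩ := exists_glue h y
  rw [tensorOp_single_glue] at hz
  obtain ⟨v', rfl, hv'⟩ := exists_of_sandwich_apply_ne_zero hz
  exact (glue_strictMono h u t).monotone (hT v v' hv')

theorem sum_sandwich_cut {i p j m : ℕ} (h : i + p + j = m) [Fintype (Word X i)]
    [Fintype (Word X j)] (f : TensorPow K X m) :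
    ∑ u : Word X i, ∑ t : Word X j, sandwich h u t (cut h u t f) = f := by
  classical
  induction f using Finsupp.induction_linear with
  | zero => simp
  | add f g hf hg =>
    simp only [map_add, Finset.sum_add_distrib, hf, hg]
  | single w c =>
    obtain ⟨u, t, v, rfl⟩ := exists_glue h w
    rw [← sandwich_single, Finset.sum_eq_single u, Finset.sum_eq_single t, cut_sandwich_self]
    · intro t' _ ht'
      rw [cut_sandwich_of_ne h (fun e => ht' e.2), map_zero]
    · simp
    · intro u' _ hu'
      refine Finset.sum_eq_zero fun t' _ => ?_
      rw [cut_sandwich_of_ne h (fun e => hu' e.1), map_zero]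
    · simp

variable [Finite X]

/-- Being a sum by definition, `tensorSub` obviously commutes with sums; this coefficientwise
description makes it commute with intersections as well. -/
theorem mem_tensorSub_iff {i p j m : ℕ} (h : i + p + j = m) {U : Submodule K (TensorPow K X p)}
    {f : TensorPow K X m} : f ∈ tensorSub i j h U ↔ ∀ u t, cut h u t f ∈ U := by
  classical
  constructor
  · intro hf u t
    suffices H : tensorSub i j h U ≤ U.comap (cut h u t) from H hf
    refine iSup₂_le fun u' t' => ?_
    rintro _ ⟨g, hg, rfl⟩
    rw [Submodule.mem_comap]
    by_cases e : u = u' ∧ t = t'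
    · obtain ⟨rfl, rfl⟩ := e
      rwa [cut_sandwich_self]
    · rw [cut_sandwich_of_ne h e]
      exact U.zero_mem
  · intro hf
    have := Fintype.ofFinite (Word X i)
    have := Fintype.ofFinite (Word X j)
    rw [← sum_sandwich_cut h f]
    exact Submodule.sum_mem _ fun u _ => Submodule.sum_mem _ fun t _ =>
      sandwich_mem_tensorSub h u t (hf u t)

theorem tensorSub_iInf {ι : Sort*} {i p j m : ℕ} (h : i + p + j = m)
    (U : ι → Submodule K (TensorPow K X p)) :
    tensorSub i j h (⨅ k, U k) = ⨅ k, tensorSub i j h (U k) := by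
  ext f
  simp only [mem_tensorSub_iff, Submodule.mem_iInf]
  exact ⟨fun H k u t => H u t k, fun H u t k => H k u t⟩

theorem tensorSub_inf {i p j m : ℕ} (h : i + p + j = m) (U U' : Submodule K (TensorPow K X p)) :
    tensorSub i j h (U ⊓ U') = tensorSub i j h U ⊓ tensorSub i j h U' := by
  ext f
  simp only [mem_tensorSub_iff, Submodule.mem_inf, forall_and]

theorem tensorSub_top {i p j m : ℕ} (h : i + p + j = m) :
    tensorSub i j h (⊤ : Submodule K (TensorPow K X p)) = ⊤ := by
  ext f
  simp [mem_tensorSub_iff]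

theorem tensorSub_tensorSub {i j i' j' p q m : ℕ} (h : i + q + j = m) (h' : i' + p + j' = q)
    (h'' : i + i' + p + (j' + j) = m) (U : Submodule K (TensorPow K X p)) :
    tensorSub i j h (tensorSub i' j' h' U) = tensorSub (i + i') (j' + j) h'' U := by
  ext f
  have hcut : ∀ u t u' t', cut h' u' t' (cut h u t f) =
      cut h'' ⟨u.1 ++ u'.1, by simp [u.2, u'.2]⟩ ⟨t'.1 ++ t.1, by simp [t.2, t'.2]⟩ f := by
    intro u t u' t'
    ext v
    simp only [cut_apply]
    congr 1
    exact Subtype.ext (by simp [glue])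
  simp only [mem_tensorSub_iff]
  constructor
  · intro H u t
    have hu := u.2
    have ht := t.2
    have := H ⟨u.1.take i, by rw [List.length_take]; omega⟩
      ⟨t.1.drop j', by rw [List.length_drop]; omega⟩ ⟨u.1.drop i, by rw [List.length_drop]; omega⟩
      ⟨t.1.take j', by rw [List.length_take]; omega⟩
    rw [hcut] at this
    simpa only [List.take_append_drop] using this
  · intro H u t u' t'
    rw [hcut]
    exact H _ _

/-! ### Leading words and confluence of subspaces `V^{⊗ i} ⊗ U ⊗ V^{⊗ j}`. -/

variable [LinearOrder X]

/-- Inserting a word between fixed `u` and `t` is strictly increasing, so passing to the coefficient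
at `(u, t)`, or back, preserves leading words. -/
theorem glue_mem_lmSet_tensorSub {i p j m : ℕ} (h : i + p + j = m)
    {U : Submodule K (TensorPow K X p)} {u : Word X i} {t : Word X j} {v : Word X p} :
    glue h u t v ∈ lmSet (tensorSub i j h U) ↔ v ∈ lmSet U := by
  rw [mem_lmSet, mem_lmSet]
  constructor
  · rintro ⟨f, hf, hf0, hfl⟩
    exact ⟨cut h u t f, (mem_tensorSub_iff h).1 hf u t, hf0,
      fun z hz => (glue_strictMono h u t).le_iff_le.1 (hfl _ hz)⟩
  · rintro ⟨f, hf, hf0, hfl⟩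
    refine ⟨sandwich h u t f, sandwich_mem_tensorSub h u t hf, by rwa [sandwich_apply_glue], ?_⟩
    intro z hz
    obtain ⟨v', rfl, hv'⟩ := exists_of_sandwich_apply_ne_zero hz
    exact (glue_strictMono h u t).monotone (hfl v' hv')

theorem LmConfluent.tensorSub {i p j m : ℕ} (h : i + p + j = m)
    {U U' : Submodule K (TensorPow K X p)} (hU : LmConfluent U U') :
    LmConfluent (tensorSub i j h U) (tensorSub i j h U') := by
  intro y hy
  obtain ⟨u, t, v, rfl⟩ := exists_glue h y
  have := lmSet_mono (sup_le (tensorSub_mono h le_sup_left) (tensorSub_mono h le_sup_right)) hy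
  rw [glue_mem_lmSet_tensorSub] at this
  exact (hU this).imp (glue_mem_lmSet_tensorSub h).2 (glue_mem_lmSet_tensorSub h).2

theorem redOp_tensorSub_sandwich {i p j m : ℕ} (h : i + p + j = m)
    (U : Submodule K (TensorPow K X p)) (u : Word X i) (t : Word X j) (f : TensorPow K X p) :
    redOp (tensorSub i j h U) (sandwich h u t f) = sandwich h u t (redOp U f) := by
  rw [redOp_apply_eq_iff, ← map_sub]
  refine ⟨sandwich_mem_tensorSub h u t (sub_redOp_mem U f), fun z hz => ?_⟩
  obtain ⟨v, rfl, hv⟩ := exists_of_sandwich_apply_ne_zero hz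
  rw [mem_normalSet_iff, glue_mem_lmSet_tensorSub, ← mem_normalSet_iff]
  exact mem_normalSet_of_redOp_apply hv

/-- Relations on disjoint factors are confluent. -/
theorem lmConfluent_tensorSub_of_disjoint {p q i j m : ℕ} (h : 0 + p + j = m) (h' : i + q + 0 = m)
    (hpi : p ≤ i) (U : Submodule K (TensorPow K X p)) (U' : Submodule K (TensorPow K X q)) :
    LmConfluent (tensorSub 0 j h U) (tensorSub i 0 h' U') := by
  have := Fintype.ofFinite (Word X p)
  intro y hy
  obtain ⟨f, hf, hf0, hfl⟩ := mem_lmSet.1 hy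
  obtain ⟨e, t, v, rfl⟩ := exists_glue h y
  by_cases hv : v ∈ lmSet U
  · exact Or.inl ((glue_mem_lmSet_tensorSub h).2 hv)
  right
  rw [← mem_normalSet_iff] at hv
  have hpj : p + j + 0 = m := by omega
  have hglue : ∀ x z, glue h e z x = glue hpj x e z := fun x z => Subtype.ext (by
    obtain ⟨e, he⟩ := e
    obtain rfl := List.length_eq_zero_iff.1 he
    simp [glue])
  -- contract the first `p` letters with a linear form that vanishes on `U`
  set ρ : Word X p → K := fun x => redOp U (Finsupp.single x 1) v with hρ
  set C : TensorPow K X m →ₗ[K] TensorPow K X j := ∑ x, ρ x • cut hpj x e with hC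
  have hCapp : ∀ g z, C g z = ∑ x, ρ x * g (glue h e z x) := by
    intro g z
    simp [hC, LinearMap.sum_apply, Finsupp.finsetSum_apply, cut_apply, hglue]
  have hC₁ : ∀ g ∈ tensorSub 0 j h U, C g = 0 := by
    intro g hg
    ext z
    have h1 := redOp_apply_eq_zero_iff.2 ((mem_tensorSub_iff h).1 hg e z)
    have h2 := DFunLike.congr_fun h1 v
    rw [end_apply_eq_sum, Finset.sum_subset (Finset.subset_univ _)
      (fun x _ hx => by simp only [Finsupp.mem_support_iff, not_not] at hx; simp [hx])] at h2
    rw [hCapp]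
    simpa [cut_apply, mul_comm] using h2
  have hq : i - p + q + 0 = j := by omega
  have hC₂ : ∀ g ∈ tensorSub i 0 h' U', C g ∈ tensorSub (i - p) 0 hq U' := by
    intro g hg
    rw [hC, LinearMap.sum_apply]
    refine Submodule.sum_mem _ fun x _ => Submodule.smul_mem _ _ ?_
    have hip : p + (i - p) = i := by omega
    have := tensorSub_tensorSub hpj hq (by omega) U'
    simp only [hip] at this
    rw [← this] at hg
    exact (mem_tensorSub_iff hpj).1 hg x e
  -- Although `C` mixes prefixes, only `v` contributes to `C f`: a prefix `x ≠ v` with `ρ x ≠ 0` is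
  -- greater than `v`, and `f` has no word that large.
  have hCf : ∀ z, C f z = f (glue h e z v) := by
    intro z
    rw [hCapp, Finset.sum_eq_single v]
    · simp [hρ, redOp_single_of_mem_normalSet hv]
    · intro x _ hxv
      by_contra hne
      have hxz := hfl _ (right_ne_zero_of_mul hne)
      have hvx := (thetaInv U).isTriangular x v (left_ne_zero_of_mul hne)
      refine absurd hxz (not_le.2 ?_)
      have hlt : v < x := lt_of_le_of_ne hvx (Ne.symm hxv)
      rw [hglue, hglue]
      change v.1 ++ t.1 ++ e.1 < x.1 ++ z.1 ++ e.1
      rw [List.append_assoc, List.append_assoc]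
      exact append_lt_append_of_lt (v.2.trans x.2.symm) hlt _ _
    · simp
  obtain ⟨f₁, hf₁, f₂, hf₂, rfl⟩ := Submodule.mem_sup.1 hf
  -- `C` removes the component of `f` in the first subspace, so `C f` comes from the second one; its
  -- leading word is what remains of `y = v t` after `v`.
  have ht : t ∈ lmSet (tensorSub (i - p) 0 hq U') := by
    refine mem_lmSet.2 ⟨C (f₁ + f₂), ?_, by rwa [hCf], fun z hz => ?_⟩
    · rw [map_add, hC₁ f₁ hf₁, zero_add]
      exact hC₂ f₂ hf₂
    · rw [hCf] at hz
      have := hfl _ hz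
      rw [hglue, hglue] at this
      exact (glue_strictMono hpj v e).le_iff_le.1 this
  have hip : p + (i - p) = i := by omega
  have hE := tensorSub_tensorSub hpj hq (by omega) U'
  simp only [hip] at hE
  rw [← hE, hglue, glue_mem_lmSet_tensorSub]
  exact ht

end Words
namespace HomPresentation

/-! ### The operator `S` and the relations of a reduced presentation -/

section Relations

variable {K X : Type*} [Field K]

theorem incl_apply {m : ℕ} (f : TensorPow K X m) (w : Word X m) : incl m f w.1 = f w :=
  Finsupp.mapDomain_apply Subtype.val_injective f w

theorem incl_single {m : ℕ} (w : Word X m) (c : K) :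
    incl m (Finsupp.single w c) = Finsupp.single w.1 c := by
  simp [incl, Finsupp.lmapDomain_apply, Finsupp.mapDomain_single]

theorem append_append_injective {N : ℕ} (u t : List X) :
    Function.Injective fun v : Word X N => u ++ v.1 ++ t := by
  intro v v' e
  exact Subtype.ext (List.append_cancel_left (List.append_cancel_right e))

variable [LinearOrder X]

theorem reduction_apply {N : ℕ} (u t : List X) {f : TensorPow K X N} {w : Word X N}
    (hw : lm f = (w : WithBot (Word X N))) (g : TensorAlg K X) :
    reduction u f t g =
      g - g (u ++ w.1 ++ t) • Finsupp.mapDomain (fun v : Word X N => u ++ v.1 ++ t) f := by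
  classical
  have hex : ∀ x : List X, (∃ v : Word X N, lm f = (v : WithBot (Word X N)) ∧ x = u ++ v.1 ++ t) ↔
      x = u ++ w.1 ++ t := by
    intro x
    constructor
    · rintro ⟨v, hv, rfl⟩
      rw [hw, WithBot.coe_inj] at hv
      rw [hv]
    · rintro rfl
      exact ⟨w, hw, rfl⟩
  induction g using Finsupp.induction_linear with
  | zero => simp
  | add g g' hg hg' =>
    rw [map_add, hg, hg', Finsupp.add_apply, add_smul]
    abel
  | single x c =>
    rw [reduction, Finsupp.linearCombination_single]
    simp only [hex]
    split_ifs with hx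
    · subst hx
      simp [smul_sub]
    · rw [Finsupp.single_eq_of_ne (Ne.symm hx)]
      simp

theorem reduction_eq_self_iff {N : ℕ} (u t : List X) {f : TensorPow K X N} {w : Word X N}
    (hw : lm f = (w : WithBot (Word X N))) (g : TensorAlg K X) :
    reduction u f t g = g ↔ g (u ++ w.1 ++ t) = 0 := by
  rw [reduction_apply u t hw, sub_eq_self, smul_eq_zero]
  refine or_iff_left fun h => (lm_eq_iff.1 hw).1 ?_
  have := DFunLike.congr_fun h (u ++ w.1 ++ t)
  rwa [Finsupp.mapDomain_apply (append_append_injective u t)] at this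

variable {P : HomPresentation K X}

theorem IsReduced.exists_lm (hP : P.IsReduced) {f : TensorPow K X P.N} (hf : f ∈ P.R) :
    ∃ w : Word X P.N, lm f = (w : WithBot (Word X P.N)) :=
  let ⟨w, hw, _⟩ := hP f hf
  ⟨w, hw⟩

theorem IsReduced.isNormalForm_iff (hP : P.IsReduced) {g : TensorAlg K X} :
    IsNormalForm P.R g ↔ ∀ (u t : List X), ∀ f ∈ P.R, ∀ w : Word X P.N,
      lm f = (w : WithBot (Word X P.N)) → g (u ++ w.1 ++ t) = 0 := by
  constructor
  · intro h u t f hf w hw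
    exact (reduction_eq_self_iff u t hw g).1 (h _ ⟨u, t, f, hf, rfl⟩)
  · rintro h _ ⟨u, t, f, hf, rfl⟩
    obtain ⟨w, hw⟩ := hP.exists_lm hf
    exact (reduction_eq_self_iff u t hw g).2 (h u t f hf w hw)

/-- By reducedness `lm f` is normal for `R \ {f}`, so no other relation can have it as leading word.
This removes the choice hidden in `operatorS`. -/
theorem IsReduced.lm_injOn (hP : P.IsReduced) {f g : TensorPow K X P.N} (hf : f ∈ P.R)
    (hg : g ∈ P.R) (h : lm f = lm g) : f = g := by
  by_contra hne
  obtain ⟨w, hw, _, _, hnf⟩ := hP f hf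
  have h1 := (reduction_eq_self_iff [] [] (h ▸ hw) _).1
    (hnf _ ⟨[], [], g, ⟨hg, fun e => hne e.symm⟩, rfl⟩)
  simp [incl_single] at h1

theorem IsReduced.operatorS_single (hP : P.IsReduced) {f : TensorPow K X P.N} (hf : f ∈ P.R)
    {w : Word X P.N} (hw : lm f = (w : WithBot (Word X P.N))) :
    P.operatorS (Finsupp.single w 1) = Finsupp.single w 1 - f := by
  classical
  have hex : ∃ f ∈ P.R, lm f = (w : WithBot (Word X P.N)) := ⟨f, hf, hw⟩
  rw [operatorS, Finsupp.linearCombination_single, one_smul, dif_pos hex,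
    hP.lm_injOn hex.choose_spec.1 hf (hex.choose_spec.2.trans hw.symm)]

theorem operatorS_single_of_not {w : Word X P.N}
    (h : ¬ ∃ f ∈ P.R, lm f = (w : WithBot (Word X P.N))) :
    P.operatorS (Finsupp.single w 1) = Finsupp.single w 1 := by
  classical
  rw [operatorS, Finsupp.linearCombination_single, one_smul, dif_neg h]

/-- By reducedness no word of `lm(f) - f` is the leading word of a relation, so `S` fixes `lm(f) -
f`, which is also `S(lm(f))`. -/
theorem IsReduced.operatorS_relation (hP : P.IsReduced) {f : TensorPow K X P.N} (hf : f ∈ P.R) :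
    P.operatorS f = 0 := by
  obtain ⟨w, hw, _, hnf, _⟩ := hP f hf
  have h1 : P.operatorS (Finsupp.single w 1 - f) = Finsupp.single w 1 - f := by
    refine end_apply_eq_self fun x hx => operatorS_single_of_not ?_
    rintro ⟨f', hf', hx'⟩
    have := hP.isNormalForm_iff.1 hnf [] [] f' hf' x hx'
    rw [List.nil_append, List.append_nil, incl_apply] at this
    exact hx this
  rw [map_sub, hP.operatorS_single hf hw] at h1
  have h2 : P.operatorS f = (Finsupp.single w 1 - f) - (Finsupp.single w 1 - f) := by
    nth_rewrite 2 [← h1]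
    abel
  rw [h2, sub_self]

theorem IsReduced.Rbar_le_ker (hP : P.IsReduced) : P.Rbar ≤ LinearMap.ker P.operatorS :=
  Submodule.span_le.2 fun _ hf => hP.operatorS_relation hf

theorem IsReduced.isTriangular (hP : P.IsReduced) : IsTriangular P.operatorS := by
  intro y z hz
  by_cases h : ∃ f ∈ P.R, lm f = (y : WithBot (Word X P.N))
  · obtain ⟨f, hf, hy⟩ := h
    rw [hP.operatorS_single hf hy, Finsupp.sub_apply] at hz
    by_contra hcon
    have h1 : f z = 0 := by
      by_contra h0
      exact hcon ((lm_eq_iff.1 hy).2 z h0)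
    rw [h1, sub_zero] at hz
    exact hcon (single_ne_zero_cases hz).le
  · rw [operatorS_single_of_not h] at hz
    exact (single_ne_zero_cases hz).le

/-- `S` is triangular, kills `R̄`, and fixes all words that are not leading words of relations; such
a word cannot lead an element of the kernel. -/
theorem IsReduced.mem_lmSet_Rbar (hP : P.IsReduced) {w : Word X P.N} :
    w ∈ lmSet P.Rbar ↔ ∃ f ∈ P.R, lm f = (w : WithBot (Word X P.N)) := by
  constructor
  · exact fun h => lmSet_subset_of_le_ker hP.isTriangular hP.Rbar_le_ker
      (s := {w | ∃ f ∈ P.R, lm f = (w : WithBot (Word X P.N))})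
      (fun y hy => operatorS_single_of_not hy) h
  · rintro ⟨f, hf, hw⟩
    exact ⟨f, Submodule.subset_span hf, hw⟩

end Relations

/-! ### The subspaces `V^{⊗ i} ⊗ R̄ ⊗ V^{⊗ j}` -/

section RelationSubspaces

variable {K X : Type*} [Field K]

theorem tensorSub_congr {i j i' j' p m : ℕ} {h : i + p + j = m} {h' : i' + p + j' = m}
    (U : Submodule K (TensorPow K X p)) (hi : i = i') (hj : j = j') :
    tensorSub i j h U = tensorSub i' j' h' U := by
  subst hi hj
  rfl

/-- The positions `(i, j)` of a factor of length `N` in a word of length `m`. -/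
abbrev Position (N m : ℕ) : Type := {q : ℕ × ℕ // q.1 + N + q.2 = m}

instance (N m : ℕ) : Finite (Position N m) :=
  Finite.of_injective (fun q : Position N m => (⟨q.1.1, by have := q.2; omega⟩ : Fin (m + 1)))
    fun q q' e => by
      have h := q.2
      have h' := q'.2
      simp only [Fin.mk.injEq] at e
      exact Subtype.ext (Prod.ext e (by omega))

theorem position_ext {N m : ℕ} {q q' : Position N m} (h : q.1.1 = q'.1.1) : q = q' := by
  have h₁ := q.2
  have h₂ := q'.2
  exact Subtype.ext (Prod.ext h (by omega))

variable (P : HomPresentation K X)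

/-- The subspace `V^{⊗ i} ⊗ R̄ ⊗ V^{⊗ j}` of `V^{⊗ m}`. -/
def relSub {m : ℕ} (q : Position P.N m) : Submodule K (TensorPow K X m) :=
  tensorSub q.1.1 q.1.2 q.2 P.Rbar

theorem idealComp_eq (m : ℕ) : P.idealComp m = ⨆ q : Position P.N m, P.relSub q := by
  apply le_antisymm
  · exact iSup_le fun i => iSup_le fun j => iSup_le fun h =>
      le_iSup (fun q : Position P.N m => P.relSub q) ⟨(i, j), h⟩
  · exact iSup_le fun q => le_iSup_of_le q.1.1 (le_iSup_of_le q.1.2 (le_iSup_of_le q.2 le_rfl))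

theorem J_eq (n : ℕ) : P.J (n + 2) = ⨅ q : Position P.N (P.l (n + 2)), P.relSub q := by
  rw [J, if_neg (by omega)]
  apply le_antisymm
  · exact le_iInf fun q => iInf_le_of_le q.1.1 (iInf_le_of_le q.1.2 (iInf_le_of_le q.2 le_rfl))
  · exact le_iInf fun i => le_iInf fun j => le_iInf fun h =>
      iInf_le (fun q : Position P.N (P.l (n + 2)) => P.relSub q) ⟨(i, j), h⟩

theorem l_add_two (n : ℕ) : P.l (n + 2) = P.l n + P.N := by
  have h1 : (n + 2) / 2 = n / 2 + 1 := by omega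
  have h2 : (n + 2) % 2 = n % 2 := by omega
  rw [l, l, lN, lN, h1, h2]
  ring

theorem l_le_succ (n : ℕ) : P.l n ≤ P.l (n + 1) := lN_le_succ P.two_le n

theorem l_zero : P.l 0 = 0 := by simp [l, lN]

theorem l_one : P.l 1 = 1 := by simp [l, lN]

variable [Finite X]

theorem relSub_eq_tensorSub {m : ℕ} (q : Position P.N m) {i j p a b : ℕ} (h : i + p + j = m)
    (h' : a + P.N + b = p) (hi : i + a = q.1.1) (hj : b + j = q.1.2) :
    P.relSub q = tensorSub i j h (tensorSub a b h' P.Rbar) := by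
  rw [tensorSub_tensorSub h h' (by omega)]
  exact tensorSub_congr _ hi.symm hj.symm

theorem tensorSub_idealComp {d p m : ℕ} (h : 0 + d + p = m) :
    tensorSub 0 p h (P.idealComp d) = ⨆ q : {q : Position P.N m // p ≤ q.1.2}, P.relSub q.1 := by
  rw [idealComp_eq, tensorSub_iSup]
  apply le_antisymm
  · refine iSup_le fun q => ?_
    have hq := q.2
    rw [relSub, ← P.relSub_eq_tensorSub ⟨(q.1.1, q.1.2 + p), by simp only; omega⟩ h q.2
      (by simp) rfl]
    exact le_iSup (fun q : {q : Position P.N m // p ≤ q.1.2} => P.relSub q.1)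
      ⟨⟨(q.1.1, q.1.2 + p), by simp only; omega⟩, by simp⟩
  · refine iSup_le fun q => ?_
    have hq := q.1.2
    have hq' := q.2
    rw [P.relSub_eq_tensorSub q.1 h (a := q.1.1.1) (b := q.1.1.2 - p) (by omega) (by omega)
      (by omega)]
    exact le_iSup (fun q : Position P.N d => tensorSub 0 p h (P.relSub q))
      ⟨(q.1.1.1, q.1.1.2 - p), by simp only; omega⟩

theorem tensorSub_J {n d m : ℕ} (h : d + P.l (n + 2) + 0 = m) :
    tensorSub d 0 h (P.J (n + 2)) =
      ⨅ (q : Position P.N m) (_ : d ≤ q.1.1), P.relSub q := by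
  rw [J_eq, tensorSub_iInf]
  apply le_antisymm
  · refine le_iInf₂ fun q hd => ?_
    have hq := q.2
    rw [P.relSub_eq_tensorSub q h (a := q.1.1 - d) (b := q.1.2) (by omega) (by omega) (by omega)]
    exact iInf_le (fun q : Position P.N (P.l (n + 2)) => tensorSub d 0 h (P.relSub q))
      ⟨(q.1.1 - d, q.1.2), by simp only; omega⟩
  · refine le_iInf fun q => ?_
    have hq := q.2
    rw [relSub, ← P.relSub_eq_tensorSub ⟨(d + q.1.1, q.1.2), by simp only; omega⟩ h q.2 rfl
      (by simp)]
    exact iInf₂_le (f := fun (q : Position P.N m) (_ : d ≤ q.1.1) => P.relSub q)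
      ⟨(d + q.1.1, q.1.2), by simp only; omega⟩ (by simp)

variable {P}

/-- The extra-condition moves the right-hand factor one step to the left; iterating reaches every
intermediate position. -/
theorem ExtraCondition.relSub_inf_le (hE : P.ExtraCondition) {m : ℕ} {q q' q'' : Position P.N m}
    (h₁ : q.1.1 ≤ q'.1.1) (h₂ : q'.1.1 ≤ q''.1.1) (h₃ : q''.1.1 - q.1.1 ≤ P.N - 1) :
    P.relSub q ⊓ P.relSub q'' ≤ P.relSub q' := by
  obtain ⟨d, hd⟩ := Nat.exists_eq_add_of_le h₂
  induction d generalizing q'' with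
  | zero =>
    obtain rfl : q'' = q' := position_ext hd
    exact inf_le_right
  | succ d ih =>
    rcases h₁.eq_or_lt with h | h
    · obtain rfl : q = q' := position_ext h
      exact inf_le_left
    have hq := q.2
    have hq'' := q''.2
    obtain ⟨n, hn⟩ := Nat.exists_eq_add_of_le (h₁.trans h₂)
    have hm : q.1.1 + (n + P.N) + q''.1.2 = m := by omega
    let q₁ : Position P.N m := ⟨(q''.1.1 - 1, q''.1.2 + 1), by simp only; omega⟩
    have key : P.relSub q ⊓ P.relSub q'' ≤ P.relSub q₁ := by
      rw [P.relSub_eq_tensorSub q hm (by omega : 0 + P.N + n = n + P.N) rfl (by omega),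
        P.relSub_eq_tensorSub q'' hm (by omega : n + P.N + 0 = n + P.N) (by omega) (by omega),
        P.relSub_eq_tensorSub q₁ hm (by omega : n - 1 + P.N + 1 = n + P.N)
          (by simp only [q₁]; omega) (by simp only [q₁]; omega), ← tensorSub_inf]
      refine tensorSub_mono hm ?_
      rw [inf_comm]
      -- Here `q` is strictly left of `q'` and `q'` strictly left of `q''`, so the distance `n` is
      -- at least `2`.
      exact hE n (by omega) (by omega)
    exact (le_inf inf_le_left key).trans
      (ih (by simp only [q₁]; omega) (by simp only [q₁]; omega) (by simp only [q₁]; omega))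

variable [LinearOrder X]

/-- Shifts `a ≥ N` give disjoint factors and need no hypothesis; for overlaps, side-confluence
provides the equal alternating products. -/
theorem IsSideConfluent.lmConfluent_tensorSub (hR : P.IsReduced) (hS : P.IsSideConfluent)
    {a : ℕ} (ha : 1 ≤ a) :
    LmConfluent (tensorSub 0 a (by omega : 0 + P.N + a = a + P.N) P.Rbar)
      (tensorSub a 0 (by omega : a + P.N + 0 = a + P.N) P.Rbar) := by
  by_cases haN : P.N ≤ a
  · exact lmConfluent_tensorSub_of_disjoint _ _ haN _ _
  · obtain ⟨k, hk, h⟩ := hS a ha (by omega)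
    have hfix : ∀ {i j m : ℕ} (h : i + P.N + j = m) (y : Word X m),
        y ∉ lmSet (tensorSub i j h P.Rbar) →
        tensorOp i j h P.operatorS (Finsupp.single y 1) = Finsupp.single y 1 := by
      intro i j m h y hy
      obtain ⟨u, t, v, rfl⟩ := exists_glue h y
      rw [glue_mem_lmSet_tensorSub, hR.mem_lmSet_Rbar] at hy
      rw [tensorOp_single_glue, operatorS_single_of_not hy, sandwich_single]
    exact lmConfluent_of_altProd_eq (hR.isTriangular.tensorOp _) (hR.isTriangular.tensorOp _)
      (tensorSub_le_ker_tensorOp _ hR.Rbar_le_ker) (tensorSub_le_ker_tensorOp _ hR.Rbar_le_ker)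
      (hfix _) (hfix _) hk h.symm

theorem IsSideConfluent.lmConfluent_relSub (hR : P.IsReduced) (hS : P.IsSideConfluent) {m : ℕ}
    (q q' : Position P.N m) : LmConfluent (P.relSub q) (P.relSub q') := by
  wlog hle : q.1.1 ≤ q'.1.1 generalizing q q'
  · exact (this q' q (by omega)).symm
  rcases hle.eq_or_lt with h | h
  · obtain rfl := position_ext h
    exact LmConfluent.of_le le_rfl
  · have hq := q.2
    have hq' := q'.2
    obtain ⟨a, ha⟩ := Nat.exists_eq_add_of_lt h
    have hm : q.1.1 + (a + 1 + P.N) + q'.1.2 = m := by omega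
    rw [P.relSub_eq_tensorSub q hm (by omega : 0 + P.N + (a + 1) = a + 1 + P.N) rfl (by omega),
      P.relSub_eq_tensorSub q' hm (by omega : a + 1 + P.N + 0 = a + 1 + P.N) (by omega) (by omega)]
    exact (hS.lmConfluent_tensorSub hR (by omega)).tensorSub hm

/-- The leading words of the ideal are the words that contain the leading word of a relation. -/
theorem IsSideConfluent.mem_lmSet_idealComp (hR : P.IsReduced) (hS : P.IsSideConfluent) {m : ℕ}
    {w : Word X m} : w ∈ lmSet (P.idealComp m) ↔ ∃ (u t : List X) (v : Word X P.N),
      w.1 = u ++ v.1 ++ t ∧ ∃ f ∈ P.R, lm f = (v : WithBot (Word X P.N)) := by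
  constructor
  · intro hw
    rw [idealComp_eq] at hw
    obtain ⟨q, hq⟩ := Set.mem_iUnion.1 (lmSet_iSup_subset (hS.lmConfluent_relSub hR) hw)
    obtain ⟨u, t, v, rfl⟩ := exists_glue q.2 w
    rw [relSub, glue_mem_lmSet_tensorSub, hR.mem_lmSet_Rbar] at hq
    exact ⟨u.1, t.1, v, rfl, hq⟩
  · rintro ⟨u, t, v, hw, hv⟩
    have hm : u.length + P.N + t.length = m := by
      rw [← w.2, hw, List.length_append, List.length_append, v.2]
    have e : w = glue hm ⟨u, rfl⟩ ⟨t, rfl⟩ v := Subtype.ext hw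
    rw [idealComp_eq]
    refine lmSet_mono (le_iSup (fun q : Position P.N m => P.relSub q)
      ⟨(u.length, t.length), hm⟩) ?_
    rw [relSub, e, glue_mem_lmSet_tensorSub]
    exact hR.mem_lmSet_Rbar.2 hv

end RelationSubspaces
/-! ### The reduction pairs of an extra-confluent presentation -/

section ReductionPairs

variable {K X : Type*} [Field K] (P : HomPresentation K X)

/-- The kernel `I(R)_{m - l_N(n)} ⊗ V^{⊗ l_N(n)}` of `F_1^{n,m}`. -/
def kerF1 (n m : ℕ) (hm : P.l n ≤ m) : Submodule K (TensorPow K X m) :=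
  tensorSub 0 (P.l n) (by omega : 0 + (m - P.l n) + P.l n = m) (P.idealComp (m - P.l n))

/-- The kernel of `F_2^{n,m}`: zero if `m < l_N(n+1)`, and `V^{⊗ m - l_N(n+1)} ⊗ J_{n+1}`
otherwise. -/
def kerF2 (n m : ℕ) : Submodule K (TensorPow K X m) :=
  if h : m < P.l (n + 1) then ⊥
  else tensorSub (m - P.l (n + 1)) 0
    (by omega : m - P.l (n + 1) + P.l (n + 1) + 0 = m) (P.J (n + 1))

theorem kerF2_eq_bot {n m : ℕ} (h : m < P.l (n + 1)) : P.kerF2 n m = ⊥ := dif_pos h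

theorem kerF2_eq_tensorSub {n d m : ℕ} (h : d + P.l (n + 1) + 0 = m) :
    P.kerF2 n m = tensorSub d 0 h (P.J (n + 1)) := by
  rw [kerF2, dif_neg (by omega)]
  obtain rfl : d = m - P.l (n + 1) := by omega
  rfl

variable [Finite X]

theorem kerF2_zero {m : ℕ} (h : P.l 1 ≤ m) : P.kerF2 0 m = ⊤ := by
  rw [P.kerF2_eq_tensorSub (n := 0) (Nat.sub_add_cancel h), J, if_pos (by omega), tensorSub_top]

theorem kerF2_succ {n m : ℕ} (h : P.l (n + 2) ≤ m) : P.kerF2 (n + 1) m =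
    ⨅ (q : Position P.N m) (_ : m - P.l (n + 2) ≤ q.1.1), P.relSub q := by
  rw [P.kerF2_eq_tensorSub (n := n + 1) (Nat.sub_add_cancel h), tensorSub_J]

theorem kerF2_succ_le_relSub {n m : ℕ} (h : P.l (n + 2) ≤ m) (q : Position P.N m)
    (hq : m - P.l (n + 2) ≤ q.1.1) : P.kerF2 (n + 1) m ≤ P.relSub q := by
  rw [P.kerF2_succ h]
  exact iInf₂_le (f := fun (q : Position P.N m) (_ : m - P.l (n + 2) ≤ q.1.1) => P.relSub q) q hq

theorem le_kerF2_succ {n m : ℕ} (h : P.l (n + 2) ≤ m) {U : Submodule K (TensorPow K X m)}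
    (hU : ∀ q : Position P.N m, m - P.l (n + 2) ≤ q.1.1 → U ≤ P.relSub q) :
    U ≤ P.kerF2 (n + 1) m := by
  rw [P.kerF2_succ h]
  exact le_iInf₂ hU

theorem kerF1_eq {n m : ℕ} (hm : P.l n ≤ m) : P.kerF1 n m hm =
    ⨆ q : {q : Position P.N m // P.l n ≤ q.1.2}, P.relSub q.1 :=
  P.tensorSub_idealComp _

theorem relSub_le_kerF1 {n m : ℕ} (hm : P.l n ≤ m) (q : Position P.N m) (hq : P.l n ≤ q.1.2) :
    P.relSub q ≤ P.kerF1 n m hm := by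
  rw [kerF1_eq]
  exact le_iSup (fun q : {q : Position P.N m // P.l n ≤ q.1.2} => P.relSub q.1) ⟨q, hq⟩

theorem kerF1_succ_le {n m : ℕ} (hm : P.l n ≤ m) (hm' : P.l (n + 1) ≤ m) :
    P.kerF1 (n + 1) m hm' ≤ P.kerF1 n m hm := by
  rw [P.kerF1_eq hm']
  exact iSup_le fun q => P.relSub_le_kerF1 hm q.1 ((P.l_le_succ n).trans q.2)

/-- Since `l_N(n+2) = l_N(n) + N`, the first of the intersected positions leaves exactly `l_N(n)`
letters on its right: it is one of the summands of the kernel of `F_1^{n,m}`. -/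
theorem kerF2_succ_le {n m : ℕ} (hm : P.l n ≤ m) :
    P.kerF2 (n + 1) m ≤ P.kerF1 n m hm ⊓ P.kerF2 n m := by
  by_cases h : m < P.l (n + 2)
  · rw [P.kerF2_eq_bot h]
    exact bot_le
  rw [not_lt] at h
  have h2 := P.l_add_two n
  have hs : P.l (n + 1) ≤ P.l (n + 2) := P.l_le_succ (n + 1)
  refine le_inf ?_ ?_
  · let q : Position P.N m := ⟨(m - P.l (n + 2), P.l n), by simp only; omega⟩
    exact (P.kerF2_succ_le_relSub h q le_rfl).trans (P.relSub_le_kerF1 hm q le_rfl)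
  · cases n with
    | zero =>
      rw [P.kerF2_zero (hs.trans h)]
      exact le_top
    | succ n =>
      refine P.le_kerF2_succ (hs.trans h) fun q hq => P.kerF2_succ_le_relSub h q ?_
      exact (Nat.sub_le_sub_left hs m).trans hq

variable {P}

/-- Of the positions required by `ker F_2^{n+1,m}`, the rightmost are already imposed by `ker
F_2^{n,m}`. The others lie between `q` and the first position imposed by `ker F_2^{n,m}`, and `q.1.2
< l_N(n+1)` says that these two are at distance at most `N - 1`, within reach of the
extra-condition. -/
theorem ExtraCondition.relSub_inf_kerF2_le (hE : P.ExtraCondition) {n m : ℕ}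
    (hm' : P.l (n + 1) ≤ m) (q : Position P.N m) (hq : P.l n ≤ q.1.2)
    (hq' : q.1.2 < P.l (n + 1)) : P.relSub q ⊓ P.kerF2 n m ≤ P.kerF2 (n + 1) m := by
  have hqm := q.2
  have h2 := P.l_add_two n
  obtain ⟨a, ha⟩ : ∃ a, P.l n = a := ⟨_, rfl⟩
  obtain ⟨b, hb⟩ : ∃ b, P.l (n + 1) = b := ⟨_, rfl⟩
  rw [ha] at h2 hq
  rw [hb] at hm' hq'
  have hle : P.l (n + 2) ≤ m := by rw [h2]; omega
  refine P.le_kerF2_succ hle fun q₁ hq₁ => ?_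
  rw [h2] at hq₁
  have hqm₁ := q₁.2
  by_cases hqq₁ : q₁.1.1 = q.1.1
  · obtain rfl := position_ext hqq₁
    exact inf_le_left
  cases n with
  -- Here `l_N(0) = 0` and `l_N(1) = 1`, so `q` is the last position and no `q₁` lies strictly to
  -- its right.
  | zero =>
    rw [P.l_zero] at ha
    rw [zero_add, P.l_one] at hb
    omega
  | succ n =>
    have h3 := P.l_add_two n
    obtain ⟨c, hc⟩ : ∃ c, P.l n = c := ⟨_, rfl⟩
    rw [hc, hb] at h3
    by_cases hq₂ : m - b ≤ q₁.1.1
    · exact inf_le_right.trans (P.kerF2_succ_le_relSub (hb.trans_le hm') q₁ (by rwa [hb]))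
    · refine (inf_le_inf_left _ (P.kerF2_succ_le_relSub (hb.trans_le hm')
        ⟨(m - b, c), by simp only; omega⟩ (by rw [hb]))).trans (hE.relSub_inf_le ?_ ?_ ?_)
      · omega
      · simp only; omega
      · simp only; omega

variable [LinearOrder X]

theorem lmConfluent_relSub_kerF2 (hR : P.IsReduced) (hS : P.IsSideConfluent) (n : ℕ) {m : ℕ}
    (q : Position P.N m) : LmConfluent (P.relSub q) (P.kerF2 n m) := by
  by_cases h : m < P.l (n + 1)
  · rw [P.kerF2_eq_bot h]
    exact (LmConfluent.of_le bot_le).symm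
  rw [not_lt] at h
  cases n with
  | zero =>
    rw [P.kerF2_zero h]
    exact LmConfluent.of_le le_top
  | succ n =>
    rw [P.kerF2_succ h]
    exact (lmConfluent_iInf (hS.lmConfluent_relSub hR) _ q).symm

theorem lmConfluent_kerF (hR : P.IsReduced) (hS : P.IsSideConfluent) (n : ℕ) {m : ℕ}
    (hm : P.l n ≤ m) : LmConfluent (P.kerF1 n m hm) (P.kerF2 n m) := by
  rw [kerF1_eq]
  exact lmConfluent_iSup (fun q q' => hS.lmConfluent_relSub hR q.1 q'.1)
    fun q => lmConfluent_relSub_kerF2 hR hS n q.1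

/-- The distributivity property from which the exactness of the Koszul complex follows. -/
theorem IsExtraConfluent.kerF1_inf_kerF2_le (hP : P.IsExtraConfluent) {n m : ℕ} (hm : P.l n ≤ m)
    (hm' : P.l (n + 1) ≤ m) :
    P.kerF1 n m hm ⊓ P.kerF2 n m ≤ P.kerF1 (n + 1) m hm' ⊔ P.kerF2 (n + 1) m := by
  have h : P.kerF1 n m hm ⊓ P.kerF2 n m ≤
      ⨆ q : {q : Position P.N m // P.l n ≤ q.1.2}, P.relSub q.1 ⊓ P.kerF2 n m := by
    rw [P.kerF1_eq hm]
    exact iSup_inf_le_of_lmConfluent (fun q q' => hP.2.1.lmConfluent_relSub hP.1 q.1 q'.1)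
      fun q => lmConfluent_relSub_kerF2 hP.1 hP.2.1 n q.1
  -- Distributivity has reduced the claim to a single position: either it leaves at least `l_N(n+1)`
  -- letters on the right and belongs to the next `F_1`, or the extra-condition applies.
  refine h.trans (iSup_le fun q => ?_)
  rcases le_or_gt (P.l (n + 1)) q.1.1.2 with hq | hq
  · exact inf_le_left.trans ((P.relSub_le_kerF1 hm' q.1 hq).trans le_sup_left)
  · exact (hP.2.2.relSub_inf_kerF2_le hm' q.1 q.2 hq).trans le_sup_right

theorem reductionPair_eq (n m : ℕ) (hm : P.l n ≤ m) :
    P.reductionPair n m hm = (thetaInv (P.kerF1 n m hm), thetaInv (P.kerF2 n m)) := by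
  refine Prod.ext rfl ?_
  change P.F2 n m = thetaInv (P.kerF2 n m)
  by_cases h : m < P.l (n + 1)
  · rw [P.kerF2_eq_bot h]
    exact (dif_pos h).trans (Subtype.ext redOp_bot.symm)
  · rw [kerF2, dif_neg h]
    exact dif_neg h

/-- The left bound of the reduction pair of bi-degree `(n, m)`. -/
def IsExtraConfluent.pairBound (hP : P.IsExtraConfluent) (n m : ℕ) (hm : P.l n ≤ m) :
    Module.End K (TensorPow K X m) :=
  leftBound (lmConfluent_kerF hP.1 hP.2.1 n hm)

theorem IsExtraConfluent.confluent (hP : P.IsExtraConfluent) (n m : ℕ) (hm : P.l n ≤ m) :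
    Confluent (P.reductionPair n m hm) := by
  rw [reductionPair_eq]
  exact confluent_thetaInv (lmConfluent_kerF hP.1 hP.2.1 n hm)

theorem IsExtraConfluent.pairLeftBound_eq (hP : P.IsExtraConfluent) (n m : ℕ) (hm : P.l n ≤ m)
    (k : ℕ) (hk : ConfluentAt (P.reductionPair n m hm) k) :
    pairLeftBound (P.reductionPair n m hm) k hk = hP.pairBound n m hm :=
  pairLeftBound_eq_leftBound _ (reductionPair_eq n m hm) k hk

/-- The prefixes of length `m - l_N(n+1)` of the words occurring in a value of the left bound of
bi-degree `(n, m)` are normal. -/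
theorem IsExtraConfluent.redOp_pairBound (hP : P.IsExtraConfluent) {n m : ℕ} (hm : P.l n ≤ m)
    (hm' : P.l (n + 1) ≤ m) (v : TensorPow K X m) :
    redOp (P.kerF1 (n + 1) m hm') (hP.pairBound n m hm v) = hP.pairBound n m hm v := by
  obtain ⟨w, hw, e⟩ := exists_leftBound_apply_eq (lmConfluent_kerF hP.1 hP.2.1 n hm) v
  -- Normality of the prefix of length `m - l_N(n)` passes to the shorter prefix of length `m -
  -- l_N(n+1)`.
  have hw' : ∀ z, w z ≠ 0 → z ∈ normalSet (P.kerF1 (n + 1) m hm') := by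
    intro z hz
    rw [mem_normalSet_iff]
    exact fun h => mem_normalSet_iff.1 (hw z hz) (lmSet_mono (P.kerF1_succ_le hm hm') h)
  refine redOp_apply_of_normal fun z hz => ?_
  rw [pairBound, e, Finsupp.sub_apply] at hz
  by_cases hwz : w z = 0
  swap
  · exact hw' z hwz
  rw [hwz, zero_sub, neg_ne_zero] at hz
  have h : m - P.l (n + 1) + P.l (n + 1) + 0 = m := by omega
  -- The remaining words come from `F_2`, which alters only the last `l_N(n+1)` letters and keeps
  -- the prefix `u`.
  obtain ⟨x, hx, hxz⟩ := exists_of_end_apply_ne_zero hz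
  obtain ⟨u, t, y, rfl⟩ := exists_glue h x
  rw [P.kerF2_eq_tensorSub h, ← sandwich_single, redOp_tensorSub_sandwich] at hxz
  obtain ⟨y', rfl, _⟩ := exists_of_sandwich_apply_ne_zero hxz
  have hx' := hw' _ hx
  have hglue : ∀ y : Word X (P.l (n + 1)), glue h u t y =
      glue (by omega : 0 + (m - P.l (n + 1)) + P.l (n + 1) = m) t y u := by
    intro y
    obtain ⟨t, ht⟩ := t
    obtain rfl := List.length_eq_zero_iff.1 ht
    exact Subtype.ext (by simp [glue])
  rw [hglue, mem_normalSet_iff, kerF1, glue_mem_lmSet_tensorSub] at hx' ⊢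
  exact hx'

/-- The reduction relations: on `V^{⊗ m - l_N(n+1)} ⊗ J_{n+1}`, the left bound of bi-degree `(n, m)`
is the infimum of the reduction pair of bi-degree `(n + 1, m)`. -/
theorem IsExtraConfluent.redOp_sup_eq_pairBound (hP : P.IsExtraConfluent) {n m : ℕ}
    (hm : P.l n ≤ m) (hm' : P.l (n + 1) ≤ m) {v : TensorPow K X m} (hv : v ∈ P.kerF2 n m) :
    redOp (P.kerF1 (n + 1) m hm' ⊔ P.kerF2 (n + 1) m) v = hP.pairBound n m hm v := by
  have hc := lmConfluent_kerF hP.1 hP.2.1 n hm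
  rw [redOp_apply_eq_iff]
  refine ⟨hP.kerF1_inf_kerF2_le hm hm' (sub_leftBound_apply_mem hc hv), fun z hz => ?_⟩
  rw [mem_normalSet_iff]
  intro hcon
  -- Confluence in bi-degree `(n + 1, m)` leaves two cases: normal prefixes exclude the first, and
  -- the second would give a leading word of `ker F_1^{n,m} ∩ ker F_2^{n,m}`.
  rcases lmConfluent_kerF hP.1 hP.2.1 (n + 1) hm' hcon with h | h
  · rw [← hP.redOp_pairBound hm hm'] at hz
    exact mem_normalSet_iff.1 (mem_normalSet_of_redOp_apply hz) h
  · exact leftBound_apply_ne_zero hc hz (lmSet_mono (P.kerF2_succ_le hm) h)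

/-- The identity behind the contracting homotopy. -/
theorem IsExtraConfluent.redOp_pairBound_add (hP : P.IsExtraConfluent) {n m : ℕ}
    (hm : P.l n ≤ m) (hm' : P.l (n + 1) ≤ m) {v : TensorPow K X m} (hv : v ∈ P.kerF2 n m) :
    redOp (P.kerF1 (n + 1) m hm') (hP.pairBound (n + 1) m hm' v + hP.pairBound n m hm v) =
      redOp (P.kerF1 (n + 1) m hm') v := by
  have h1 := LinearMap.congr_fun
    (redOp_mul_leftBound (lmConfluent_kerF hP.1 hP.2.1 (n + 1) hm')) v
  rw [Module.End.mul_apply, LinearMap.sub_apply, hP.redOp_sup_eq_pairBound hm hm' hv] at h1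
  rw [map_add, hP.redOp_pairBound hm hm', pairBound, h1, sub_add_cancel]

theorem IsExtraConfluent.pairBound_apply_mem (hP : P.IsExtraConfluent) {n m : ℕ}
    (hm : P.l n ≤ m) (v : TensorPow K X m) : hP.pairBound n m hm v ∈ P.kerF2 n m :=
  leftBound_apply_mem _ v

theorem IsExtraConfluent.pairBound_redOp (hP : P.IsExtraConfluent) {n m : ℕ}
    (hm : P.l n ≤ m) (v : TensorPow K X m) :
    hP.pairBound n m hm (redOp (P.kerF1 n m hm) v) = hP.pairBound n m hm v :=
  LinearMap.congr_fun (leftBound_mul_redOp _) v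

/-- The identity behind the contracting homotopy in degree zero. -/
theorem IsExtraConfluent.redOp_pairBound_zero (hP : P.IsExtraConfluent) {m : ℕ} (hm : P.l 0 ≤ m)
    (hm' : P.l 1 ≤ m) (v : TensorPow K X m) :
    redOp (P.kerF1 0 m hm) (hP.pairBound 0 m hm v) = redOp (P.kerF1 0 m hm) v := by
  have h1 := LinearMap.congr_fun
    (redOp_mul_leftBound (lmConfluent_kerF hP.1 hP.2.1 0 hm)) v
  -- `J_1 = V` makes the second kernel the whole space.
  have h2 : redOp (P.kerF1 0 m hm ⊔ P.kerF2 0 m) v = 0 := by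
    rw [redOp_apply_eq_zero_iff, P.kerF2_zero hm', sup_top_eq]
    trivial
  rw [Module.End.mul_apply, LinearMap.sub_apply, h2, sub_zero] at h1
  exact h1

end ReductionPairs
/-! ### Normal forms and the projection onto the algebra -/

section NormalFormOperator

variable {K X : Type*} [Field K]

theorem tensorAlg_induction {p : TensorAlg K X → Prop} (f : TensorAlg K X) (zero : p 0)
    (add : ∀ f g, p f → p g → p (f + g)) (incl : ∀ m (f : TensorPow K X m), p (incl m f)) : p f := by
  induction f using Finsupp.induction_linear with
  | zero => exact zero
  | add f g hf hg => exact add f g hf hg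
  | single w c =>
    have := incl w.length (Finsupp.single ⟨w, rfl⟩ c)
    rwa [incl_single] at this

theorem incl_sandwich {i p j m : ℕ} (h : i + p + j = m) (u : Word X i) (t : Word X j)
    (f : TensorPow K X p) : incl m (sandwich h u t f) =
      Finsupp.mapDomain (fun v : Word X p => u.1 ++ v.1 ++ t.1) f := by
  rw [incl, sandwich, Finsupp.lmapDomain_apply, Finsupp.lmapDomain_apply,
    ← Finsupp.mapDomain_comp]
  rfl

theorem toFree_single (w : List X) (c : K) :
    toFree (Finsupp.single w c) = c • (w.map (FreeAlgebra.ι K)).prod := by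
  simp [toFree]

theorem toFree_incl_sandwich {i p j m : ℕ} (h : i + p + j = m) (u : Word X i) (t : Word X j)
    (f : TensorPow K X p) : toFree (incl m (sandwich h u t f)) =
      (u.1.map (FreeAlgebra.ι K)).prod * toFree (incl p f) * (t.1.map (FreeAlgebra.ι K)).prod := by
  induction f using Finsupp.induction_linear with
  | zero => simp
  | add f g hf hg => simp only [map_add, hf, hg, mul_add, add_mul]
  | single v c =>
    rw [sandwich_single, incl_single, incl_single, toFree_single, toFree_single]
    simp [glue, mul_assoc]

theorem toFree_surjective : Function.Surjective (toFree (K := K) (X := X)) := by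
  have key : ∀ (a : FreeAlgebra K X) (f : TensorAlg K X), ∃ g, toFree g = a * toFree f := by
    intro a
    induction a using FreeAlgebra.induction with
    | grade0 r => exact fun f => ⟨r • f, by rw [map_smul, Algebra.smul_def]⟩
    | grade1 x =>
      refine fun f => ⟨Finsupp.mapDomain (x :: ·) f, ?_⟩
      induction f using Finsupp.induction_linear with
      | zero => simp
      | add f g hf hg => rw [Finsupp.mapDomain_add, map_add, hf, hg, map_add, mul_add]
      | single w c => simp [Finsupp.mapDomain_single, toFree_single]
    | mul a b ha hb =>
      intro f
      obtain ⟨g, hg⟩ := hb f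
      obtain ⟨g', hg'⟩ := ha g
      exact ⟨g', by rw [hg', hg, mul_assoc]⟩
    | add a b ha hb =>
      intro f
      obtain ⟨g, hg⟩ := ha f
      obtain ⟨g', hg'⟩ := hb f
      exact ⟨g + g', by rw [map_add, hg, hg', add_mul]⟩
  intro a
  obtain ⟨g, hg⟩ := key a (Finsupp.single [] 1)
  exact ⟨g, by simpa [toFree_single] using hg⟩

section Bar

variable {P : HomPresentation K X} {A : Type*} [Ring A] [Algebra K A] (ψ : A ≃ₐ[K] P.Alg)

theorem bar_surjective : Function.Surjective (bar ψ) := by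
  intro a
  obtain ⟨b, hb⟩ := RingQuot.mkAlgHom_surjective K _ (ψ a)
  obtain ⟨f, rfl⟩ := toFree_surjective b
  exact ⟨f, by simp [bar, hb]⟩

theorem bar_incl_sandwich {i p j m : ℕ} (h : i + p + j = m) (u : Word X i) (t : Word X j)
    (f : TensorPow K X p) : bar ψ (incl m (sandwich h u t f)) =
      bar ψ (Finsupp.single u.1 1) * bar ψ (incl p f) * bar ψ (Finsupp.single t.1 1) := by
  simp only [bar, LinearMap.comp_apply, AlgHom.toLinearMap_apply, AlgEquiv.toLinearMap_apply]
  rw [toFree_incl_sandwich, toFree_single, toFree_single, one_smul, one_smul]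
  simp only [map_mul]

theorem bar_single_append (u v : List X) : bar ψ (Finsupp.single (u ++ v) 1) =
    bar ψ (Finsupp.single u 1) * bar ψ (Finsupp.single v 1) := by
  simp only [bar, LinearMap.comp_apply, AlgHom.toLinearMap_apply, AlgEquiv.toLinearMap_apply]
  rw [toFree_single, toFree_single, toFree_single, one_smul, one_smul, one_smul, List.map_append,
    List.prod_append]
  simp only [map_mul]

theorem bar_single_nil : bar ψ (Finsupp.single [] 1) = 1 := by
  simp [bar, toFree_single]

theorem bar_incl_of_mem_idealComp {m : ℕ} {f : TensorPow K X m} (hf : f ∈ P.idealComp m) :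
    bar ψ (incl m f) = 0 := by
  suffices H : P.idealComp m ≤ LinearMap.ker (bar ψ ∘ₗ incl m) from H hf
  rw [idealComp_eq]
  refine iSup_le fun q => iSup₂_le fun u t => ?_
  rw [Submodule.map_le_iff_le_comap, Rbar, Submodule.span_le]
  intro g hg
  change bar ψ (incl m (sandwich q.2 u t g)) = 0
  have h0 : bar ψ (incl P.N g) = 0 := by
    have : RingQuot.mkAlgHom K (fun a b : FreeAlgebra K X =>
        (∃ f ∈ P.R, a = toFree (incl P.N f)) ∧ b = 0) (toFree (incl P.N g)) = 0 := by
      rw [RingQuot.mkAlgHom_rel K ⟨⟨g, hg, rfl⟩, rfl⟩, map_zero]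
    simp only [bar, LinearMap.comp_apply, AlgHom.toLinearMap_apply, AlgEquiv.toLinearMap_apply]
    rw [this, map_zero]
  rw [bar_incl_sandwich, h0, mul_zero, zero_mul]

end Bar

variable (P : HomPresentation K X)

theorem sandwich_relation_mem_idealComp {i j m : ℕ} (h : i + P.N + j = m) (u : Word X i)
    (t : Word X j) {f : TensorPow K X P.N} (hf : f ∈ P.R) : sandwich h u t f ∈ P.idealComp m := by
  rw [idealComp_eq]
  exact (le_iSup (fun q : Position P.N m => P.relSub q) ⟨(i, j), h⟩)
    (sandwich_mem_tensorSub h u t (Submodule.subset_span hf))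

theorem idealComp_zero : P.idealComp 0 = ⊥ := by
  rw [idealComp_eq]
  refine iSup_eq_bot.2 fun q => ?_
  have h1 := q.2
  have h2 := P.two_le
  omega

variable [Finite X]

theorem sandwich_mem_idealComp {i p j m : ℕ} (h : i + p + j = m) (u : Word X i) (t : Word X j)
    {f : TensorPow K X p} (hf : f ∈ P.idealComp p) : sandwich h u t f ∈ P.idealComp m := by
  suffices H : tensorSub i j h (P.idealComp p) ≤ P.idealComp m from
    H (sandwich_mem_tensorSub h u t hf)
  rw [idealComp_eq, idealComp_eq, tensorSub_iSup]
  refine iSup_le fun q => ?_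
  have hq := q.2
  rw [relSub, ← P.relSub_eq_tensorSub ⟨(i + q.1.1, q.1.2 + j), by simp only; omega⟩ h q.2 rfl rfl]
  exact le_iSup (fun q : Position P.N m => P.relSub q) _

/-! ### The normal form operator and its factorisation through the algebra. -/

variable [LinearOrder X]

/-- The operator of `T(V)` that is `θ⁻¹(I(R)_m)` on `V^{⊗ m}`. -/
def nf : TensorAlg K X →ₗ[K] TensorAlg K X :=
  Finsupp.linearCombination K fun w : List X =>
    incl w.length (redOp (P.idealComp w.length) (Finsupp.single ⟨w, rfl⟩ 1))

theorem nf_incl {m : ℕ} (f : TensorPow K X m) :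
    P.nf (incl m f) = incl m (redOp (P.idealComp m) f) := by
  induction f using Finsupp.induction_linear with
  | zero => simp
  | add f g hf hg => simp only [map_add, hf, hg]
  | single w c =>
    obtain ⟨w, rfl⟩ := w
    rw [incl_single, nf, Finsupp.linearCombination_single, ← map_smul, ← map_smul,
      Finsupp.smul_single, smul_eq_mul, mul_one]

theorem nf_incl_of_mem {m : ℕ} {f : TensorPow K X m} (hf : f ∈ P.idealComp m) :
    P.nf (incl m f) = 0 := by
  rw [nf_incl, redOp_apply_eq_zero_iff.2 hf, map_zero]

theorem nf_mapDomain_cons_nf (x : X) (g : TensorAlg K X) :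
    P.nf (Finsupp.mapDomain (x :: ·) (P.nf g)) = P.nf (Finsupp.mapDomain (x :: ·) g) := by
  induction g using tensorAlg_induction with
  | zero => simp
  | add f g hf hg => simp only [map_add, Finsupp.mapDomain_add, hf, hg]
  | incl m f =>
    have e : ∀ f : TensorPow K X m, Finsupp.mapDomain (x :: ·) (incl m f) =
        incl (1 + m + 0) (sandwich rfl ⟨[x], rfl⟩ ⟨[], rfl⟩ f) := by
      intro f
      rw [incl_sandwich, incl, Finsupp.lmapDomain_apply, ← Finsupp.mapDomain_comp]
      congr 1
      funext v
      simp
    rw [nf_incl, e, e, eq_comm, ← sub_eq_zero, ← map_sub, ← map_sub, ← map_sub]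
    exact P.nf_incl_of_mem (P.sandwich_mem_idealComp _ _ _ (sub_redOp_mem _ f))

/-- The action of the free algebra on `T(V)`, in which a letter `x` maps `g` to the normal form of
`x g`. -/
def freeAction : FreeAlgebra K X →ₐ[K] Module.End K (TensorAlg K X) :=
  FreeAlgebra.lift K fun x => P.nf ∘ₗ Finsupp.lmapDomain K K (x :: ·)

theorem freeAction_cons (x : X) (w : List X) (g : TensorAlg K X) :
    P.freeAction ((x :: w).map (FreeAlgebra.ι K)).prod g =
      P.nf (Finsupp.mapDomain ((x :: w) ++ ·) g) := by
  have hx : ∀ (x : X) (g : TensorAlg K X), P.freeAction (FreeAlgebra.ι K x) g =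
      P.nf (Finsupp.mapDomain (x :: ·) g) := by
    intro x g
    simp [freeAction, Finsupp.lmapDomain_apply]
  induction w generalizing x with
  | nil => simp [hx]
  | cons y w ih =>
    rw [List.map_cons, List.prod_cons, map_mul, Module.End.mul_apply, ih, hx, nf_mapDomain_cons_nf,
      ← Finsupp.mapDomain_comp]
    rfl

/-- On a word `t`, a relation `f` acts as the normal form of `f t`, an element of the ideal. Thus
the action descends to the quotient, and applying it to the empty word yields `A → T(V)`. -/
theorem freeAction_relation {f : TensorPow K X P.N} (hf : f ∈ P.R) :
    P.freeAction (toFree (incl P.N f)) = 0 := by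
  have key : ∀ (t : List X) (f : TensorPow K X P.N),
      P.freeAction (toFree (incl P.N f)) (Finsupp.single t 1) =
        P.nf (incl (0 + P.N + t.length) (sandwich rfl ⟨[], rfl⟩ ⟨t, rfl⟩ f)) := by
    intro t f
    induction f using Finsupp.induction_linear with
    | zero => simp
    | add f g hf hg => simp only [map_add, LinearMap.add_apply, hf, hg]
    | single w c =>
      rw [sandwich_single, incl_single, incl_single, toFree_single, map_smul, LinearMap.smul_apply]
      obtain ⟨w, hw⟩ := w
      cases w with
      -- The empty word acts as the identity rather than through `nf`; it does not occur in `f`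
      -- since `N ≥ 2`.
      | nil =>
        have := P.two_le
        simp only [List.length_nil] at hw
        omega
      | cons x w =>
        rw [freeAction_cons, ← map_smul, Finsupp.mapDomain_single, Finsupp.smul_single, smul_eq_mul,
          mul_one]
        rfl
  refine Finsupp.lhom_ext' fun t => LinearMap.ext_ring ?_
  simp only [LinearMap.comp_apply, Finsupp.lsingle_apply, LinearMap.zero_apply]
  rw [key]
  exact P.nf_incl_of_mem (P.sandwich_relation_mem_idealComp _ _ _ hf)

variable {P} {A : Type*} [Ring A] [Algebra K A] (ψ : A ≃ₐ[K] P.Alg)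

/-- The linear map `A → T(V)` that sends the class of `f` to `nf f`. -/
def normalFormMap : A →ₗ[K] TensorAlg K X :=
  LinearMap.applyₗ (Finsupp.single [] 1) ∘ₗ
    (RingQuot.liftAlgHom K (s := fun a b : FreeAlgebra K X =>
      (∃ f ∈ P.R, a = toFree (incl P.N f)) ∧ b = 0) ⟨P.freeAction, by
        rintro a b ⟨⟨f, hf, rfl⟩, rfl⟩
        rw [P.freeAction_relation hf, map_zero]⟩).toLinearMap ∘ₗ ψ.toLinearMap

theorem normalFormMap_bar (f : TensorAlg K X) : normalFormMap ψ (bar ψ f) = P.nf f := by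
  have h1 : normalFormMap ψ (bar ψ f) = P.freeAction (toFree f) (Finsupp.single [] 1) := by
    simp [normalFormMap, bar]
  rw [h1]
  induction f using Finsupp.induction_linear with
  | zero => simp
  | add f g hf hg =>
    rw [map_add, map_add, LinearMap.add_apply, map_add]
    rw [hf (by simp [normalFormMap, bar]), hg (by simp [normalFormMap, bar])]
  | single w c =>
    rw [toFree_single, map_smul, LinearMap.smul_apply]
    cases w with
    | nil =>
      have : Finsupp.single ([] : List X) c =
          incl 0 (Finsupp.single (⟨[], rfl⟩ : Word X 0) c) := by rw [incl_single]
      -- In degree `0` the ideal vanishes, so the empty word is its own normal form.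
      rw [this, nf_incl, idealComp_zero, redOp_bot, Module.End.one_apply, ← this]
      simp
    | cons x w =>
      rw [freeAction_cons, ← map_smul, Finsupp.mapDomain_single, Finsupp.smul_single]
      simp

theorem nf_reduction {r : TensorAlg K X →ₗ[K] TensorAlg K X} (hR : P.IsReduced)
    (hr : IsReduction P.R r) (g : TensorAlg K X) : P.nf (r g) = P.nf g := by
  obtain ⟨u, t, f, hf, rfl⟩ := hr
  obtain ⟨w, hw⟩ := hR.exists_lm hf
  have h0 : P.nf (Finsupp.mapDomain (fun v : Word X P.N => u ++ v.1 ++ t) f) = 0 := by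
    have := incl_sandwich (K := K) (rfl : u.length + P.N + t.length = _) ⟨u, rfl⟩ ⟨t, rfl⟩ f
    rw [← this]
    exact P.nf_incl_of_mem (P.sandwich_relation_mem_idealComp _ _ _ hf)
  rw [reduction_apply u t hw, map_sub, map_smul, h0, smul_zero, sub_zero]

theorem nf_of_isNormalForm (hR : P.IsReduced) (hS : P.IsSideConfluent) {g : TensorAlg K X}
    (hg : IsNormalForm P.R g) : P.nf g = g := by
  refine end_apply_eq_self fun w hw => ?_
  rw [show Finsupp.single w (1 : K) = incl w.length (Finsupp.single ⟨w, rfl⟩ 1) by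
    rw [incl_single], nf_incl, redOp_single_of_mem_normalSet]
  rw [mem_normalSet_iff, hS.mem_lmSet_idealComp hR]
  rintro ⟨u, t, v, e, f, hf, hv⟩
  exact hw ((congrArg g e).trans (hR.isNormalForm_iff.1 hg u t f hf v hv))

/-- Every element of `T(V)` has a normal form. -/
theorem exists_isNormalFormOf (hR : P.IsReduced) (g : TensorAlg K X) :
    ∃ g', IsNormalFormOf P.R g g' := by
  classical
  -- `s` contains the reducible words of `g` and is closed under passing to smaller words
  suffices H : ∀ (s : Finset (List X)),
      (∀ w ∈ s, ∀ z : List X, z.length = w.length → z < w → z ∈ s) → ∀ g : TensorAlg K X,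
      (∀ w ∈ g.support, w ∈ s ∨ ∀ (u t : List X), ∀ f ∈ P.R, ∀ v : Word X P.N,
        lm f = (v : WithBot (Word X P.N)) → w ≠ u ++ v.1 ++ t) →
      ∃ g', IsNormalFormOf P.R g g' by
    -- The lexicographic order on all words need not be well founded; bounding the length confines
    -- the induction to a finite set.
    have hfin := List.finite_length_le X (g.support.sup List.length)
    refine H hfin.toFinset ?_ g ?_
    · intro w hw z hz _
      simp only [Set.Finite.mem_toFinset, Set.mem_ofPred_eq] at hw ⊢
      omega
    · intro w hw
      left
      simp only [Set.Finite.mem_toFinset, Set.mem_ofPred_eq]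
      exact Finset.le_sup (f := List.length) hw
  intro s
  induction s using Finset.induction_on_max with
  | empty =>
    intro _ g hg
    refine ⟨g, hR.isNormalForm_iff.2 fun u t f hf v hv => ?_, .refl⟩
    by_contra hne
    exact (hg _ (by simpa using hne)).elim (by simp) fun h => h u t f hf v hv rfl
  | insert a s hs ih =>
    intro hlow g hg
    have has : a ∉ s := fun h => lt_irrefl _ (hs a h)
    have hlow' : ∀ w ∈ s, ∀ z : List X, z.length = w.length → z < w → z ∈ s := by
      intro w hw z hz hzw
      rcases Finset.mem_insert.1 (hlow w (Finset.mem_insert_of_mem hw) z hz hzw) with rfl | h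
      · exact absurd (hs w hw) hzw.asymm
      · exact h
    by_cases hred : g a ≠ 0 ∧ ∃ (u t : List X), ∃ f ∈ P.R, ∃ v : Word X P.N,
        lm f = (v : WithBot (Word X P.N)) ∧ a = u ++ v.1 ++ t
    -- One reduction erases `a`, the coefficient of `lm(f)` in `f` being `1`, and introduces only
    -- smaller words of the same length, which lie in `s`.
    · obtain ⟨_, u, t, f, hf, v, hv, rfl⟩ := hred
      obtain ⟨v', hv', hfv, _⟩ := hR f hf
      obtain rfl : v' = v := by rw [hv, WithBot.coe_inj] at hv'; exact hv'.symm
      obtain ⟨g', hg', hpath⟩ := ih hlow' (reduction u f t g) (by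
        intro w hw
        rw [Finsupp.mem_support_iff, reduction_apply u t hv, Finsupp.sub_apply,
          Finsupp.smul_apply, smul_eq_mul] at hw
        by_cases hwm : Finsupp.mapDomain (fun v : Word X P.N => u ++ v.1 ++ t) f w = 0
        · rw [hwm, mul_zero, sub_zero] at hw
          refine (hg w (by simpa using hw)).imp_left fun h => ?_
          refine (Finset.mem_insert.1 h).resolve_left ?_
          rintro rfl
          rw [Finsupp.mapDomain_apply (append_append_injective u t), hfv] at hwm
          exact one_ne_zero hwm
        · left
          have hwr : w ∈ Set.range fun v : Word X P.N => u ++ v.1 ++ t := by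
            by_contra hwr
            exact hwm (Finsupp.mapDomain_of_notMem_range f w hwr)
          obtain ⟨z, rfl⟩ := hwr
          simp only at hw hwm ⊢
          rw [Finsupp.mapDomain_apply (append_append_injective u t)] at hw hwm
          have hzv : z ≠ v' := by
            rintro rfl
            rw [hfv, mul_one, sub_self] at hw
            exact hw rfl
          have hlt : z < v' := lt_of_le_of_ne ((lm_eq_iff.1 hv).2 z hwm) hzv
          refine (Finset.mem_insert.1 (hlow _ (Finset.mem_insert_self _ _) _ ?_ ?_)).resolve_left ?_
          · simp [z.2, v'.2]
          · rw [List.append_assoc, List.append_assoc, append_lt_append_left_iff]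
            exact append_lt_append_of_lt (z.2.trans v'.2.symm) hlt _ _
          · exact fun e => hzv (append_append_injective u t e))
      exact ⟨g', hg', .head ⟨_, ⟨u, t, f, hf, rfl⟩, rfl⟩ hpath⟩
    · refine ih hlow' g fun w hw => ?_
      rcases hg w hw with h | h
      · rcases Finset.mem_insert.1 h with rfl | h
        · right
          intro u t f hf v hv e
          exact hred ⟨by simpa using hw, u, t, f, hf, v, hv, e⟩
        · exact Or.inl h
      · exact Or.inr h

theorem isNormalFormMap_normalFormMap (hR : P.IsReduced) (hS : P.IsSideConfluent) :
    IsNormalFormMap ψ (normalFormMap ψ) := by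
  -- `nf` is invariant under reductions and fixes normal forms, so it computes any normal form;
  -- existence of one gives the converse.
  have key : ∀ f g, IsNormalFormOf P.R f g → g = P.nf f := by
    rintro f g ⟨hg, hpath⟩
    have : P.nf g = P.nf f := by
      clear hg
      induction hpath with
      | refl => rfl
      | tail _ h ih =>
        obtain ⟨r, hr, rfl⟩ := h
        rw [nf_reduction hR hr, ih]
    rw [← this, nf_of_isNormalForm hR hS hg]
  intro f g
  rw [normalFormMap_bar]
  refine ⟨key f g, ?_⟩
  rintro rfl
  obtain ⟨g, hg⟩ := exists_isNormalFormOf hR f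
  rwa [← key f g hg]

end NormalFormOperator
/-! ### The Koszul complex in terms of words -/

section Splitting

variable {K X : Type*} [Field K] {P : HomPresentation K X} {A : Type*} [Ring A] [Algebra K A]
  (ψ : A ≃ₐ[K] P.Alg)

/-- The map `T(V) → A ⊗ V^{⊗ p}` that sends a word `w = w₁ w₂` with `w₂` of length `p` to
`w̄₁ ⊗ w₂`, and the words of length `< p` to `0`. -/
def split (p : ℕ) : TensorAlg K X →ₗ[K] A ⊗[K] TensorPow K X p :=
  Finsupp.linearCombination K fun w : List X =>
    if h : p ≤ w.length then
      splitBar ψ (Nat.sub_add_cancel h) (Finsupp.single ⟨w, rfl⟩ 1) else 0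

theorem split_incl {d p m : ℕ} (h : d + p = m) (f : TensorPow K X m) :
    split ψ p (incl m f) = splitBar ψ h f := by
  induction f using Finsupp.induction_linear with
  | zero => simp
  | add f g hf hg => simp only [map_add, hf, hg]
  | single w c =>
    obtain ⟨w, rfl⟩ := w
    have hp : p ≤ w.length := by omega
    obtain rfl : d = w.length - p := by omega
    rw [incl_single, split, Finsupp.linearCombination_single, dif_pos hp, ← map_smul,
      Finsupp.smul_single, smul_eq_mul, mul_one]

theorem splitBar_sandwich_left {d p m : ℕ} (h : d + p = m) (u : Word X d) (t : Word X 0)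
    (f : TensorPow K X p) : splitBar ψ h (sandwich (by omega : d + p + 0 = m) u t f) =
      bar ψ (Finsupp.single u.1 1) ⊗ₜ[K] f := by
  obtain ⟨t, ht⟩ := t
  obtain rfl := List.length_eq_zero_iff.1 ht
  obtain ⟨u, rfl⟩ := u
  induction f using Finsupp.induction_linear with
  | zero => simp
  | add f g hf hg => simp only [map_add, hf, hg, TensorProduct.tmul_add]
  | single v c =>
    rw [sandwich_single, splitBar, Finsupp.linearCombination_single]
    simp [glue, ← TensorProduct.tmul_smul]

theorem splitBar_sandwich_right {d p m : ℕ} (h : d + p = m) (t : Word X 0) (v : Word X p)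
    (f : TensorPow K X d) : splitBar ψ h (sandwich (by omega : 0 + d + p = m) t v f) =
      bar ψ (incl d f) ⊗ₜ[K] Finsupp.single v 1 := by
  obtain ⟨t, ht⟩ := t
  obtain rfl := List.length_eq_zero_iff.1 ht
  induction f using Finsupp.induction_linear with
  | zero => simp
  | add f g hf hg => simp only [map_add, hf, hg, TensorProduct.add_tmul]
  | single u c =>
    obtain ⟨u, rfl⟩ := u
    rw [sandwich_single, splitBar, Finsupp.linearCombination_single, incl_single]
    have e : Finsupp.single u c = c • Finsupp.single u (1 : K) := by simp
    rw [e, map_smul, TensorProduct.smul_tmul']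
    simp [glue]

/-- Both sides come from the same `f`, cut at two places: the differential only moves letters from
the right factor into `A`. This reduces statements on the complex to statements on words. -/
theorem koszulF_split {n m : ℕ} (h : P.l (n + 1) ≤ m) (f : TensorPow K X m) :
    koszulF ψ n (split ψ (P.l (n + 1)) (incl m f)) = split ψ (P.l n) (incl m f) := by
  have hs := P.l_le_succ n
  have h₁ : m - P.l (n + 1) + P.l (n + 1) = m := by omega
  have h₂ : m - P.l n + P.l n = m := by omega
  rw [split_incl ψ h₁, split_incl ψ h₂]
  induction f using Finsupp.induction_linear with
  | zero => simp
  | add f g hf hg => simp only [map_add, hf, hg]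
  | single w c =>
    have h₃ : m - P.l (n + 1) + P.l (n + 1) + 0 = m := h₁
    have h₄ : P.l (n + 1) - P.l n + P.l n + 0 = P.l (n + 1) := sub_add_lN n
    obtain ⟨u, t, v, rfl⟩ := exists_glue h₃ w
    rw [← sandwich_single, splitBar_sandwich_left, koszulF_tmul]
    obtain ⟨u', t', v', rfl⟩ := exists_glue h₄ v
    have e : sandwich (K := K) h₃ u t (Finsupp.single (glue h₄ u' t' v') c) = sandwich (by omega : m - P.l n + P.l n + 0 = m)
          ⟨u.1 ++ u'.1, by rw [List.length_append, u.2, u'.2]; omega⟩ t (Finsupp.single v' c) := by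
      rw [sandwich_single, sandwich_single]
      congr 1
      have := List.length_eq_zero_iff.1 t'.2
      exact Subtype.ext (by simp [glue, this])
    rw [e, splitBar_sandwich_left, ← sandwich_single, splitBar_sandwich_left, bar_single_append,
      TensorProduct.smul_tmul', smul_eq_mul]

theorem split_mem_koszul {n d m : ℕ} (h : d + P.l n + 0 = m) {f : TensorPow K X m}
    (hf : f ∈ tensorSub d 0 h (P.J n)) : split ψ (P.l n) (incl m f) ∈ koszul ψ n := by
  have h' : d + P.l n = m := h
  rw [split_incl ψ h']
  suffices H : tensorSub d 0 h (P.J n) ≤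
      ((koszul ψ n).restrictScalars K).comap (splitBar ψ h') from H hf
  refine iSup₂_le fun u t => ?_
  rintro _ ⟨g, hg, rfl⟩
  change splitBar ψ h' (sandwich h u t g) ∈ koszul ψ n
  rw [splitBar_sandwich_left]
  exact Submodule.tmul_mem_baseChange_of_mem _ hg

/-- The elements `w̄ ⊗ f` with `f ∈ J_n` span `A ⊗ J_n`. -/
theorem koszul_hom_ext {n : ℕ} {M : Type*} [AddCommMonoid M] [Module K M]
    {F G : koszul ψ n →ₗ[K] M}
    (h : ∀ (x : koszul ψ n) (d m : ℕ) (hm : d + P.l n + 0 = m) (f : TensorPow K X m),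
      f ∈ tensorSub d 0 hm (P.J n) → x.1 = split ψ (P.l n) (incl m f) → F x = G x) : F = G := by
  let T : A ⊗[K] P.J n →ₗ[K] koszul ψ n := (Submodule.toBaseChange A (P.J n)).restrictScalars K
  have hT : Function.Surjective T := Submodule.toBaseChange_surjective A (P.J n)
  suffices H : F ∘ₗ T = G ∘ₗ T by
    refine LinearMap.ext fun x => ?_
    obtain ⟨y, rfl⟩ := hT x
    exact LinearMap.congr_fun H y
  refine TensorProduct.ext' fun a j => ?_
  obtain ⟨f, rfl⟩ := bar_surjective ψ a
  induction f using Finsupp.induction_linear with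
  | zero => rw [map_zero, TensorProduct.zero_tmul, map_zero, map_zero]
  | add f g hf hg => rw [map_add, TensorProduct.add_tmul, map_add, map_add, hf, hg]
  | single w c =>
    have hc : Finsupp.single w c = c • Finsupp.single w (1 : K) := by simp
    rw [hc, map_smul, ← TensorProduct.smul_tmul', map_smul, map_smul]
    congr 1
    refine h _ w.length _ rfl (sandwich rfl ⟨w, rfl⟩ ⟨[], rfl⟩ j.1)
      (sandwich_mem_tensorSub _ _ _ j.2) ?_
    rw [split_incl ψ (show w.length + P.l n = w.length + P.l n + 0 from rfl),
      splitBar_sandwich_left]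
    rfl

theorem concat_incl_tmul_single {d p m : ℕ} (h : 0 + d + p = m) (t : Word X 0)
    (f : TensorPow K X d) (v : Word X p) :
    concat p (incl d f ⊗ₜ[K] Finsupp.single v 1) = incl m (sandwich h t v f) := by
  obtain ⟨t, ht⟩ := t
  obtain rfl := List.length_eq_zero_iff.1 ht
  induction f using Finsupp.induction_linear with
  | zero => simp
  | add f g hf hg => simp only [map_add, TensorProduct.add_tmul, hf, hg]
  | single u c =>
    rw [sandwich_single, incl_single, incl_single]
    simp [concat, glue, Finsupp.lmapDomain_apply, Finsupp.mapDomain_single]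

theorem koszulAug_eq_zero {m : ℕ} (hm : 1 ≤ m) {f : TensorPow K X m} {x : koszul ψ 0}
    (hx : x.1 = split ψ (P.l 0) (incl m f)) : koszulAug ψ x = 0 := by
  have h0 := P.l_zero
  have h : m + P.l 0 = m := by omega
  have h' : 0 + m + P.l 0 = m := by omega
  change TensorProduct.lift (((LinearMap.mul K K).compl₂ (Finsupp.lapply emptyWord)) ∘ₗ
      P.augAlg.toLinearMap ∘ₗ ψ.toLinearMap) x.1 = 0
  rw [hx, split_incl ψ h]
  clear hx
  induction f using Finsupp.induction_linear with
  | zero => simp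
  | add f g hf hg => simp only [map_add, hf, hg, add_zero]
  | single w c =>
    obtain ⟨t, v, u, rfl⟩ := exists_glue h' w
    rw [← sandwich_single, splitBar_sandwich_right, TensorProduct.lift.tmul]
    have : P.augAlg (ψ (bar ψ (incl m (Finsupp.single u c)))) = 0 := by
      have h1 := aug_toFree_incl m hm (Finsupp.single u c)
      simp only [bar, LinearMap.comp_apply, AlgHom.toLinearMap_apply, AlgEquiv.toLinearMap_apply,
        AlgEquiv.apply_symm_apply, augAlg, RingQuot.liftAlgHom_mkAlgHom_apply]
      exact h1
    simp [this]

theorem koszulAug_koszulUnit : koszulAug ψ ∘ₗ koszulUnit ψ = LinearMap.id := by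
  refine LinearMap.ext_ring ?_
  simp [koszulAug, koszulUnit]

theorem exists_eq_koszulUnit {f : TensorPow K X 0} {x : koszul ψ 0}
    (hx : x.1 = split ψ (P.l 0) (incl 0 f)) : ∃ c, x = koszulUnit ψ c := by
  have h : 0 + P.l 0 = 0 := by rw [P.l_zero]
  rw [split_incl ψ h] at hx
  refine ⟨f ⟨[], rfl⟩, Subtype.ext (hx.trans ?_)⟩
  have hf : f = Finsupp.single ⟨[], rfl⟩ (f ⟨[], rfl⟩) := by
    ext ⟨w, hw⟩
    obtain rfl := List.length_eq_zero_iff.1 hw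
    simp
  change _ = f ⟨[], rfl⟩ • ((1 : A) ⊗ₜ[K] Finsupp.single emptyWord (1 : K))
  conv_lhs => rw [hf]
  rw [splitBar, Finsupp.linearCombination_single]
  congr 1
  rw [← bar_single_nil ψ]
  rfl

variable [Finite X]

theorem koszulD_eq {n m : ℕ} (hm : P.l (n + 1) ≤ m) {f : TensorPow K X m} {x : koszul ψ (n + 1)}
    (hx : x.1 = split ψ (P.l (n + 1)) (incl m f)) :
    (koszulD ψ n x).1 = split ψ (P.l n) (incl m f) := by
  rw [← koszulF_split ψ hm f, ← hx]
  rfl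

theorem koszulAug_comp_koszulD (x : koszul ψ 1) : koszulAug ψ (koszulD ψ 0 x) = 0 := by
  have : koszulAug ψ ∘ₗ (koszulD ψ 0).restrictScalars K = 0 := by
    refine koszul_hom_ext ψ fun x d m hm f _ hx => ?_
    have h1 : P.l (0 + 1) = 1 := P.l_one
    have hm' : P.l (0 + 1) ≤ m := by omega
    exact koszulAug_eq_zero ψ (by omega) (koszulD_eq ψ hm' hx)
  exact LinearMap.congr_fun this x

variable [LinearOrder X]

/-- `split` kills `I(R)_{m - l_N(n)} ⊗ V^{⊗ l_N(n)}`, so it does not see `F_1^{n,m}`. -/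
theorem split_redOp {n m : ℕ} (hm : P.l n ≤ m) (f : TensorPow K X m) :
    split ψ (P.l n) (incl m (redOp (P.kerF1 n m hm) f)) = split ψ (P.l n) (incl m f) := by
  have h : m - P.l n + P.l n = m := by omega
  rw [split_incl ψ h, split_incl ψ h, eq_comm, ← sub_eq_zero, ← map_sub]
  suffices H : P.kerF1 n m hm ≤ LinearMap.ker (splitBar ψ h) from H (sub_redOp_mem _ f)
  refine iSup₂_le fun t v => ?_
  rintro _ ⟨g, hg, rfl⟩
  rw [LinearMap.mem_ker, splitBar_sandwich_right, bar_incl_of_mem_idealComp ψ hg,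
    TensorProduct.zero_tmul]

theorem concat_split {n m : ℕ} (hm : P.l n ≤ m) (f : TensorPow K X m) :
    concat (P.l n) (TensorProduct.map (normalFormMap ψ) LinearMap.id
      (split ψ (P.l n) (incl m f))) = incl m (redOp (P.kerF1 n m hm) f) := by
  have h : m - P.l n + P.l n = m := by omega
  rw [split_incl ψ h]
  induction f using Finsupp.induction_linear with
  | zero => simp
  | add f g hf hg => simp only [map_add, hf, hg]
  | single w c =>
    have h' : 0 + (m - P.l n) + P.l n = m := by omega
    obtain ⟨t, v, u, rfl⟩ := exists_glue h' w
    rw [← sandwich_single, splitBar_sandwich_right, TensorProduct.map_tmul, normalFormMap_bar,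
      nf_incl, LinearMap.id_apply, concat_incl_tmul_single h' t, kerF1, redOp_tensorSub_sandwich]

theorem phiN_eq {n m : ℕ} (hm : P.l n ≤ m) {f : TensorPow K X m} {x : koszul ψ n}
    (hx : x.1 = split ψ (P.l n) (incl m f)) :
    phiN ψ (normalFormMap ψ) n x = incl m (redOp (P.kerF1 n m hm) f) := by
  rw [← concat_split ψ hm f, ← hx]
  rfl

/-- Cutting undoes `φ_n`, which gives the injectivity of `φ_n` and hence the uniqueness of the left
bound. -/
theorem split_phiN (n : ℕ) (x : koszul ψ n) :
    split ψ (P.l n) (phiN ψ (normalFormMap ψ) n x) = x.1 := by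
  have : split ψ (P.l n) ∘ₗ phiN ψ (normalFormMap ψ) n =
      (koszul ψ n).subtype.restrictScalars K := by
    refine koszul_hom_ext ψ fun x d m hm f _ hx => ?_
    rw [LinearMap.comp_apply, phiN_eq ψ (by omega) hx, split_redOp, ← hx]
    rfl
  exact LinearMap.congr_fun this x

theorem phiN_injective (n : ℕ) : Function.Injective (phiN ψ (normalFormMap ψ) n) := by
  intro x y h
  apply Subtype.ext
  rw [← split_phiN ψ, ← split_phiN ψ, h]

end Splitting

/-! ### The left bound of a presentation -/

section LeftBoundOfPresentation

variable {K X : Type*} [Field K] [LinearOrder X] [Finite X] {P : HomPresentation K X}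

theorem IsExtraConfluent.hPrime_incl (hP : P.IsExtraConfluent) {k : ℕ → ℕ → ℕ}
    (hk : P.AreDegrees k) {n m : ℕ} (hm : P.l n ≤ m) (f : TensorPow K X m) :
    hPrime hk n (incl m f) = incl m (hP.pairBound n m hm f) := by
  induction f using Finsupp.induction_linear with
  | zero => simp
  | add f g hf hg => simp only [map_add, hf, hg]
  | single w c =>
    obtain ⟨w, rfl⟩ := w
    rw [incl_single, hPrime, Finsupp.linearCombination_single, dif_pos hm, hP.pairLeftBound_eq,
      ← map_smul, ← map_smul, Finsupp.smul_single, smul_eq_mul, mul_one]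

theorem IsExtraConfluent.exists_areDegrees (hP : P.IsExtraConfluent) :
    ∃ k : ℕ → ℕ → ℕ, P.AreDegrees k := by
  classical
  have : ∀ n m, ∃ k, ∀ hm : P.l n ≤ m, ConfluentAt (P.reductionPair n m hm) k := by
    intro n m
    by_cases hm : P.l n ≤ m
    · obtain ⟨k, hk⟩ := hP.confluent n m hm
      exact ⟨k, fun _ => hk⟩
    · exact ⟨0, fun h => absurd h hm⟩
  choose k hk using this
  exact ⟨k, hk⟩

theorem IsExtraConfluent.pairBound_eq_zero (hP : P.IsExtraConfluent) {n m : ℕ} (hm : P.l n ≤ m)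
    (h : m < P.l (n + 1)) (f : TensorPow K X m) : hP.pairBound n m hm f = 0 := by
  have hmem := hP.pairBound_apply_mem hm f
  rwa [P.kerF2_eq_bot h, Submodule.mem_bot] at hmem

variable {A : Type*} [Ring A] [Algebra K A] (ψ : A ≃ₐ[K] P.Alg)

theorem IsExtraConfluent.split_pairBound_mem (hP : P.IsExtraConfluent) {n m : ℕ} (hm : P.l n ≤ m)
    (f : TensorPow K X m) :
    split ψ (P.l (n + 1)) (incl m (hP.pairBound n m hm f)) ∈ koszul ψ (n + 1) := by
  rcases lt_or_ge m (P.l (n + 1)) with h | h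
  · rw [hP.pairBound_eq_zero hm h, map_zero, map_zero]
    exact Submodule.zero_mem _
  · have hmem := hP.pairBound_apply_mem hm f
    have h' : m - P.l (n + 1) + P.l (n + 1) + 0 = m := by omega
    rw [P.kerF2_eq_tensorSub h'] at hmem
    exact split_mem_koszul ψ h' hmem

theorem IsExtraConfluent.split_hPrime_phiN_mem (hP : P.IsExtraConfluent) {k : ℕ → ℕ → ℕ}
    (hk : P.AreDegrees k) (n : ℕ) (x : koszul ψ n) :
    split ψ (P.l (n + 1)) (hPrime hk n (phiN ψ (normalFormMap ψ) n x)) ∈ koszul ψ (n + 1) := by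
  set W := (koszul ψ (n + 1)).restrictScalars K with hW
  -- Membership is recast as the vanishing of a linear map, so that it can be tested on the spanning
  -- elements.
  suffices H : W.mkQ ∘ₗ split ψ (P.l (n + 1)) ∘ₗ hPrime hk n ∘ₗ phiN ψ (normalFormMap ψ) n = 0 by
    have := LinearMap.congr_fun H x
    simpa [hW] using this
  refine koszul_hom_ext ψ fun x d m hm f _ hx => ?_
  have hm' : P.l n ≤ m := by omega
  rw [LinearMap.comp_apply, LinearMap.comp_apply, LinearMap.comp_apply, phiN_eq ψ hm' hx,
    hP.hPrime_incl hk hm', LinearMap.zero_apply, Submodule.mkQ_apply,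
    Submodule.Quotient.mk_eq_zero]
  exact hP.split_pairBound_mem ψ hm' _

/-- The left bound `h_n : A ⊗ J_n → A ⊗ J_{n+1}` of the presentation. -/
def IsExtraConfluent.homotopy (hP : P.IsExtraConfluent) (n : ℕ) :
    koszul ψ n →ₗ[K] koszul ψ (n + 1) where
  toFun x := ⟨_, hP.split_hPrime_phiN_mem ψ hP.exists_areDegrees.choose_spec n x⟩
  map_add' x y := Subtype.ext (by simp only [map_add]; rfl)
  map_smul' c x := Subtype.ext (by simp only [map_smul]; rfl)

theorem IsExtraConfluent.homotopy_eq (hP : P.IsExtraConfluent) {n m : ℕ} (hm : P.l n ≤ m)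
    {f : TensorPow K X m} {x : koszul ψ n} (hx : x.1 = split ψ (P.l n) (incl m f)) :
    (hP.homotopy ψ n x).1 = split ψ (P.l (n + 1)) (incl m (hP.pairBound n m hm f)) := by
  change split ψ (P.l (n + 1)) (hPrime _ n (phiN ψ (normalFormMap ψ) n x)) = _
  rw [phiN_eq ψ hm hx, hP.hPrime_incl _ hm, hP.pairBound_redOp]

/-- `φ_{n+1}` after cutting is `F_1^{n+1,m}`, which fixes the values of the bound of bi-degree `(n,
m)`. If `m < l_N(n+1)`, that bound is zero. -/
theorem IsExtraConfluent.isLeftBound_homotopy (hP : P.IsExtraConfluent) {k : ℕ → ℕ → ℕ}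
    (hk : P.AreDegrees k) : IsLeftBound ψ (normalFormMap ψ) hk (hP.homotopy ψ) := by
  intro n
  refine koszul_hom_ext ψ fun x d m hm f _ hx => ?_
  have hm' : P.l n ≤ m := by omega
  rw [LinearMap.comp_apply, LinearMap.comp_apply, phiN_eq ψ hm' hx, hP.hPrime_incl hk hm',
    hP.pairBound_redOp]
  have hx' := hP.homotopy_eq ψ hm' hx
  rcases lt_or_ge m (P.l (n + 1)) with h | h
  · rw [hP.pairBound_eq_zero hm' h, map_zero, map_zero] at hx'
    rw [hP.pairBound_eq_zero hm' h, map_zero, show hP.homotopy ψ n x = 0 from Subtype.ext hx',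
      map_zero]
  · rw [phiN_eq ψ h hx', hP.redOp_pairBound]

theorem IsExtraConfluent.isLeftBound_iff (hP : P.IsExtraConfluent) {k : ℕ → ℕ → ℕ}
    (hk : P.AreDegrees k) (h' : ∀ n, koszul ψ n →ₗ[K] koszul ψ (n + 1)) :
    IsLeftBound ψ (normalFormMap ψ) hk h' ↔ h' = hP.homotopy ψ := by
  constructor
  · intro h
    funext n
    refine LinearMap.ext fun x => phiN_injective ψ (n + 1) ?_
    exact LinearMap.congr_fun ((h n).trans (hP.isLeftBound_homotopy ψ hk n).symm) x
  · rintro rfl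
    exact hP.isLeftBound_homotopy ψ hk

theorem IsExtraConfluent.koszulD_homotopy (hP : P.IsExtraConfluent) {n m : ℕ} (hm : P.l n ≤ m)
    {f : TensorPow K X m} {x : koszul ψ n} (hx : x.1 = split ψ (P.l n) (incl m f)) :
    (koszulD ψ n (hP.homotopy ψ n x)).1 =
      split ψ (P.l n) (incl m (hP.pairBound n m hm f)) := by
  have hx' := hP.homotopy_eq ψ hm hx
  rcases lt_or_ge m (P.l (n + 1)) with h | h
  · rw [hP.pairBound_eq_zero hm h, map_zero, map_zero] at hx' ⊢
    rw [show hP.homotopy ψ n x = 0 from Subtype.ext hx', map_zero]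
    rfl
  · exact koszulD_eq ψ h hx'

theorem IsExtraConfluent.isContractingHomotopy (hP : P.IsExtraConfluent) :
    IsContractingHomotopy ψ (hP.homotopy ψ) where
  aug := koszulAug_koszulUnit ψ
  zero := by
    refine koszul_hom_ext (M := koszul ψ 0) ψ fun x d m hm f _ hx => ?_
    have h0 := P.l_zero
    have h1 := P.l_one
    have hm' : P.l 0 ≤ m := by omega
    have hD := hP.koszulD_homotopy ψ hm' hx
    apply Subtype.ext
    change (koszulD ψ 0 (hP.homotopy ψ 0 x)).1 + (koszulUnit ψ (koszulAug ψ x)).1 = x.1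
    rw [hD]
    -- In degree `0` the bound vanishes and `h_{-1} ε` is the identity; in positive degree `ε`
    -- vanishes and the bound does all the work.
    rcases Nat.eq_zero_or_pos m with rfl | hpos
    · have hlt : 0 < P.l (0 + 1) := by rw [zero_add]; omega
      rw [hP.pairBound_eq_zero hm' hlt, map_zero, map_zero, zero_add]
      obtain ⟨c, rfl⟩ := exists_eq_koszulUnit ψ hx
      rw [show koszulAug ψ (koszulUnit ψ c) = c from
        LinearMap.congr_fun (koszulAug_koszulUnit ψ) c]
    · rw [koszulAug_eq_zero ψ hpos hx, map_zero, ← split_redOp ψ hm',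
        hP.redOp_pairBound_zero hm' (by omega), split_redOp, hx]
      exact add_zero _
  succ n := by
    refine koszul_hom_ext (M := koszul ψ (n + 1)) ψ fun x d m hm f hf hx => ?_
    have hs := P.l_le_succ n
    have hm' : P.l (n + 1) ≤ m := by omega
    have hm'' : P.l n ≤ m := by omega
    have hf' : f ∈ P.kerF2 n m := by rwa [P.kerF2_eq_tensorSub hm]
    apply Subtype.ext
    change (koszulD ψ (n + 1) (hP.homotopy ψ (n + 1) x)).1 +
      (hP.homotopy ψ n (koszulD ψ n x)).1 = x.1
    -- Both composites are cuts, with right factor of length `l_N(n+1)`, of the bounds of bi-degrees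
    -- `(n + 1, m)` and `(n, m)` at the same `f`; `F_1^{n+1,m}` may be inserted before cutting.
    rw [hP.koszulD_homotopy ψ hm' hx, hP.homotopy_eq ψ hm'' (koszulD_eq ψ hm' hx), ← map_add,
      ← map_add, ← split_redOp ψ hm', hP.redOp_pairBound_add hm'' hm' hf', split_redOp, hx]

/-- Two differentials move the cut by `N` letters, and the elements of `J_{n+2}` begin with a
relation in those letters, which vanishes in `A`. -/
theorem koszulD_comp_koszulD (n : ℕ) (x : koszul ψ (n + 2)) :
    koszulD ψ n (koszulD ψ (n + 1) x) = 0 := by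
  have : (koszulD ψ n).restrictScalars K ∘ₗ (koszulD ψ (n + 1)).restrictScalars K = 0 := by
    refine koszul_hom_ext (M := koszul ψ n) ψ fun x d m hm f hf hx => ?_
    have hs := P.l_le_succ n
    have hs' : P.l (n + 1) ≤ P.l (n + 2) := P.l_le_succ (n + 1)
    have hd : d + P.l (n + 2) + 0 = m := hm
    have hm₂ : P.l (n + 2) ≤ m := by omega
    have hm₁ : P.l (n + 1) ≤ m := by omega
    have hm₀ : P.l n ≤ m := by omega
    have hf' : f ∈ P.kerF2 (n + 1) m := by rwa [P.kerF2_eq_tensorSub hm]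
    apply Subtype.ext
    change (koszulD ψ n (koszulD ψ (n + 1) x)).1 = 0
    rw [koszulD_eq ψ hm₁ (koszulD_eq ψ hm₂ hx), ← split_redOp ψ hm₀,
      redOp_apply_eq_zero_iff.2 (P.kerF2_succ_le hm₀ hf').1, map_zero, map_zero]
  exact LinearMap.congr_fun this x

theorem koszulAcyclic_of_isContractingHomotopy
    {h : ∀ n, koszul ψ n →ₗ[K] koszul ψ (n + 1)} (H : IsContractingHomotopy ψ h) :
    KoszulAcyclic ψ where
  surjective c := ⟨koszulUnit ψ c, LinearMap.congr_fun H.aug c⟩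
  exact_zero x := by
    constructor
    · intro hx
      refine ⟨h 0 x, ?_⟩
      have := LinearMap.congr_fun H.zero x
      simpa [hx] using this
    · rintro ⟨y, rfl⟩
      exact koszulAug_comp_koszulD ψ y
  exact_succ n x := by
    constructor
    · intro hx
      refine ⟨h (n + 1) x, ?_⟩
      have := LinearMap.congr_fun (H.succ n) x
      simpa [hx] using this
    · rintro ⟨y, rfl⟩
      exact koszulD_comp_koszulD ψ n y

end LeftBoundOfPresentation
end HomPresentation
end KoszulHomotopy
end

/-! ### The main theorem. -/

open KoszulHomotopy HomPresentation in
theorem mainTheorem1 {K X A : Type*} [Field K] [LinearOrder X] [Finite X] [Ring A] [Algebra K A]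
    (P : HomPresentation K X) (hP : P.IsExtraConfluent) (ψ : A ≃ₐ[K] P.Alg) :
    -- the reduction pairs are confluent
    (∀ n m, (hm : P.l n ≤ m) → Confluent (P.reductionPair n m hm)) ∧
    -- normal forms exist, are unique, and define a linear map on `A`
    ∃ φbar : A →ₗ[K] TensorAlg K X, IsNormalFormMap ψ φbar ∧
    -- the left bound `h` exists, is unique, does not depend on the degrees `k n m`,
    -- and is a contracting homotopy; in particular the Koszul complex is acyclic
    ∃ h : ∀ n, koszul ψ n →ₗ[K] koszul ψ (n + 1),
      (∀ (k : ℕ → ℕ → ℕ) (hk : P.AreDegrees k) (h' : ∀ n, koszul ψ n →ₗ[K] koszul ψ (n + 1)),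
        IsLeftBound ψ φbar hk h' ↔ h' = h) ∧
      IsContractingHomotopy ψ h ∧ KoszulAcyclic ψ := by
  exact ⟨hP.confluent, normalFormMap ψ, isNormalFormMap_normalFormMap ψ hP.1 hP.2.1,
    hP.homotopy ψ, fun _ hk h' => hP.isLeftBound_iff ψ hk h', hP.isContractingHomotopy ψ,
    koszulAcyclic_of_isContractingHomotopy ψ (hP.isContractingHomotopy ψ)⟩
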